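/- Let $n,M,d,k,n_t,n_H\ge 0$ be integers with $k\ge 1$, let $t_0\in\mathbb R$, $\Delta t\ge 0$, $\Lambda\ge 0$, $\Upsilon\in\mathbb R$, $\epsilon\in(0,1]$, and put $I=[t_0,t_0+\Delta t]$; $\|\cdot\|$ is the spectral norm. *Hamiltonians.* Consider $H(t)=\sum_{\mu=1}^M T_\mu^\dagger H_\mu(t)T_\mu$ with unitary $T_\mu$ and $H_\mu:\mathbb R\to\mathbb C^{2^n\times 2^n}$ Hermitian on $I$, such that $\{H_\mu\}$ is $d$-sparse on $I$ (for each $\mu$, at most $d$ elements in each row of $H_\mu(t)$ attain a nonzero value for any $t\in I$) and $\Lambda$-$2k$-smooth on $I$ (the derivatives up to order $2k$ exist on $I$ and $\Lambda\ge(\sum_\mu\|H_\mu^{(p)}(t)\|)^{1/(p+1)}$ for $t\in I$, $0\le p\le 2k$). Let $|(H_\mu(t))_{xy}|\le\Upsilon$ on $I$. Let $U(t_0+\Delta t,t_0)$ be the evolution generated by $H$, i.e. the value at $t_0+\Delta t$ of the solution of $U'=-iH(t)U$, $U(t_0)=1$. *Oracles.* A quantum circuit may use: ColNum, which for classical inputs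 $p,i,\mu$ maps $|x\rangle|b\rangle$ to $|x\rangle|b\oplus f\rangle$ with $f$ the $p$-th bit of the $i$-th entry of a list of $d$ column numbers that contains every column in which row $x$ of $H_\mu$ attains a nonzero value on $I$; MatrixVal, which for classical inputs $p,\mu,q$ maps $|x\rangle|y\rangle|b\rangle$ to $|x\rangle|y\rangle|b\oplus g\rangle$ with $g$ the $p$-th bit of an $n_H$-bit encoding of $(H_\mu(t_q))_{xy}$, where $t_q=t_0+(q-\tfrac12)\Delta t/2^{n_t}$, $1\le q\le 2^{n_t}$; the basis transformations $T_\mu$ and their inverses; and arbitrary unitaries independent of the oracles. The encoding is in polar form $\rho e^{i\phi}$, with $\lfloor n_H/2\rfloor$ bits for $\rho/\Upsilon$ and $\lfloor n_H/2\rfloor$ bits for $\phi/2\pi$, with errors at most $\Upsilon 2^{-\lfloor n_H/2\rfloor}$ in $\rho$ and $2\pi 2^{-\lfloor n_H/2\rfloor}$ in $\phi$. Let $N$ be the number of queries to ColNum and MatrixVal and $N_T$ the number of calls of the $T_\mu$ and $T_\mu^\dagger$. *Cost of a one-sparse Hamiltonian.* Let $C$ be the number of oracle calls needed to simulate a one-sparse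 Hamiltonian: the least $c$ such that, for some rule that uses the lists of column numbers to decompose $d$-sparse Hermitian matrices, by positions of their elements, into $6d^2$ one-sparse Hermitian ones, and for some number of ancilla qubits, for each of the resulting one-sparse terms $\tilde H_{\mu,j}(t_q)$ (with elements as given by MatrixVal to finite precision, the elements above the diagonal determining those below it and diagonal elements being replaced by their real parts) and each real duration $\delta$, a circuit with at most $c$ queries to ColNum and MatrixVal and no calls of the $T_\mu$ implements $e^{-i\delta\tilde H_{\mu,j}(t_q)}$ exactly, whatever Hermitian family on $I$ the oracles describe. *Precision.* Assume $$n_t\ge\left\lceil\log_2\frac{\big(\max_{t\in I,\mu}\|\partial_tH_\mu(t)\|\big)(32kMd^2)(5/3)^{k-1}\Delta t^2}{\epsilon}\right\rceil,\qquad n_H\ge 2\left\lceil\log_2\frac{32kMd^2(5/3)^{k-1}\Upsilon\Delta t}{\epsilon}\right\rceil+6 .$$ (Here $\log_2 0$ is read as $0$.) **Theorem.** There is a single circuit, depending only on $n,M,d,k,n_t,n_H,t_0,\Delta t,\Lambda,\Upsilon,\epsilon$, that for all $H_\mu$, $T_\mu$ and oracles as above implements (mapping $|\psi\rangle|0\rangle$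 to $(\tilde U|\psi\rangle)|0\rangle$ for all $\psi$) an operator $\tilde U$ with $\|U(t_0+\Delta t,t_0)-\tilde U\|\le\epsilon$, and for which $$N\le 12\,C\,M d^2\,5^{k-1}\left\lceil 24kd^2\Lambda\Delta t\left(\frac53\right)^k\left(\frac{6d^2\Lambda\Delta t}{\tilde\epsilon/2}\right)^{1/2k}\right\rceil,\qquad \tilde\epsilon=\min\{\epsilon,18(5/3)^{k-1}d^2\Lambda\Delta t\},$$ and $N_T\le N/(3Cd^2)$. (Quotients with denominator $0$ are read as $0$.) -/

import Mathlib

open scoped Matrix.Norms.L2Operator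

noncomputable section

namespace HamSim

/-! ### Time-dependent Hamiltonians

Matrices of size `2 ^ n` carry the spectral norm (the operator norm for the Euclidean norm). -/

/-- Labels of the computational basis of `n` qubits. -/
abbrev Basis (n : ℕ) : Type := Fin (2 ^ n)

/-- Operators on `n` qubits. -/
abbrev Op (n : ℕ) : Type := Matrix (Basis n) (Basis n) ℂ

/-- The family `H` is `d`-sparse on `S`: in each row of each `H μ` at most `d` matrix elements
attain a nonzero value at some time in `S`. -/
def IsSparseOn {n M : ℕ} (d : ℕ) (H : Fin M → ℝ → Op n) (S : Set ℝ) : Prop :=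
  ∀ μ x, {y : Basis n | ∃ t ∈ S, H μ t x y ≠ 0}.ncard ≤ d

/-- The family `H` is `Λ`-`P`-smooth on `S`: the derivatives up to order `P` exist on `S` and
`(∑ μ, ‖H μ ^ (p) (t)‖) ^ (1 / (p + 1)) ≤ Λ` for all `p ≤ P` and `t ∈ S`. -/
def IsSmoothOn {n M : ℕ} (Λ : ℝ) (P : ℕ) (H : Fin M → ℝ → Op n) (S : Set ℝ) : Prop :=
  (∀ μ, ∀ m < P, DifferentiableOn ℝ (iteratedDerivWithin m (H μ) S) S) ∧
  ∀ p ≤ P, ∀ t ∈ S,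
    (∑ μ, ‖iteratedDerivWithin p (H μ) S t‖) ^ (1 / ((p : ℝ) + 1)) ≤ Λ

/-- The Hamiltonian `∑ μ, (T μ)† H μ (t) (T μ)`. -/
def totalHamiltonian {n M : ℕ} (H : Fin M → ℝ → Op n)
    (T : Fin M → Matrix.unitaryGroup (Basis n) ℂ) (t : ℝ) : Op n :=
  ∑ μ, (T μ : Op n).conjTranspose * H μ t * (T μ : Op n)

/-- `U t` is the time-ordered exponential of `-i G` from `t₀` to `t`, for `t ∈ [t₀, t₀ + Δt]`:
the solution of the Schrödinger equation `U' = -i G U`, `U t₀ = 1`. -/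
def IsEvolution {n : ℕ} (G : ℝ → Op n) (t₀ Δt : ℝ) (U : ℝ → Op n) : Prop :=
  U t₀ = 1 ∧ ∀ t ∈ Set.Icc t₀ (t₀ + Δt),
    HasDerivWithinAt U (-Complex.I • (G t * U t)) (Set.Icc t₀ (t₀ + Δt)) t

/-! ### Oracles -/

/-- The black boxes. `col μ i x` is the `i`-th column number in the list of row `x` of the `μ`-th
Hamiltonian; `val p x y μ q` is the `p`-th bit of the encoding of the matrix element `(x, y)` of
the `μ`-th Hamiltonian at the `q`-th mesh time; `T μ` is the `μ`-th basis transformation. -/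
structure Oracles (n M d nt nH : ℕ) where
  col : Fin M → Fin d → Basis n → Basis n
  val : Fin nH → Basis n → Basis n → Fin M → Fin (2 ^ nt) → Bool
  T : Fin M → Matrix.unitaryGroup (Basis n) ℂ

/-- The mesh times: the midpoints of the `2 ^ nt` equal subintervals of `[t₀, t₀ + Δt]`
(`q` is counted from `0`). -/
def meshTime (t₀ Δt : ℝ) {nt : ℕ} (q : Fin (2 ^ nt)) : ℝ :=
  t₀ + ((q : ℝ) + 1 / 2) * Δt / 2 ^ nt

/-- The binary fraction of the first `nH / 2` bits, which encode the modulus. -/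
def modulusCode {nH : ℕ} (v : Fin nH → Bool) : ℝ :=
  ∑ p : Fin (nH / 2), if v ⟨p, by omega⟩ then (1 / 2 : ℝ) ^ ((p : ℕ) + 1) else 0

/-- The binary fraction of the next `nH / 2` bits, which encode the phase. -/
def phaseCode {nH : ℕ} (v : Fin nH → Bool) : ℝ :=
  ∑ p : Fin (nH / 2), if v ⟨nH / 2 + p, by omega⟩ then (1 / 2 : ℝ) ^ ((p : ℕ) + 1) else 0

/-- The complex number with modulus `Υ * modulusCode v` and phase `2 π * phaseCode v`. -/
def decode {nH : ℕ} (Υ : ℝ) (v : Fin nH → Bool) : ℂ :=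
  ((Υ * modulusCode v : ℝ) : ℂ) *
    Complex.exp (Complex.I * ((2 * Real.pi * phaseCode v : ℝ) : ℂ))

/-- The oracles `O` describe the Hamiltonians `H` on `[t₀, t₀ + Δt]`: `Υ` bounds all matrix
elements, the list of `d` column numbers of each row contains every column in which a nonzero value
is attained, and `val` gives the matrix elements at the mesh times in polar form, modulus and phase
with `nH / 2` bits each. -/
structure Oracles.Describes {n M d nt nH : ℕ} (O : Oracles n M d nt nH)
    (H : Fin M → ℝ → Op n) (t₀ Δt Υ : ℝ) : Prop where
  bound : ∀ μ, ∀ t ∈ Set.Icc t₀ (t₀ + Δt), ∀ x y, ‖H μ t x y‖ ≤ Υ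
  col_spec : ∀ μ x y, (∃ t ∈ Set.Icc t₀ (t₀ + Δt), H μ t x y ≠ 0) → ∃ i, O.col μ i x = y
  val_spec : ∀ μ q x y, ∃ ρ φ : ℝ, 0 ≤ ρ ∧
    H μ (meshTime t₀ Δt q) x y = (ρ : ℂ) * Complex.exp (Complex.I * (φ : ℂ)) ∧
    |ρ - Υ * modulusCode (fun p => O.val p x y μ q)| ≤ Υ / 2 ^ (nH / 2) ∧
    |φ - 2 * Real.pi * phaseCode (fun p => O.val p x y μ q)| ≤ 2 * Real.pi / 2 ^ (nH / 2)

/-! ### Quantum circuits with oracle calls -/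

/-- Basis labels of the registers: the `n`-qubit system register (which is also the first input of
the oracles), a second `n`-qubit input register, the oracle output qubit, and `a` ancilla qubits. -/
abbrev Reg (n a : ℕ) : Type := Basis n × Basis n × Bool × (Fin a → Bool)

/-- One step of a circuit: a unitary that does not depend on the oracles, a query for the `p`-th bit
of a column number, a query for the `p`-th bit of a matrix element, or a call of a basis
transformation or of its inverse. The bit, list, Hamiltonian and time indices are classical. -/
inductive Gate (n M d nt nH a : ℕ) : Type
  | unitary (V : Matrix.unitaryGroup (Reg n a) ℂ)
  | colNum (p : Fin n) (i : Fin d) (μ : Fin M)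
  | matrixVal (p : Fin nH) (μ : Fin M) (q : Fin (2 ^ nt))
  | basisChange (μ : Fin M)
  | basisChangeInv (μ : Fin M)

/-- A circuit, first gate first. -/
abbrev Circuit (n M d nt nH a : ℕ) : Type := List (Gate n M d nt nH a)

/-- The operation `|x⟩|y⟩|b⟩|w⟩ ↦ |x⟩|y⟩|b ⊕ f x y⟩|w⟩`. -/
def queryMatrix {n a : ℕ} (f : Basis n → Basis n → Bool) : Matrix (Reg n a) (Reg n a) ℂ :=
  fun r s => if r = (s.1, s.2.1, xor s.2.2.1 (f s.1 s.2.1), s.2.2.2) then 1 else 0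

/-- The operator `A` applied to the system register. -/
def onSystem {n a : ℕ} (A : Op n) : Matrix (Reg n a) (Reg n a) ℂ :=
  fun r s => if r.2 = s.2 then A r.1 s.1 else 0

/-- The action of a gate, given the oracles. -/
def Gate.toMatrix {n M d nt nH a : ℕ} (O : Oracles n M d nt nH) :
    Gate n M d nt nH a → Matrix (Reg n a) (Reg n a) ℂ
  | .unitary V => V
  | .colNum p i μ => queryMatrix fun x _ => (O.col μ i x : ℕ).testBit p
  | .matrixVal p μ q => queryMatrix fun x y => O.val p x y μ q
  | .basisChange μ => onSystem (O.T μ : Op n)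
  | .basisChangeInv μ => onSystem (O.T μ : Op n).conjTranspose

/-- The action of a circuit, given the oracles. -/
def Circuit.run {n M d nt nH a : ℕ} (O : Oracles n M d nt nH) :
    Circuit n M d nt nH a → Matrix (Reg n a) (Reg n a) ℂ
  | [] => 1
  | g :: c => Circuit.run O c * g.toMatrix O

/-- Queries to the two oracles for the Hamiltonians. -/
def Gate.isQuery {n M d nt nH a : ℕ} : Gate n M d nt nH a → Bool
  | .colNum _ _ _ => true
  | .matrixVal _ _ _ => true
  | _ => false

/-- Calls of the basis transformations (or their inverses). -/
def Gate.isBasisCall {n M d nt nH a : ℕ} : Gate n M d nt nH a → Bool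
  | .basisChange _ => true
  | .basisChangeInv _ => true
  | _ => false

/-- Number of queries to the two oracles for the Hamiltonians. -/
def Circuit.numQueries {n M d nt nH a : ℕ} (c : Circuit n M d nt nH a) : ℕ :=
  List.countP Gate.isQuery c

/-- Number of calls of the basis transformations. -/
def Circuit.numBasisCalls {n M d nt nH a : ℕ} (c : Circuit n M d nt nH a) : ℕ :=
  List.countP Gate.isBasisCall c

/-- The state of all registers other than the system before and after the computation. -/
def blank (n a : ℕ) : Basis n × Bool × (Fin a → Bool) :=
  (⟨0, Nat.two_pow_pos n⟩, false, fun _ => false)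

/-- With oracles `O`, the circuit maps `|ψ⟩|0⟩` to `(V |ψ⟩)|0⟩` for all `ψ`. -/
def Circuit.Implements {n M d nt nH a : ℕ} (c : Circuit n M d nt nH a)
    (O : Oracles n M d nt nH) (V : Op n) : Prop :=
  ∀ (r : Reg n a) (x : Basis n),
    Circuit.run O c r (x, blank n a) = if r.2 = blank n a then V r.1 x else 0

/-! ### The cost of a one-sparse exponential -/

/-- `x` and `y` occur in each other's lists of column numbers. -/
def Linked {n d : ℕ} (col : Fin d → Basis n → Basis n) (x y : Basis n) : Prop :=
  (∃ i, col i x = y) ∧ ∃ i, col i y = x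

/-- A rule that decomposes `d`-sparse Hermitian matrices into `6 d ^ 2` one-sparse Hermitian ones:
from the lists of column numbers it assigns to every linked position `(x, y)` an index below
`6 d ^ 2`, the same one to `(y, x)`, and different ones to different positions in a row. -/
def IsOneSparseDecomposition {n d : ℕ}
    (label : (Fin d → Basis n → Basis n) → Basis n → Basis n → ℕ) : Prop :=
  ∀ col x y, Linked col x y →
    label col x y < 6 * d ^ 2 ∧ label col y x = label col x y ∧
    ∀ y', Linked col x y' → label col x y' = label col x y → y' = y

open scoped Classical in
/-- The `j`-th one-sparse term of the `μ`-th Hamiltonian at the `q`-th mesh time, as the oracles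
give it with finite precision. The element with row number less than column number determines its
transposed one, and diagonal elements are made real, so that the term is Hermitian. -/
def oneSparseTerm {n M d nt nH : ℕ}
    (label : (Fin d → Basis n → Basis n) → Basis n → Basis n → ℕ)
    (O : Oracles n M d nt nH) (Υ : ℝ) (μ : Fin M) (j : ℕ) (q : Fin (2 ^ nt)) : Op n :=
  fun x y =>
    if Linked (O.col μ) x y ∧ label (O.col μ) x y = j then
      if x < y then decode Υ (fun p => O.val p x y μ q)
      else if y < x then (starRingEnd ℂ) (decode Υ (fun p => O.val p y x μ q))
      else ((decode Υ (fun p => O.val p x x μ q)).re : ℂ)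
    else 0

/-- With `c` queries one can simulate the exponential of every one-sparse term, for every duration:
for some decomposition rule and some number of ancilla qubits, and for each `μ`, `j`, `q` and
duration `δ`, a circuit with at most `c` queries implements `exp (-i δ H̃)`, with `H̃` the
one-sparse term given by the oracles, whichever Hermitian family the oracles describe. -/
def OneSparseSimulable (n M d nt nH : ℕ) (t₀ Δt Υ : ℝ) (c : ℕ) : Prop :=
  ∃ label : (Fin d → Basis n → Basis n) → Basis n → Basis n → ℕ,
    IsOneSparseDecomposition label ∧
    ∃ a : ℕ, ∀ (μ : Fin M) (j : ℕ) (_ : j < 6 * d ^ 2) (q : Fin (2 ^ nt)) (δ : ℝ),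
      ∃ S : Circuit n M d nt nH a, S.numQueries ≤ c ∧ S.numBasisCalls = 0 ∧
        ∀ (H : Fin M → ℝ → Op n) (O : Oracles n M d nt nH),
          (∀ ν, ∀ t ∈ Set.Icc t₀ (t₀ + Δt), (H ν t).IsHermitian) →
          O.Describes H t₀ Δt Υ →
          S.Implements O
            (NormedSpace.exp ((-Complex.I * (δ : ℂ)) • oneSparseTerm label O Υ μ j q))

/-- The number of oracle calls needed to simulate a one-sparse Hamiltonian. -/
def oneSparseCost (n M d nt nH : ℕ) (t₀ Δt Υ : ℝ) : ℕ :=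
  sInf {c : ℕ | OneSparseSimulable n M d nt nH t₀ Δt Υ c}

/-- The reduced tolerance `min {ε, 18 (5/3) ^ (k-1) d ^ 2 Λ Δt}`. -/
def reducedTolerance (d k : ℕ) (Λ Δt ε : ℝ) : ℝ :=
  min ε (18 * (5 / 3 : ℝ) ^ (k - 1) * (d : ℝ) ^ 2 * Λ * Δt)

end HamSim

end

/-!
The circuit is Suzuki's product formula of order `2 k`, applied in `r` equal time steps to the
`6 M d ^ 2` one-sparse terms of the Hamiltonian; a step consists of `5 ^ (k - 1)` symmetric second
order products. The proof has four parts.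

*Local error.* Around the centre of a time step every generator is replaced by its Taylor polynomial
of degree below `2 k`. The cost of this is a power `2 k + 1` of the step length
(`sum_norm_sub_taylorPolynomial_le`), and for polynomial generators the exact propagator and the
product formula are entire functions of the (complex) step length. A symmetric step is undone by
the step with opposite sign, so the difference of two of them vanishes to an odd order, and
Suzuki's choice of the durations removes the leading coefficient
(`IsSymmetricStep.vanishesToOrder_add_two`, `vanishesToOrder_suzuki`). Hence the difference has a
zero of order `2 k + 1`, and the Schwarz lemma (`norm_le_of_eq_pow_smul`) converts the crude bound
`2 exp (σ R b)` on a circle of radius `R` into an explicit error bound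
(`norm_suzuki_sub_propagator_le`, `norm_evolution_sub_suzukiStep_le`). Here `σ` is the total length
of the schedule, counting backward steps positively; Bernoulli's inequality gives
`σ ≤ k (5 / 3) ^ (k - 1)` (`sum_abs_suzukiSchedule_le`).

*Global error.* All factors are unitary, so errors add up over the steps, and the errors due to the
mesh of times and to the finite number of bits enter linearly
(`norm_evolution_sub_oracleFormula_le`). The number of steps and the precision in the theorem make
the total at most `ε` (`stepCount_bound`, `precision_error_le`).

*Circuit.* Within one Hamiltonian all terms are simulated between a single pair of basis changes
(`strangCircuit`), which gives `4 M 5 ^ (k - 1) r` basis calls and at most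
`12 C M d ^ 2 5 ^ (k - 1) r` queries. As the number of basis calls has to be bounded in terms of the
queries actually made, the circuit is padded with queries that act trivially because the output
qubit is in the state `|0⟩ + |1⟩` (`exists_padding_circuit`).

*The cost `C`.* It is an infimum of natural numbers, so it has to be shown that some number of
queries suffices at all (`exists_oneSparseSimulable`). A decomposition rule exists by greedy edge
colouring (`exists_isOneSparseDecomposition`), and a circuit that reads all answers of the oracles
into ancillas, applies the exponential controlled by them, and clears the ancillas again simulates
the terms (`exists_circuit_of_answers`). If `C = 0`, then every one-sparse exponential agrees with
the one for the zero Hamiltonian (`exp_oneSparseTerm_eq_one`), so the product formula equals `1`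
and the empty circuit suffices; it also serves where the Hamiltonian or the duration is zero.
-/

noncomputable section

namespace HamSim

/-! ### Entire functions vanishing to a given order -/

section ComplexAnalysis

variable {E : Type*} [NormedAddCommGroup E] [NormedSpace ℂ E] [CompleteSpace E]

/-- If `F c z` is continuous in both variables, entire in `z`, and zero for `z = 0`, then `F c z / z`
is continuous in both variables. -/
theorem exists_continuous_div {F : ℂ → ℂ → E} (hF : Continuous (Function.uncurry F))
    (hd : ∀ c, Differentiable ℂ (F c)) (h0 : ∀ c, F c 0 = 0) :
    ∃ G : ℂ → ℂ → E, Continuous (Function.uncurry G) ∧ ∀ c z, F c z = z • G c z := by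
  have hG : ∀ c, Differentiable ℂ (dslope (F c) 0) := fun c => by
    rw [← differentiableOn_univ, Complex.differentiableOn_dslope Filter.univ_mem]
    exact (hd c).differentiableOn
  refine ⟨fun c => dslope (F c) 0, ?_, fun c z => ?_⟩
  · rw [continuous_iff_continuousAt]
    rintro ⟨c₀, z₀⟩
    rw [Metric.continuousAt_iff']
    intro η hη
    set R : ℝ := ‖z₀‖ + 1 with hR
    have hRpos : 0 < R := by positivity
    -- `F c` is uniformly close to `F c₀` on the circle of radius `R`
    have h1 : ∀ᶠ c in nhds c₀, ∀ z ∈ Metric.sphere (0 : ℂ) R, ‖F c z - F c₀ z‖ < R * (η / 2) := by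
      refine (isCompact_sphere (0 : ℂ) R).eventually_forall_of_forall_eventually
        (P := fun c z => ‖F c z - F c₀ z‖ < R * (η / 2)) fun y _ => ?_
      have hc : Continuous fun q : ℂ × ℂ => ‖F q.1 q.2 - F c₀ q.2‖ :=
        (hF.sub (hF.comp (by fun_prop : Continuous fun q : ℂ × ℂ => (c₀, q.2)))).norm
      have := hc.continuousAt (x := (c₀, y))
      refine this.eventually (gt_mem_nhds ?_)
      simp only [sub_self, norm_zero]; positivity
    have h2 : ∀ᶠ z in nhds z₀, dist (dslope (F c₀) 0 z) (dslope (F c₀) 0 z₀) < η / 2 :=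
      Metric.continuousAt_iff'.1 (hG c₀).continuous.continuousAt _ (half_pos hη)
    have h3 : ∀ᶠ z in nhds z₀, z ∈ Metric.ball (0 : ℂ) R :=
      Metric.isOpen_ball.mem_nhds (by simp [hR])
    rw [nhds_prod_eq]
    filter_upwards [h1.prod_mk (h2.and h3)] with ⟨c, z⟩ ⟨hc, hz2, hz3⟩
    have key : ‖dslope (F c) 0 z - dslope (F c₀) 0 z‖ ≤ η / 2 := by
      refine Complex.norm_le_of_forall_mem_frontier_norm_le
        (f := fun z => dslope (F c) 0 z - dslope (F c₀) 0 z) Metric.isBounded_ball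
        ((hG c).sub (hG c₀)).diffContOnCl (fun w hw => ?_) (subset_closure hz3)
      rw [frontier_ball _ hRpos.ne'] at hw
      have hw0 : ‖w‖ = R := by simpa using hw
      have hwne : w ≠ 0 := by rintro rfl; simp at hw0; linarith
      have := hc w hw
      rw [dslope_of_ne _ hwne, dslope_of_ne _ hwne]
      simp only [slope, h0, vsub_eq_sub, sub_zero, ← smul_sub, norm_smul, norm_inv, hw0]
      rw [inv_mul_le_iff₀ hRpos]; exact this.le
    calc dist (dslope (F c) 0 z) (dslope (F c₀) 0 z₀)
        ≤ dist (dslope (F c) 0 z) (dslope (F c₀) 0 z)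
          + dist (dslope (F c₀) 0 z) (dslope (F c₀) 0 z₀) := dist_triangle _ _ _
      _ < η / 2 + η / 2 := by
          rw [dist_eq_norm (dslope (F c) 0 z)]; exact add_lt_add_of_le_of_lt key hz2
      _ = η := add_halves η
  · have := sub_smul_dslope (F c) 0 z
    simpa [h0] using this.symm

/-- A continuous quotient of an entire function by a power of the variable is entire. -/
theorem differentiable_of_eq_pow_smul {f g : ℂ → E} {N : ℕ} (hf : Differentiable ℂ f)
    (hg : Continuous g) (h : ∀ z, f z = z ^ N • g z) : Differentiable ℂ g := by
  rw [← differentiableOn_univ,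
    ← Complex.differentiableOn_compl_singleton_and_continuousAt_iff (c := 0) Filter.univ_mem]
  refine ⟨fun z hz => ?_, hg.continuousAt⟩
  have hz0 : z ≠ 0 := by simpa using hz
  have h1 : DifferentiableAt ℂ (fun w : ℂ => (w ^ N)⁻¹ • f w) z :=
    ((differentiableAt_id.pow N).inv (pow_ne_zero N hz0)).smul (hf z)
  refine (h1.congr_of_eventuallyEq ?_).differentiableWithinAt
  filter_upwards [isOpen_ne.mem_nhds hz0] with w hw
  rw [h w, smul_smul, inv_mul_cancel₀ (pow_ne_zero N hw), one_smul]

/-- A Schwarz lemma: an entire function with a zero of order `N` at the origin that is bounded by `C`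
on the circle of radius `R` is bounded by `C (‖z‖ / R) ^ N` inside. -/
theorem norm_le_of_eq_pow_smul {f g : ℂ → E} {N : ℕ} {R C : ℝ} (hf : Differentiable ℂ f)
    (hg : Continuous g) (h : ∀ z, f z = z ^ N • g z) (hR : 0 < R)
    (hC : ∀ z : ℂ, ‖z‖ = R → ‖f z‖ ≤ C) {z : ℂ} (hz : ‖z‖ ≤ R) :
    ‖f z‖ ≤ C * (‖z‖ / R) ^ N := by
  have hgd := differentiable_of_eq_pow_smul hf hg h
  have key : ‖g z‖ ≤ C / R ^ N := by
    refine Complex.norm_le_of_forall_mem_frontier_norm_le (Metric.isBounded_ball (x := (0 : ℂ)))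
      hgd.diffContOnCl (fun w hw => ?_) (U := Metric.ball 0 R) ?_
    · rw [frontier_ball _ hR.ne'] at hw
      have hw0 : ‖w‖ = R := by simpa using hw
      have := hC w hw0
      rw [h w, norm_smul, norm_pow, hw0] at this
      rw [le_div_iff₀ (by positivity)]; linarith
    · rw [closure_ball _ hR.ne']; simpa using hz
  rw [h z, norm_smul, norm_pow, div_pow]
  calc ‖z‖ ^ N * ‖g z‖ ≤ ‖z‖ ^ N * (C / R ^ N) := by gcongr
    _ = C * (‖z‖ ^ N / R ^ N) := by ring

/-! ### Linear differential equations in the complex domain -/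

/-- The terms of the Dyson series of `Y' = B Y`: each is the primitive, zero at the origin, of `B`
applied to the previous one. -/
def dysonTerm (B : ℂ → E →L[ℂ] E) (hB : Differentiable ℂ B) (y₀ : E) :
    ℕ → {f : ℂ → E // Differentiable ℂ f}
  | 0 => ⟨fun _ => y₀, differentiable_const _⟩
  | n + 1 =>
    have h : Differentiable ℂ fun z => B z ((dysonTerm B hB y₀ n).1 z) :=
      hB.clm_apply (dysonTerm B hB y₀ n).2
    ⟨(h.isExactOn_univ.with_val_at 0 0).choose,
      fun z => ((h.isExactOn_univ.with_val_at 0 0).choose_spec.2 z trivial).differentiableAt⟩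

variable {B : ℂ → E →L[ℂ] E} (hB : Differentiable ℂ B) (y₀ : E)

theorem dysonTerm_succ_zero (n : ℕ) : (dysonTerm B hB y₀ (n + 1)).1 0 = 0 := by
  have h : Differentiable ℂ fun z => B z ((dysonTerm B hB y₀ n).1 z) :=
    hB.clm_apply (dysonTerm B hB y₀ n).2
  exact (h.isExactOn_univ.with_val_at 0 0).choose_spec.1

theorem hasDerivAt_dysonTerm_succ (n : ℕ) (z : ℂ) :
    HasDerivAt (dysonTerm B hB y₀ (n + 1)).1 (B z ((dysonTerm B hB y₀ n).1 z)) z := by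
  have h : Differentiable ℂ fun z => B z ((dysonTerm B hB y₀ n).1 z) :=
    hB.clm_apply (dysonTerm B hB y₀ n).2
  exact (h.isExactOn_univ.with_val_at 0 0).choose_spec.2 z trivial

theorem norm_dysonTerm_le {R b : ℝ} (hb : 0 ≤ b) (hBb : ∀ z : ℂ, ‖z‖ ≤ R → ‖B z‖ ≤ b) (n : ℕ) :
    ∀ z : ℂ, ‖z‖ ≤ R → ‖(dysonTerm B hB y₀ n).1 z‖ ≤ ‖y₀‖ * ((b * ‖z‖) ^ n / n.factorial) := by
  induction n with
  | zero => intro z _; simp [dysonTerm]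
  | succ n ih =>
    intro z hz
    have hpath : ∀ t : ℝ, HasDerivAt (fun t : ℝ => (t : ℂ) * z) z t := fun t => by
      simpa using (Complex.ofRealCLM.hasDerivAt (x := t)).mul_const z
    have hD : ∀ t : ℝ, HasDerivAt (fun t : ℝ => (dysonTerm B hB y₀ (n + 1)).1 (t * z))
        (z • B (t * z) ((dysonTerm B hB y₀ n).1 (t * z))) t := fun t =>
      (hasDerivAt_dysonTerm_succ hB y₀ n (t * z)).scomp t (hpath t)
    have hbd : ∀ t : ℝ, HasDerivAt
        (fun t : ℝ => ‖y₀‖ * ((b * ‖z‖) ^ (n + 1) * t ^ (n + 1) / (n + 1).factorial))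
        (‖y₀‖ * ((b * ‖z‖) ^ (n + 1) * t ^ n / n.factorial)) t := fun t => by
      have := (((hasDerivAt_pow (n + 1) t).const_mul ((b * ‖z‖) ^ (n + 1))).div_const
        ((n + 1).factorial : ℝ)).const_mul ‖y₀‖
      convert! this using 1
      rw [Nat.factorial_succ]; push_cast; field_simp
    have := image_norm_le_of_norm_deriv_right_le_deriv_boundary (a := 0) (b := 1)
      (f := fun t : ℝ => (dysonTerm B hB y₀ (n + 1)).1 (t * z))
      (f' := fun t : ℝ => z • B (t * z) ((dysonTerm B hB y₀ n).1 (t * z)))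
      (fun t _ => (hD t).continuousAt.continuousWithinAt) (fun t _ => (hD t).hasDerivWithinAt)
      (B := fun t => ‖y₀‖ * ((b * ‖z‖) ^ (n + 1) * t ^ (n + 1) / (n + 1).factorial))
      (by simp [dysonTerm_succ_zero]) hbd (fun t ht => ?_) (x := 1) (by simp)
    · simpa using this
    · have htz : ‖(t : ℂ) * z‖ = t * ‖z‖ := by simp [abs_of_nonneg ht.1]
      have hle : ‖(t : ℂ) * z‖ ≤ R := by
        rw [htz]; nlinarith [norm_nonneg z, ht.1, ht.2]
      calc ‖z • B (t * z) ((dysonTerm B hB y₀ n).1 (t * z))‖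
          ≤ ‖z‖ * (b * (‖y₀‖ * ((b * ‖(t : ℂ) * z‖) ^ n / n.factorial))) := by
            rw [norm_smul]
            gcongr
            exact (ContinuousLinearMap.le_opNorm _ _).trans
              (mul_le_mul (hBb _ hle) (ih _ hle) (norm_nonneg _) hb)
        _ = _ := by rw [htz]; ring

/-- A linear differential equation with entire coefficients has an entire solution. -/
theorem exists_entire_solution {B : ℂ → E →L[ℂ] E} (hB : Differentiable ℂ B) (y₀ : E) :
    ∃ Y : ℂ → E, Y 0 = y₀ ∧ ∀ z, HasDerivAt Y (B z (Y z)) z := by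
  refine ⟨fun z => ∑' n, (dysonTerm B hB y₀ n).1 z, ?_, fun z => ?_⟩
  · beta_reduce
    rw [tsum_eq_single 0]
    · rfl
    · intro n hn
      obtain ⟨m, rfl⟩ := Nat.exists_eq_succ_of_ne_zero hn
      exact dysonTerm_succ_zero hB y₀ m
  · set R : ℝ := ‖z‖ + 1
    obtain ⟨b, hb⟩ := (isCompact_closedBall (0 : ℂ) R).exists_bound_of_continuousOn
      hB.continuous.continuousOn
    have hb' : ∀ w : ℂ, ‖w‖ ≤ R → ‖B w‖ ≤ b := fun w hw => hb w (by simpa using hw)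
    have hb0 : 0 ≤ b := (norm_nonneg _).trans (hb' 0 (by simp; positivity))
    have hsum : ∀ w : ℂ, ‖w‖ ≤ R → Summable fun n => (dysonTerm B hB y₀ n).1 w := fun w hw =>
      .of_norm_bounded ((Real.summable_pow_div_factorial (b * ‖w‖)).mul_left ‖y₀‖)
        fun n => norm_dysonTerm_le hB y₀ hb0 hb' n w hw
    have hzR : ‖z‖ ≤ R := by simp [R]
    let D' : ℕ → ℂ → E := fun n w => match n with
      | 0 => 0
      | m + 1 => B w ((dysonTerm B hB y₀ m).1 w)
    let u : ℕ → ℝ := fun n => match n with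
      | 0 => 0
      | m + 1 => b * (‖y₀‖ * ((b * R) ^ m / m.factorial))
    have hu : Summable u := (summable_nat_add_iff 1).1
      (((Real.summable_pow_div_factorial (b * R)).mul_left ‖y₀‖).mul_left b)
    have key := hasDerivAt_tsum_of_isPreconnected (y₀ := z) (y := z) (t := Metric.ball 0 R)
      (g := fun n w => (dysonTerm B hB y₀ n).1 w) (g' := D') hu Metric.isOpen_ball
      (convex_ball _ _).isPreconnected ?_ ?_ (by simp [R]) (hsum z hzR) (by simp [R])
    · convert! key using 1
      have hs' : Summable fun n => D' n z := (summable_nat_add_iff 1).1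
        ((hsum z hzR).map (B z) (B z).continuous)
      rw [hs'.tsum_eq_zero_add, (B z).map_tsum (hsum z hzR)]
      simp [D']
    · rintro (_ | m) w _
      · exact hasDerivAt_const _ _
      · exact hasDerivAt_dysonTerm_succ hB y₀ m w
    · rintro (_ | m) w hw
      · simp [D', u]
      · have hw' : ‖w‖ ≤ R := by simpa using (Metric.mem_ball.1 hw).le
        refine (ContinuousLinearMap.le_opNorm _ _).trans (mul_le_mul (hb' w hw') ?_
          (norm_nonneg _) hb0)
        refine (norm_dysonTerm_le hB y₀ hb0 hb' m w hw').trans ?_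
        gcongr

end ComplexAnalysis

/-- Grönwall's bound for an entire solution, along rays from the origin. -/
theorem norm_solution_le {E : Type*} [NormedAddCommGroup E] [NormedSpace ℂ E] {B : ℂ → E →L[ℂ] E}
    {Y : ℂ → E} (hY : ∀ z, HasDerivAt Y (B z (Y z)) z) {R b : ℝ}
    (hBb : ∀ z : ℂ, ‖z‖ ≤ R → ‖B z‖ ≤ b) {z : ℂ} (hz : ‖z‖ ≤ R) :
    ‖Y z‖ ≤ ‖Y 0‖ * Real.exp (b * ‖z‖) := by
  have hpath : ∀ t : ℝ, HasDerivAt (fun t : ℝ => (t : ℂ) * z) z t := fun t => by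
    simpa using (Complex.ofRealCLM.hasDerivAt (x := t)).mul_const z
  have hD : ∀ t : ℝ, HasDerivAt (fun t : ℝ => Y (t * z)) (z • B (t * z) (Y (t * z))) t := fun t =>
    (hY (t * z)).scomp t (hpath t)
  have := norm_le_gronwallBound_of_norm_deriv_right_le (a := 0) (b := 1) (δ := ‖Y 0‖)
    (K := b * ‖z‖) (ε := 0) (f := fun t : ℝ => Y (t * z))
    (fun t _ => (hD t).continuousAt.continuousWithinAt) (fun t _ => (hD t).hasDerivWithinAt)
    (by simp) (fun t ht => ?_) 1 (by simp)
  · simpa [gronwallBound_ε0] using this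
  · have htz : ‖(t : ℂ) * z‖ = t * ‖z‖ := by simp [abs_of_nonneg ht.1]
    have hle : ‖(t : ℂ) * z‖ ≤ R := by
      rw [htz]; nlinarith [norm_nonneg z, ht.1, ht.2]
    rw [norm_smul, add_zero]
    calc ‖z‖ * ‖B (t * z) (Y (t * z))‖ ≤ ‖z‖ * (b * ‖Y (t * z)‖) := by
          gcongr
          exact (ContinuousLinearMap.le_opNorm _ _).trans (by gcongr; exact hBb _ hle)
      _ = _ := by ring

/-! ### Exponentials and ordered products -/

section Products

set_option linter.unusedSectionVars false

variable {𝔸 : Type*} [NormedRing 𝔸] [NormedAlgebra ℂ 𝔸] [CompleteSpace 𝔸] {ι : Type*}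

theorem exp_neg_mul_exp (x : 𝔸) : NormedSpace.exp (-x) * NormedSpace.exp x = 1 := by
  let +nondep : NormedAlgebra ℚ 𝔸 := .restrictScalars ℚ ℂ 𝔸
  rw [← NormedSpace.exp_add_of_commute (Commute.refl x).neg_left, neg_add_cancel,
    NormedSpace.exp_zero]

theorem differentiable_exp : Differentiable ℂ (NormedSpace.exp : 𝔸 → 𝔸) := fun x =>
  (NormedSpace.exp_analytic (𝕂 := ℂ) x).differentiableAt

theorem norm_exp_le_exp_norm [NormOneClass 𝔸] (x : 𝔸) :
    ‖NormedSpace.exp x‖ ≤ Real.exp ‖x‖ := by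
  rw [← (NormedSpace.exp_series_hasSum_exp' (𝕂 := ℂ) x).tsum_eq, Real.exp_eq_exp_ℝ,
    ← (NormedSpace.exp_series_hasSum_exp' (𝕂 := ℝ) ‖x‖).tsum_eq]
  refine tsum_of_norm_bounded (NormedSpace.exp_series_hasSum_exp' (𝕂 := ℝ) ‖x‖).summable.hasSum
    fun n => ?_
  rw [norm_smul]
  simp only [norm_inv, RCLike.norm_natCast, smul_eq_mul]
  gcongr
  exact norm_pow_le x n

theorem differentiable_list_prod {F : Type*} [NormedAddCommGroup F] [NormedSpace ℂ F]
    (l : List ι) {f : ι → F → 𝔸} (h : ∀ i, Differentiable ℂ (f i)) :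
    Differentiable ℂ fun x => (l.map fun i => f i x).prod := by
  induction l with
  | nil => simp
  | cons i l ih => simpa using (h i).fun_mul ih

theorem norm_list_prod_le [NormOneClass 𝔸] (l : List ι) {f : ι → 𝔸} {g : ι → ℝ}
    (h : ∀ i ∈ l, ‖f i‖ ≤ Real.exp (g i)) :
    ‖(l.map f).prod‖ ≤ Real.exp (l.map g).sum := by
  induction l with
  | nil => simp
  | cons i l ih =>
    simp only [List.map_cons, List.prod_cons, List.sum_cons, Real.exp_add]
    exact (norm_mul_le _ _).trans (mul_le_mul (h i (by simp))
      (ih fun j hj => h j (by simp [hj])) (norm_nonneg _) (Real.exp_nonneg _))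

/-- Errors add up in products of contractions. -/
theorem norm_list_prod_sub_le [NormOneClass 𝔸] (l : List ι) {f g : ι → 𝔸}
    (hf : ∀ i ∈ l, ‖f i‖ ≤ 1) (hg : ∀ i ∈ l, ‖g i‖ ≤ 1) :
    ‖(l.map f).prod - (l.map g).prod‖ ≤ (l.map fun i => ‖f i - g i‖).sum := by
  induction l with
  | nil => simp
  | cons i l ih =>
    simp only [List.map_cons, List.prod_cons, List.sum_cons]
    have hgl : ‖(l.map g).prod‖ ≤ 1 := by
      have := norm_list_prod_le l (f := g) (g := fun _ => 0) fun j hj => by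
        simpa using hg j (by simp [hj])
      simpa using this
    have e : f i * (l.map f).prod - g i * (l.map g).prod
        = f i * ((l.map f).prod - (l.map g).prod) + (f i - g i) * (l.map g).prod := by
      noncomm_ring
    rw [e, add_comm]
    refine (norm_add_le _ _).trans (add_le_add ?_ ?_)
    · exact (norm_mul_le _ _).trans (mul_le_of_le_one_right (norm_nonneg _) hgl)
    · refine (norm_mul_le _ _).trans ((mul_le_of_le_one_left (norm_nonneg _) (hf i (by simp))).trans
        (ih (fun j hj => hf j (by simp [hj])) fun j hj => hg j (by simp [hj])))

/-- The symmetric second order product `∏ exp (z X i / 2) * ∏ exp (z X i / 2)`, the second product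
in reversed order. -/
def strang (l : List ι) (X : ι → 𝔸) (z : ℂ) : 𝔸 :=
  (l.map fun i => NormedSpace.exp ((z / 2) • X i)).prod *
    (l.reverse.map fun i => NormedSpace.exp ((z / 2) • X i)).prod

theorem prod_exp_neg_mul_prod_exp (l : List ι) (X : ι → 𝔸) :
    (l.map fun i => NormedSpace.exp (-X i)).prod *
      (l.reverse.map fun i => NormedSpace.exp (X i)).prod = 1 := by
  induction l with
  | nil => simp
  | cons i l ih =>
    simp only [List.map_cons, List.prod_cons, List.reverse_cons, List.map_append, List.prod_append,
      List.map_nil, List.prod_nil, mul_one]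
    rw [mul_assoc, ← mul_assoc _ _ (NormedSpace.exp (X i)), ih, one_mul, exp_neg_mul_exp]

theorem prod_reverse_exp_neg_mul_prod_exp (l : List ι) (X : ι → 𝔸) :
    (l.reverse.map fun i => NormedSpace.exp (-X i)).prod *
      (l.map fun i => NormedSpace.exp (X i)).prod = 1 := by
  simpa using prod_exp_neg_mul_prod_exp l.reverse X

theorem strang_neg_mul (l : List ι) (X : ι → 𝔸) (z : ℂ) : strang l X (-z) * strang l X z = 1 := by
  have e : ∀ i, (-z / 2) • X i = -((z / 2) • X i) := fun i => by rw [neg_div, neg_smul]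
  simp only [strang, e]
  rw [mul_assoc, ← mul_assoc (List.map _ l.reverse).prod (List.map _ l).prod,
    prod_reverse_exp_neg_mul_prod_exp l fun i => (z / 2) • X i, one_mul,
    prod_exp_neg_mul_prod_exp l fun i => (z / 2) • X i]

theorem strang_zero (l : List ι) (X : ι → 𝔸) : strang l X 0 = 1 := by
  simp [strang, NormedSpace.exp_zero]

theorem norm_strang_le [NormOneClass 𝔸] (l : List ι) (X : ι → 𝔸) (z : ℂ) :
    ‖strang l X z‖ ≤ Real.exp (‖z‖ * (l.map fun i => ‖X i‖).sum) := by
  have h : ∀ l' : List ι, ‖(l'.map fun i => NormedSpace.exp ((z / 2) • X i)).prod‖ ≤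
      Real.exp ((‖z‖ / 2) * (l'.map fun i => ‖X i‖).sum) := fun l' => by
    rw [← List.sum_map_mul_left]
    refine norm_list_prod_le l' fun i _ => (norm_exp_le_exp_norm _).trans ?_
    rw [norm_smul]; simp
  have e : ‖z‖ * (l.map fun i => ‖X i‖).sum = ‖z‖ / 2 * (l.map fun i => ‖X i‖).sum
      + ‖z‖ / 2 * (l.reverse.map fun i => ‖X i‖).sum := by
    rw [List.map_reverse, List.sum_reverse]; ring
  rw [e, Real.exp_add]
  exact (norm_mul_le _ _).trans
    (mul_le_mul (h l) (h l.reverse) (norm_nonneg _) (Real.exp_nonneg _))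

theorem hasDerivAt_prod_exp (l : List ι) (X : ι → 𝔸) :
    HasDerivAt (fun z : ℂ => (l.map fun i => NormedSpace.exp ((z / 2) • X i)).prod)
      ((1 / 2 : ℂ) • (l.map X).sum) 0 := by
  induction l with
  | nil => simpa using hasDerivAt_const (0 : ℂ) (1 : 𝔸)
  | cons i l ih =>
    have h1 : HasDerivAt (fun z : ℂ => NormedSpace.exp ((z / 2) • X i)) ((1 / 2 : ℂ) • X i) 0 := by
      have := (hasDerivAt_exp_smul_const' (𝕂 := ℂ) (X i) (0 / 2)).scomp (0 : ℂ)
        ((hasDerivAt_id (0 : ℂ)).div_const 2)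
      simpa [Function.comp_def, NormedSpace.exp_zero] using this
    have := h1.fun_mul ih
    simp only [zero_div, zero_smul, NormedSpace.exp_zero, List.map_const', List.prod_replicate,
      one_pow, mul_one, one_mul, ← smul_add] at this
    simpa using this

theorem hasDerivAt_strang (l : List ι) (X : ι → 𝔸) :
    HasDerivAt (strang l X) (l.map X).sum 0 := by
  have h := (hasDerivAt_prod_exp l X).fun_mul (hasDerivAt_prod_exp l.reverse X)
  have e : ∀ l' : List ι,
      (l'.map fun i => NormedSpace.exp (((0 : ℂ) / 2) • X i)).prod = 1 := fun l' => by
    simp [NormedSpace.exp_zero]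
  rw [e, e, mul_one, one_mul, List.map_reverse, List.sum_reverse, ← add_smul, add_halves,
    one_smul] at h
  exact h

theorem differentiable_strang {F : Type*} [NormedAddCommGroup F] [NormedSpace ℂ F] (l : List ι)
    {X : ι → F → 𝔸} {z : F → ℂ} (hX : ∀ i, Differentiable ℂ (X i)) (hz : Differentiable ℂ z) :
    Differentiable ℂ fun q => strang l (fun i => X i q) (z q) := by
  have h : ∀ i, Differentiable ℂ fun q => NormedSpace.exp ((z q / 2) • X i q) := fun i => by
    have h2 : Differentiable ℂ fun q => (z q / 2) • X i q := by
      have hi := hX i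
      fun_prop
    exact differentiable_exp.comp h2
  exact (differentiable_list_prod l h).mul (differentiable_list_prod l.reverse h)

end Products

/-! ### Skew-adjoint generators -/

section Skew

set_option linter.unusedSectionVars false

variable {𝔸 : Type*} [NormedRing 𝔸] [NormedAlgebra ℂ 𝔸] [CompleteSpace 𝔸] [StarRing 𝔸]
  [CStarRing 𝔸] [StarModule ℂ 𝔸] [Nontrivial 𝔸] {ι : Type*}

theorem exp_mem_unitary {x : 𝔸} (h : star x = -x) : NormedSpace.exp x ∈ unitary 𝔸 := by
  let +nondep : NormedAlgebra ℚ 𝔸 := .restrictScalars ℚ ℂ 𝔸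
  exact NormedSpace.exp_mem_unitary_of_mem_skewAdjoint (skewAdjoint.mem_iff.2 h)

theorem star_real_smul {x : 𝔸} (h : star x = -x) (t : ℝ) :
    star ((t : ℂ) • x) = -((t : ℂ) • x) := by
  rw [star_smul, h, smul_neg]; simp

/-- Along the path `exp (t x) exp ((1 - t) y)` from `exp y` to `exp x` the derivative has norm at
most `‖x - y‖`, since all exponentials are unitary. -/
theorem norm_exp_sub_exp_le {x y : 𝔸} (hx : star x = -x) (hy : star y = -y) :
    ‖NormedSpace.exp x - NormedSpace.exp y‖ ≤ ‖x - y‖ := by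
  have h1 : ∀ t : ℝ, HasDerivAt (fun t : ℝ => NormedSpace.exp ((t : ℂ) • x))
      (NormedSpace.exp ((t : ℂ) • x) * x) t := fun t => by
    have := (hasDerivAt_exp_smul_const (𝕂 := ℂ) x (t : ℂ)).scomp t
      (Complex.ofRealCLM.hasDerivAt (x := t))
    simpa [Function.comp_def] using this
  have h2 : ∀ t : ℝ, HasDerivAt (fun t : ℝ => NormedSpace.exp ((((1 - t : ℝ)) : ℂ) • y))
      (-(y * NormedSpace.exp (((1 - t : ℝ) : ℂ) • y))) t := fun t => by
    have hs : HasDerivAt (fun t : ℝ => (((1 - t : ℝ)) : ℂ)) (-1) t := by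
      simpa using ((hasDerivAt_id t).const_sub 1).ofReal_comp
    have := (hasDerivAt_exp_smul_const' (𝕂 := ℂ) y ((1 - t : ℝ) : ℂ)).scomp t hs
    simpa [Function.comp_def] using this
  have hd := fun t : ℝ => (h1 t).mul (h2 t)
  have := norm_image_sub_le_of_norm_deriv_le_segment_01' (C := ‖x - y‖)
    (fun t _ => (hd t).hasDerivWithinAt) fun t _ => ?_
  · simpa [NormedSpace.exp_zero] using this
  · have e : ∀ a b : 𝔸, a * x * b + a * -(y * b) = a * (x - y) * b := fun a b => by noncomm_ring
    rw [e]
    have u1 := CStarRing.norm_of_mem_unitary (exp_mem_unitary (star_real_smul hx t))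
    have u2 := CStarRing.norm_of_mem_unitary (exp_mem_unitary (star_real_smul hy (1 - t)))
    calc _ ≤ ‖NormedSpace.exp ((t : ℂ) • x)‖ * ‖x - y‖
          * ‖NormedSpace.exp (((1 - t : ℝ) : ℂ) • y)‖ :=
          (norm_mul_le _ _).trans (by gcongr; exact norm_mul_le _ _)
      _ = _ := by rw [u1, u2]; ring

theorem prod_exp_mem_unitary (l : List ι) {X : ι → 𝔸} (h : ∀ i, star (X i) = -X i) (t : ℝ) :
    (l.map fun i => NormedSpace.exp (((t : ℂ) / 2) • X i)).prod ∈ unitary 𝔸 := by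
  refine Submonoid.list_prod_mem _ fun a ha => ?_
  obtain ⟨i, _, rfl⟩ := List.mem_map.1 ha
  simpa using exp_mem_unitary (star_real_smul (h i) (t / 2))

theorem strang_mem_unitary (l : List ι) {X : ι → 𝔸} (h : ∀ i, star (X i) = -X i) (t : ℝ) :
    strang l X t ∈ unitary 𝔸 :=
  mul_mem (prod_exp_mem_unitary l h t) (prod_exp_mem_unitary l.reverse h t)

theorem norm_strang_sub_strang_le (l : List ι) {X Y : ι → 𝔸} (hX : ∀ i, star (X i) = -X i)
    (hY : ∀ i, star (Y i) = -Y i) (t : ℝ) :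
    ‖strang l X t - strang l Y t‖ ≤ |t| * (l.map fun i => ‖X i - Y i‖).sum := by
  have hone : ∀ {Z : ι → 𝔸}, (∀ i, star (Z i) = -Z i) → ∀ i,
      ‖NormedSpace.exp (((t : ℂ) / 2) • Z i)‖ ≤ 1 := fun hZ i => by
    have := CStarRing.norm_of_mem_unitary (exp_mem_unitary (star_real_smul (hZ i) (t / 2)))
    simpa using this.le
  have h : ∀ l' : List ι, ‖(l'.map fun i => NormedSpace.exp (((t : ℂ) / 2) • X i)).prod -
      (l'.map fun i => NormedSpace.exp (((t : ℂ) / 2) • Y i)).prod‖ ≤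
      |t| / 2 * (l'.map fun i => ‖X i - Y i‖).sum := fun l' => by
    refine (norm_list_prod_sub_le l' (fun i _ => hone hX i) fun i _ => hone hY i).trans ?_
    rw [← List.sum_map_mul_left]
    refine List.sum_le_sum fun i _ => ?_
    have := norm_exp_sub_exp_le (star_real_smul (hX i) (t / 2)) (star_real_smul (hY i) (t / 2))
    rw [← smul_sub, norm_smul] at this
    simpa using this
  simp only [strang]
  set a := (l.map fun i => NormedSpace.exp (((t : ℂ) / 2) • X i)).prod
  set b := (l.reverse.map fun i => NormedSpace.exp (((t : ℂ) / 2) • X i)).prod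
  set a' := (l.map fun i => NormedSpace.exp (((t : ℂ) / 2) • Y i)).prod
  set b' := (l.reverse.map fun i => NormedSpace.exp (((t : ℂ) / 2) • Y i)).prod
  have e : a * b - a' * b' = a * (b - b') + (a - a') * b' := by noncomm_ring
  have ha : ‖a‖ = 1 := CStarRing.norm_of_mem_unitary (prod_exp_mem_unitary l hX t)
  have hb : ‖b'‖ = 1 := CStarRing.norm_of_mem_unitary (prod_exp_mem_unitary l.reverse hY t)
  rw [e]
  calc _ ≤ ‖a‖ * ‖b - b'‖ + ‖a - a'‖ * ‖b'‖ :=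
        (norm_add_le _ _).trans (add_le_add (norm_mul_le _ _) (norm_mul_le _ _))
    _ ≤ |t| / 2 * (l.reverse.map fun i => ‖X i - Y i‖).sum
        + |t| / 2 * (l.map fun i => ‖X i - Y i‖).sum := by
        rw [ha, hb, one_mul, mul_one]; exact add_le_add (h _) (h _)
    _ = _ := by rw [List.map_reverse, List.sum_reverse]; ring

end Skew

/-! ### Suzuki's recursion -/

section Suzuki

/-- The ordered product of the steps `W` over a schedule `s`: each entry `(α, β)` contributes the
step of duration `β z` centred at `c + α z`. -/
def composeSteps {𝔸 : Type*} [Monoid 𝔸] (s : List (ℝ × ℝ)) (W : ℂ → ℂ → 𝔸) (c z : ℂ) : 𝔸 :=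
  (s.map fun q => W (c + q.1 * z) (q.2 * z)).prod

/-- Suzuki's parameter `1 / (4 - 4 ^ (1 / (2 j + 3)))`, which raises the order from `2 j + 2` to
`2 j + 4`. -/
def suzukiParam (j : ℕ) : ℝ := 1 / (4 - 4 ^ (1 / (2 * (j : ℝ) + 3)))

/-- Five consecutive steps of durations `p, p, 1 - 4 p, p, p` that cover `[-1/2, 1/2]`, as pairs of
centre and duration, latest step first. -/
def fivefold (p : ℝ) : List (ℝ × ℝ) :=
  [((1 - p) / 2, p), ((1 - 3 * p) / 2, p), (0, 1 - 4 * p), (-((1 - 3 * p) / 2), p),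
    (-((1 - p) / 2), p)]

/-- The schedule of the Suzuki formula of order `2 j + 2` on the interval `[-1/2, 1/2]`. -/
def suzukiSchedule : ℕ → List (ℝ × ℝ)
  | 0 => [(0, 1)]
  | j + 1 => (fivefold (suzukiParam j)).flatMap fun o =>
      (suzukiSchedule j).map fun q => (o.1 + o.2 * q.1, o.2 * q.2)

theorem composeSteps_suzukiSchedule_zero {𝔸 : Type*} [Monoid 𝔸] (W : ℂ → ℂ → 𝔸) :
    composeSteps (suzukiSchedule 0) W = W := by
  ext c z; simp [composeSteps, suzukiSchedule]

theorem composeSteps_suzukiSchedule_succ {𝔸 : Type*} [Monoid 𝔸] (W : ℂ → ℂ → 𝔸) (j : ℕ) :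
    composeSteps (suzukiSchedule (j + 1)) W =
      composeSteps (fivefold (suzukiParam j)) (composeSteps (suzukiSchedule j) W) := by
  ext c z
  simp only [composeSteps, suzukiSchedule, List.flatMap, List.map_flatten, List.prod_flatten,
    List.map_map]
  congr 1
  refine List.map_congr_left fun o _ => ?_
  simp only [Function.comp_apply, List.map_map]
  congr 1
  refine List.map_congr_left fun q _ => ?_
  simp only [Function.comp_apply]
  congr 1 <;> push_cast <;> ring

theorem length_suzukiSchedule (j : ℕ) : (suzukiSchedule j).length = 5 ^ j := by
  induction j with
  | zero => rfl
  | succ j ih => simp [suzukiSchedule, fivefold, ih, pow_succ]; ring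

theorem suzukiRoot_pow (j : ℕ) : ((4 : ℝ) ^ (1 / (2 * (j : ℝ) + 3))) ^ (2 * j + 3) = 4 := by
  rw [← Real.rpow_natCast, ← Real.rpow_mul (by norm_num)]
  push_cast
  rw [one_div_mul_cancel (by positivity), Real.rpow_one]

theorem one_lt_suzukiRoot (j : ℕ) : 1 < (4 : ℝ) ^ (1 / (2 * (j : ℝ) + 3)) :=
  Real.one_lt_rpow (by norm_num) (by positivity)

/-- Bernoulli's inequality bounds the root in `suzukiParam`. The bound implies
`suzukiParam j ≤ (8 j + 13) / (24 (j + 1))`, for which the lengths of the schedules telescope. -/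
theorem suzukiRoot_le (j : ℕ) :
    (4 : ℝ) ^ (1 / (2 * (j : ℝ) + 3)) ≤ 1 + 15 / (8 * (j : ℝ) + 13) := by
  refine le_of_pow_le_pow_left₀ (n := 2 * j + 3) (by omega) (by positivity) ?_
  rw [suzukiRoot_pow]
  have := one_add_mul_le_pow (a := 15 / (8 * (j : ℝ) + 13)) (by
    have : 0 ≤ 15 / (8 * (j : ℝ) + 13) := by positivity
    linarith) (2 * j + 3)
  refine le_trans ?_ this
  have h : (4 : ℝ) - 1 ≤ ((2 * j + 3 : ℕ) : ℝ) * (15 / (8 * (j : ℝ) + 13)) := by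
    rw [← mul_div_assoc, le_div_iff₀ (by positivity)]
    push_cast; nlinarith [(Nat.cast_nonneg j : (0 : ℝ) ≤ j)]
  linarith

theorem suzukiRoot_le_two (j : ℕ) : (4 : ℝ) ^ (1 / (2 * (j : ℝ) + 3)) ≤ 2 := by
  refine le_of_pow_le_pow_left₀ (n := 2 * j + 3) (by omega) (by norm_num) ?_
  rw [suzukiRoot_pow]
  calc (4 : ℝ) = 2 ^ 2 := by norm_num
    _ ≤ 2 ^ (2 * j + 3) := pow_le_pow_right₀ (by norm_num) (by omega)

theorem third_lt_suzukiParam (j : ℕ) : 1 / 3 < suzukiParam j := by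
  have h1 := one_lt_suzukiRoot j
  have h2 := suzukiRoot_le_two j
  exact one_div_lt_one_div_of_lt (by linarith) (by linarith)

theorem suzukiParam_le_half (j : ℕ) : suzukiParam j ≤ 1 / 2 := by
  have h2 := suzukiRoot_le_two j
  exact one_div_le_one_div_of_le (by norm_num) (by linarith)

/-- Suzuki's parameter makes the leading errors of the five steps cancel. -/
theorem suzukiParam_order (j : ℕ) :
    4 * suzukiParam j ^ (2 * j + 3) + (1 - 4 * suzukiParam j) ^ (2 * j + 3) = 0 := by
  have h2 := suzukiRoot_le_two j
  have h : 1 - 4 * suzukiParam j = -((4 : ℝ) ^ (1 / (2 * (j : ℝ) + 3)) * suzukiParam j) := by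
    rw [suzukiParam]
    have : 4 - (4 : ℝ) ^ (1 / (2 * (j : ℝ) + 3)) ≠ 0 := by linarith
    field_simp; ring
  rw [h, Odd.neg_pow ⟨j + 1, by ring⟩, mul_pow, suzukiRoot_pow]; ring

/-- The total duration of the five steps, counted with positive signs. -/
theorem eight_mul_suzukiParam_sub_one_le (j : ℕ) :
    8 * suzukiParam j - 1 ≤ 5 / 3 * ((j + 2) / (j + 1)) := by
  have h1 := suzukiRoot_le j
  have h2 := suzukiRoot_le_two j
  have h3 : suzukiParam j ≤ (8 * j + 13) / (24 * (j + 1)) := by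
    rw [suzukiParam, div_le_div_iff₀ (by linarith) (by positivity)]
    have : 15 / (8 * (j : ℝ) + 13) * (8 * j + 13) = 15 := by field_simp
    nlinarith [mul_le_mul_of_nonneg_right h1 (by positivity : (0 : ℝ) ≤ 8 * j + 13)]
  have h4 : 8 * ((8 * (j : ℝ) + 13) / (24 * (j + 1))) - 1 = 5 / 3 * ((j + 2) / (j + 1)) := by
    field_simp; ring
  linarith

/-- The total length of a schedule, counting backward steps positively. Each level of the recursion
contributes a factor `8 p - 1` with `p` the parameter of the level. -/
theorem sum_abs_suzukiSchedule_le (j : ℕ) :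
    ((suzukiSchedule j).map fun q => |q.2|).sum ≤ (j + 1) * (5 / 3) ^ j := by
  induction j with
  | zero => simp [suzukiSchedule]
  | succ j ih =>
    set s := ((suzukiSchedule j).map fun q => |q.2|).sum
    have hs : ((suzukiSchedule (j + 1)).map fun q => |q.2|).sum = (8 * suzukiParam j - 1) * s := by
      have h3 := third_lt_suzukiParam j
      have e : ∀ b : ℝ, ((suzukiSchedule j).map fun q => |b * q.2|).sum = |b| * s := fun b => by
        simp only [abs_mul, s]; rw [List.sum_map_mul_left]
      have a1 : |suzukiParam j| = suzukiParam j := abs_of_pos (by linarith)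
      have a2 : |1 - 4 * suzukiParam j| = 4 * suzukiParam j - 1 := by
        rw [abs_of_neg (by linarith)]; ring
      simp only [suzukiSchedule, fivefold, List.flatMap_cons, List.flatMap_nil, List.map_append,
        List.map_map, List.sum_append, Function.comp_def, e, a1, a2]
      simp; ring
    have hs0 : 0 ≤ s := List.sum_nonneg fun x hx => by
      obtain ⟨q, _, rfl⟩ := List.mem_map.1 hx; positivity
    rw [hs]
    calc (8 * suzukiParam j - 1) * s ≤ 5 / 3 * ((j + 2) / (j + 1)) * ((j + 1) * (5 / 3) ^ j) :=
          mul_le_mul (eight_mul_suzukiParam_sub_one_le j) ih hs0 (by positivity)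
      _ = _ := by push_cast; field_simp; ring

/-- All steps of a Suzuki schedule stay inside the interval `[-1/2, 1/2]`. -/
theorem suzukiSchedule_mem (j : ℕ) : ∀ q ∈ suzukiSchedule j, |q.1| + |q.2| / 2 ≤ 1 / 2 := by
  induction j with
  | zero => simp [suzukiSchedule]
  | succ j ih =>
    have hp := third_lt_suzukiParam j
    have hp' := suzukiParam_le_half j
    have hfive : ∀ o ∈ fivefold (suzukiParam j), |o.1| + |o.2| / 2 ≤ 1 / 2 := by
      have a1 : |suzukiParam j| = suzukiParam j := abs_of_pos (by linarith)
      have a2 : |1 - 4 * suzukiParam j| = 4 * suzukiParam j - 1 := by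
        rw [abs_of_neg (by linarith)]; ring
      have a3 : |(1 - suzukiParam j) / 2| = (1 - suzukiParam j) / 2 := abs_of_pos (by linarith)
      have a4 : |(1 - 3 * suzukiParam j) / 2| = (3 * suzukiParam j - 1) / 2 := by
        rw [abs_of_neg (by linarith)]; ring
      simp only [fivefold, List.forall_mem_cons, abs_neg, a1, a2, a3, a4, abs_zero]
      refine ⟨?_, ?_, ?_, ?_, ?_, by simp⟩ <;> linarith
    intro q hq
    simp only [suzukiSchedule, List.mem_flatMap, List.mem_map] at hq
    obtain ⟨o, ho, q', hq', rfl⟩ := hq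
    have h1 := hfive o ho
    have h2 := ih q' hq'
    calc |o.1 + o.2 * q'.1| + |o.2 * q'.2| / 2
        ≤ |o.1| + |o.2| * |q'.1| + |o.2| * |q'.2| / 2 := by
          rw [← abs_mul, ← abs_mul]; gcongr; exact abs_add_le _ _
      _ = |o.1| + |o.2| * (|q'.1| + |q'.2| / 2) := by ring
      _ ≤ |o.1| + |o.2| * (1 / 2) := by gcongr
      _ ≤ 1 / 2 := by linarith

end Suzuki

/-! ### The order of Suzuki's formulas -/

section Order

set_option linter.unusedSectionVars false

variable {𝔸 : Type*} [NormedRing 𝔸] [NormedAlgebra ℂ 𝔸] [CompleteSpace 𝔸]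

/-- `D c z` is `z ^ N` times a function that is continuous in `c` and `z`. -/
def VanishesToOrder (N : ℕ) (D : ℂ → ℂ → 𝔸) : Prop :=
  ∃ F : ℂ → ℂ → 𝔸, Continuous (Function.uncurry F) ∧ ∀ c z, D c z = z ^ N • F c z

/-- A holomorphic family of steps (`W c z` advances from `c - z / 2` to `c + z / 2`) for which a step
back undoes a step forward. -/
structure IsSymmetricStep (W : ℂ → ℂ → 𝔸) : Prop where
  differentiable : Differentiable ℂ fun q : ℂ × ℂ => W q.1 q.2
  zero : ∀ c, W c 0 = 1
  symm : ∀ c z, W c (-z) * W c z = 1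

theorem IsSymmetricStep.comp {W : ℂ → ℂ → 𝔸} (hW : IsSymmetricStep W) {F : Type*}
    [NormedAddCommGroup F] [NormedSpace ℂ F] {f g : F → ℂ} (hf : Differentiable ℂ f)
    (hg : Differentiable ℂ g) : Differentiable ℂ fun x => W (f x) (g x) :=
  hW.differentiable.comp (hf.prodMk hg)

/-- The error of a symmetric step has odd order: if the coefficient of an odd power `z ^ N` in
`W - V` is zero, so is the next one. -/
theorem IsSymmetricStep.vanishesToOrder_add_two {W V : ℂ → ℂ → 𝔸} (hW : IsSymmetricStep W)
    (hV : IsSymmetricStep V) {N : ℕ} (hN : Odd N) {F : ℂ → ℂ → 𝔸}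
    (hF : Continuous (Function.uncurry F)) (h : ∀ c z, W c z - V c z = z ^ N • F c z)
    (h0 : ∀ c, F c 0 = 0) : VanishesToOrder (N + 2) fun c z => W c z - V c z := by
  have hd : ∀ c, Differentiable ℂ fun z => W c z - V c z := fun c =>
    (hW.comp (differentiable_const c) differentiable_id).sub
      (hV.comp (differentiable_const c) differentiable_id)
  have hsec : ∀ {F : ℂ → ℂ → 𝔸}, Continuous (Function.uncurry F) → ∀ c, Continuous (F c) :=
    fun hF c => hF.comp (by fun_prop : Continuous fun z : ℂ => (c, z))
  obtain ⟨G, hG, hFG⟩ := exists_continuous_div hF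
    (fun c => differentiable_of_eq_pow_smul (hd c) (hsec hF c) (h c)) h0
  have hDG : ∀ c z, W c z - V c z = z ^ (N + 1) • G c z := fun c z => by
    rw [h, hFG, smul_smul, pow_succ]
  have hG0 : ∀ c, G c 0 = 0 := fun c => by
    -- reversing the step changes the sign of `G` up to factors that tend to `1`
    have hrev : ∀ z, G c (-z) = -(W c (-z) * G c z * V c (-z)) := by
      have hWc : Continuous (W c) := (hW.comp (differentiable_const c) differentiable_id).continuous
      have hVc : Continuous (V c) := (hV.comp (differentiable_const c) differentiable_id).continuous
      have hGc := hsec hG c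
      have := Continuous.ext_on (dense_compl_singleton (0 : ℂ))
        (f := fun z => G c (-z)) (g := fun z => -(W c (-z) * G c z * V c (-z)))
        (by fun_prop) (by fun_prop) fun z hz => ?_
      · exact fun z => congrFun this z
      · have hz0 : z ^ (N + 1) ≠ 0 := pow_ne_zero _ (by simpa using hz)
        have hVV : V c z * V c (-z) = 1 := by simpa using hV.symm c (-z)
        have e : W c (-z) - V c (-z) = -(W c (-z) * (W c z - V c z) * V c (-z)) := by
          rw [mul_sub, hW.symm, sub_mul, mul_assoc _ (V c z), hVV]; noncomm_ring
        rw [hDG, hDG, (hN.add_one).neg_pow, mul_smul_comm, smul_mul_assoc, ← smul_neg] at e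
        exact smul_right_injective 𝔸 hz0 e
    have := hrev 0
    rw [neg_zero, hW.zero, hV.zero, one_mul, mul_one, eq_neg_iff_add_eq_zero, ← two_smul ℂ] at this
    exact (smul_eq_zero.1 this).resolve_left two_ne_zero
  obtain ⟨G', hG', hGG'⟩ := exists_continuous_div hG
    (fun c => differentiable_of_eq_pow_smul (hd c) (hsec hG c) (hDG c)) hG0
  exact ⟨G', hG', fun c z => by beta_reduce; rw [hDG, hGG', smul_smul, ← pow_succ]⟩

/-- Two symmetric steps with the same derivative at `0` agree to second order. -/
theorem IsSymmetricStep.vanishesToOrder_three {W V : ℂ → ℂ → 𝔸} (hW : IsSymmetricStep W)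
    (hV : IsSymmetricStep V) {A : ℂ → 𝔸} (hWA : ∀ c, HasDerivAt (W c) (A c) 0)
    (hVA : ∀ c, HasDerivAt (V c) (A c) 0) : VanishesToOrder 3 fun c z => W c z - V c z := by
  have hd : ∀ c, Differentiable ℂ fun z => W c z - V c z := fun c =>
    (hW.comp (differentiable_const c) differentiable_id).sub
      (hV.comp (differentiable_const c) differentiable_id)
  obtain ⟨F, hF, hDF⟩ := exists_continuous_div (F := fun c z => W c z - V c z)
    (hW.differentiable.sub hV.differentiable).continuous hd (fun c => by simp [hW.zero, hV.zero])
  refine hW.vanishesToOrder_add_two hV odd_one hF (by simpa using hDF) fun c => ?_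
  have hFc : Continuous (F c) := hF.comp (by fun_prop : Continuous fun z : ℂ => (c, z))
  have hFd : Differentiable ℂ (F c) :=
    differentiable_of_eq_pow_smul (N := 1) (hd c) hFc (by simpa using hDF c)
  have h1 : HasDerivAt (fun z => W c z - V c z) (F c 0) 0 := by
    have := (hasDerivAt_id (0 : ℂ)).fun_smul (hFd 0).hasDerivAt
    simp only [id, zero_smul, one_smul, zero_add] at this
    exact this.congr_of_eventuallyEq (.of_forall fun z => hDF c z)
  have h2 := (hWA c).fun_sub (hVA c)
  rw [sub_self] at h2
  exact h1.unique h2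

theorem IsSymmetricStep.composeSteps_fivefold {W : ℂ → ℂ → 𝔸} (hW : IsSymmetricStep W) (p : ℝ) :
    IsSymmetricStep (composeSteps (fivefold p) W) where
  differentiable := differentiable_list_prod _ fun q =>
    hW.comp (by fun_prop) (by fun_prop)
  zero c := by simp [composeSteps, fivefold, hW.zero]
  symm c z := by
    have hs : ∀ (a b : ℂ) (x : 𝔸), W a (-b) * (W a b * x) = x := fun a b x => by
      rw [← mul_assoc, hW.symm, one_mul]
    simp only [composeSteps, fivefold, List.map_cons, List.map_nil, List.prod_cons, List.prod_nil,
      mul_one, mul_neg, Complex.ofReal_neg, Complex.ofReal_zero, zero_mul, neg_zero, neg_mul,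
      neg_neg, mul_assoc, hs, hW.symm]

theorem IsSymmetricStep.composeSteps_suzukiSchedule {W : ℂ → ℂ → 𝔸} (hW : IsSymmetricStep W)
    (j : ℕ) : IsSymmetricStep (composeSteps (suzukiSchedule j) W) := by
  induction j with
  | zero => rwa [composeSteps_suzukiSchedule_zero]
  | succ j ih => rw [composeSteps_suzukiSchedule_succ]; exact ih.composeSteps_fivefold _

/-- A two-parameter propagator in terms of a fundamental solution `Φ` and its inverse `Ψ`. -/
def propagator (Φ Ψ : ℂ → 𝔸) (c z : ℂ) : 𝔸 := Φ (c + z / 2) * Ψ (c - z / 2)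

theorem composeSteps_fivefold_propagator {Φ Ψ : ℂ → 𝔸} (h : ∀ z, Ψ z * Φ z = 1) (p : ℝ) :
    composeSteps (fivefold p) (propagator Φ Ψ) = propagator Φ Ψ := by
  have key : ∀ b d x, b = d → Ψ b * (Φ d * x) = x := by
    rintro b d x rfl
    rw [← mul_assoc, h, one_mul]
  ext c z
  simp only [composeSteps, fivefold, List.map_cons, List.map_nil, List.prod_cons, List.prod_nil,
    mul_one, propagator, mul_assoc]
  rw [key _ _ _ (by push_cast; ring), key _ _ _ (by push_cast; ring),
    key _ _ _ (by push_cast; ring), key _ _ _ (by push_cast; ring)]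
  congr 2 <;> push_cast <;> ring

/-- One level of Suzuki's recursion raises the order by two. -/
theorem VanishesToOrder.composeSteps_fivefold {W V : ℂ → ℂ → 𝔸} (hW : IsSymmetricStep W)
    (hV : IsSymmetricStep V) {N : ℕ} (hN : Odd N) (h : VanishesToOrder N fun c z => W c z - V c z)
    {p : ℝ} (hp : 4 * p ^ N + (1 - 4 * p) ^ N = 0)
    (hVp : composeSteps (fivefold p) V = V) :
    VanishesToOrder (N + 2) fun c z => composeSteps (fivefold p) W c z - V c z := by
  obtain ⟨E, hE, hWE⟩ := h
  have hEc : ∀ {f g : ℂ × ℂ → ℂ}, Continuous f → Continuous g →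
      Continuous fun x => E (f x) (g x) := fun hf hg => hE.comp (hf.prodMk hg)
  have hWc : ∀ {f g : ℂ × ℂ → ℂ}, Continuous f → Continuous g →
      Continuous fun x => W (f x) (g x) := fun hf hg =>
    hW.differentiable.continuous.comp (hf.prodMk hg)
  have hVc : ∀ {f g : ℂ × ℂ → ℂ}, Continuous f → Continuous g →
      Continuous fun x => V (f x) (g x) := fun hf hg =>
    hV.differentiable.continuous.comp (hf.prodMk hg)
  let S : ℂ → ℂ → ℝ × ℝ → 𝔸 := fun c z q => W (c + q.1 * z) (q.2 * z)
  let U : ℂ → ℂ → ℝ × ℝ → 𝔸 := fun c z q => V (c + q.1 * z) (q.2 * z)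
  let e : ℂ → ℂ → ℝ × ℝ → 𝔸 := fun c z q => (q.2 : ℂ) ^ N • E (c + q.1 * z) (q.2 * z)
  have hSU : ∀ c z q, S c z q - U c z q = z ^ N • e c z q := fun c z q => by
    simp only [S, U, e, hWE, smul_smul, mul_pow, mul_comm]
  have hS : ∀ q, Continuous fun x : ℂ × ℂ => S x.1 x.2 q := fun q =>
    hWc (by fun_prop) (by fun_prop)
  have hU : ∀ q, Continuous fun x : ℂ × ℂ => U x.1 x.2 q := fun q =>
    hVc (by fun_prop) (by fun_prop)
  have he : ∀ q, Continuous fun x : ℂ × ℂ => e x.1 x.2 q := fun q =>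
    (hEc (by fun_prop) (by fun_prop)).const_smul _
  let q₁ : ℝ × ℝ := ((1 - p) / 2, p)
  let q₂ : ℝ × ℝ := ((1 - 3 * p) / 2, p)
  let q₃ : ℝ × ℝ := (0, 1 - 4 * p)
  let q₄ : ℝ × ℝ := (-((1 - 3 * p) / 2), p)
  let q₅ : ℝ × ℝ := (-((1 - p) / 2), p)
  let F : ℂ → ℂ → 𝔸 := fun c z =>
    e c z q₁ * U c z q₂ * U c z q₃ * U c z q₄ * U c z q₅
      + S c z q₁ * e c z q₂ * U c z q₃ * U c z q₄ * U c z q₅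
      + S c z q₁ * S c z q₂ * e c z q₃ * U c z q₄ * U c z q₅
      + S c z q₁ * S c z q₂ * S c z q₃ * e c z q₄ * U c z q₅
      + S c z q₁ * S c z q₂ * S c z q₃ * S c z q₄ * e c z q₅
  refine (hW.composeSteps_fivefold p).vanishesToOrder_add_two hV hN (F := F) ?_
    (fun c z => ?_) fun c => ?_
  · have h1 := hS q₁; have h2 := hS q₂; have h3 := hS q₃; have h4 := hS q₄
    have k2 := hU q₂; have k3 := hU q₃; have k4 := hU q₄; have k5 := hU q₅
    have e1 := he q₁; have e2 := he q₂; have e3 := he q₃; have e4 := he q₄; have e5 := he q₅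
    simp only [F, Function.uncurry_def]
    fun_prop
  · have hWp : composeSteps (fivefold p) W c z
        = S c z q₁ * S c z q₂ * S c z q₃ * S c z q₄ * S c z q₅ := by
      simp [composeSteps, fivefold, S, q₁, q₂, q₃, q₄, q₅, mul_assoc]
    have hVp' : V c z = U c z q₁ * U c z q₂ * U c z q₃ * U c z q₄ * U c z q₅ := by
      conv_lhs => rw [← hVp]
      simp [composeSteps, fivefold, U, q₁, q₂, q₃, q₄, q₅, mul_assoc]
    have tele : ∀ a b c d f a' b' c' d' f' : 𝔸, a * b * c * d * f - a' * b' * c' * d' * f'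
        = (a - a') * b' * c' * d' * f' + a * (b - b') * c' * d' * f' + a * b * (c - c') * d' * f'
          + a * b * c * (d - d') * f' + a * b * c * d * (f - f') := by
      intros; noncomm_ring
    rw [hWp, hVp', tele]
    simp only [hSU, F, smul_add, mul_smul_comm, smul_mul_assoc]
  · have hp' : (4 * (p : ℂ) ^ N + (1 - 4 * (p : ℂ)) ^ N) = 0 := by exact_mod_cast hp
    have hF0 : F c 0 = (4 * (p : ℂ) ^ N + (1 - 4 * (p : ℂ)) ^ N) • E c 0 := by
      simp only [F, S, U, e, q₁, q₂, q₃, q₄, q₅, mul_zero, add_zero, hW.zero, hV.zero, mul_one,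
        one_mul, Complex.ofReal_sub, Complex.ofReal_mul, Complex.ofReal_one, Complex.ofReal_ofNat]
      module
    rw [hF0, hp', zero_smul]

/-- The Suzuki formula with `5 ^ j` steps has order `2 j + 2`. -/
theorem vanishesToOrder_suzuki {W V : ℂ → ℂ → 𝔸} (hW : IsSymmetricStep W)
    (hV : IsSymmetricStep V) (h : VanishesToOrder 3 fun c z => W c z - V c z)
    (hVp : ∀ p, composeSteps (fivefold p) V = V) (j : ℕ) :
    VanishesToOrder (2 * j + 3) fun c z => composeSteps (suzukiSchedule j) W c z - V c z := by
  induction j with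
  | zero => simpa [composeSteps_suzukiSchedule_zero] using h
  | succ j ih =>
    have := VanishesToOrder.composeSteps_fivefold (hW.composeSteps_suzukiSchedule j) hV
      ⟨j + 1, by ring⟩ ih (suzukiParam_order j) (hVp _)
    rw [composeSteps_suzukiSchedule_succ]
    exact this

end Order

/-! ### Entire generators -/

section Entire

set_option linter.unusedSectionVars false

variable {𝔸 : Type*} [NormedRing 𝔸] [NormedAlgebra ℂ 𝔸] [CompleteSpace 𝔸] {ι : Type*}

/-- `Φ` is the fundamental solution of `Y' = A Y` and `Ψ` is its inverse. -/
structure IsFundamentalSolution (A Φ Ψ : ℂ → 𝔸) : Prop where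
  left_zero : Φ 0 = 1
  right_zero : Ψ 0 = 1
  left_deriv : ∀ z, HasDerivAt Φ (A z * Φ z) z
  right_deriv : ∀ z, HasDerivAt Ψ (-(Ψ z * A z)) z
  right_mul_left : ∀ z, Ψ z * Φ z = 1

theorem exists_fundamentalSolution {A : ℂ → 𝔸} (hA : Differentiable ℂ A) :
    ∃ Φ Ψ, IsFundamentalSolution A Φ Ψ := by
  obtain ⟨Φ, hΦ0, hΦ⟩ := exists_entire_solution (B := fun z => ContinuousLinearMap.mul ℂ 𝔸 (A z))
    ((ContinuousLinearMap.mul ℂ 𝔸).differentiable.comp hA) 1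
  obtain ⟨Ψ, hΨ0, hΨ⟩ := exists_entire_solution
    (B := fun z => (ContinuousLinearMap.mul ℂ 𝔸).flip (-(A z)))
    ((ContinuousLinearMap.mul ℂ 𝔸).flip.differentiable.comp hA.neg) 1
  have h1 : ∀ z, HasDerivAt Φ (A z * Φ z) z := fun z => by simpa using hΦ z
  have h2 : ∀ z, HasDerivAt Ψ (-(Ψ z * A z)) z := fun z => by simpa using hΨ z
  refine ⟨Φ, Ψ, hΦ0, hΨ0, h1, h2, fun z => ?_⟩
  have hd : ∀ z, HasDerivAt (fun z => Ψ z * Φ z) 0 z := fun z => by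
    convert! (h2 z).fun_mul (h1 z) using 1
    noncomm_ring
  have := is_const_of_deriv_eq_zero (fun z => (hd z).differentiableAt) (fun z => (hd z).deriv) z 0
  simpa [hΦ0, hΨ0] using this

namespace IsFundamentalSolution

variable {A Φ Ψ : ℂ → 𝔸} (h : IsFundamentalSolution A Φ Ψ)

include h

theorem norm_left_le [NormOneClass 𝔸] {R b : ℝ} (hb : ∀ z : ℂ, ‖z‖ ≤ R → ‖A z‖ ≤ b) {z : ℂ}
    (hz : ‖z‖ ≤ R) : ‖Φ z‖ ≤ Real.exp (b * ‖z‖) := by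
  have := norm_solution_le (B := fun z => ContinuousLinearMap.mul ℂ 𝔸 (A z)) (Y := Φ)
    (fun z => by simpa using h.left_deriv z)
    (fun z hz => (ContinuousLinearMap.opNorm_mul_apply_le ℂ 𝔸 _).trans (hb z hz)) hz
  simpa [h.left_zero] using this

theorem norm_right_le [NormOneClass 𝔸] {R b : ℝ} (hb : ∀ z : ℂ, ‖z‖ ≤ R → ‖A z‖ ≤ b) {z : ℂ}
    (hz : ‖z‖ ≤ R) : ‖Ψ z‖ ≤ Real.exp (b * ‖z‖) := by
  have := norm_solution_le (B := fun z => (ContinuousLinearMap.mul ℂ 𝔸).flip (-(A z))) (Y := Ψ)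
    (fun z => by simpa using h.right_deriv z)
    (fun z hz => (ContinuousLinearMap.opNorm_le_bound _ (norm_nonneg _) fun x => by
      rw [ContinuousLinearMap.flip_apply, ContinuousLinearMap.mul_apply', mul_neg, norm_neg,
        mul_comm]
      exact norm_mul_le x (A z)).trans (hb z hz)) hz
  simpa [h.right_zero] using this

theorem differentiable_left : Differentiable ℂ Φ := fun z => (h.left_deriv z).differentiableAt

theorem differentiable_right : Differentiable ℂ Ψ := fun z => (h.right_deriv z).differentiableAt

theorem left_mul_right [IsDedekindFiniteMonoid 𝔸] (z : ℂ) : Φ z * Ψ z = 1 :=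
  mul_eq_one_comm.1 (h.right_mul_left z)

theorem isSymmetricStep [IsDedekindFiniteMonoid 𝔸] : IsSymmetricStep (propagator Φ Ψ) where
  differentiable := by
    have h1 := h.differentiable_left
    have h2 := h.differentiable_right
    have e1 : Differentiable ℂ fun q : ℂ × ℂ => Φ (q.1 + q.2 / 2) := h1.comp (by fun_prop)
    have e2 : Differentiable ℂ fun q : ℂ × ℂ => Ψ (q.1 - q.2 / 2) := h2.comp (by fun_prop)
    exact e1.mul e2
  zero c := by simp [propagator, h.left_mul_right]
  symm c z := by
    have e1 : c + -z / 2 = c - z / 2 := by ring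
    have e2 : c - -z / 2 = c + z / 2 := by ring
    rw [propagator, propagator, e1, e2, mul_assoc, ← mul_assoc (Ψ _) (Φ _), h.right_mul_left,
      one_mul, h.left_mul_right]

theorem hasDerivAt_propagator [IsDedekindFiniteMonoid 𝔸] (c : ℂ) :
    HasDerivAt (propagator Φ Ψ c) (A c) 0 := by
  have k1 : HasDerivAt (fun z : ℂ => c + z / 2) (1 / 2) 0 :=
    ((hasDerivAt_id (0 : ℂ)).div_const 2).const_add c
  have k2 : HasDerivAt (fun z : ℂ => c - z / 2) (-(1 / 2)) 0 :=
    ((hasDerivAt_id (0 : ℂ)).div_const 2).const_sub c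
  have e1 : c + 0 / 2 = c := by ring
  have e2 : c - 0 / 2 = c := by ring
  have h1 : HasDerivAt (fun z : ℂ => Φ (c + z / 2)) ((1 / 2 : ℂ) • (A c * Φ c)) 0 := by
    have := (h.left_deriv (c + 0 / 2)).scomp (0 : ℂ) k1
    simpa only [e1, Function.comp_def] using this
  have h2 : HasDerivAt (fun z : ℂ => Ψ (c - z / 2)) ((-(1 / 2) : ℂ) • -(Ψ c * A c)) 0 := by
    have := (h.right_deriv (c - 0 / 2)).scomp (0 : ℂ) k2
    simpa only [e2, Function.comp_def] using this
  have h3 := h1.fun_mul h2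
  convert! h3 using 1
  rw [e1, e2, smul_mul_assoc, mul_assoc, h.left_mul_right, mul_one, mul_smul_comm, mul_neg,
    ← mul_assoc, h.left_mul_right, one_mul]
  module

end IsFundamentalSolution

theorem isSymmetricStep_strang (l : List ι) {P : ι → ℂ → 𝔸} (hP : ∀ i, Differentiable ℂ (P i)) :
    IsSymmetricStep fun c z => strang l (fun i => P i c) z where
  differentiable := differentiable_strang l (X := fun i (q : ℂ × ℂ) => P i q.1)
    (fun i => (hP i).comp differentiable_fst) differentiable_snd
  zero _ := strang_zero l _
  symm _ z := strang_neg_mul l _ z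

/-- The error of Suzuki's formula for entire generators, with an explicit constant: the error is
bounded on the circle of radius `R` by the sizes of both propagators and has a zero of order
`2 j + 3` at the origin. -/
theorem norm_suzuki_sub_propagator_le [NormOneClass 𝔸] [IsDedekindFiniteMonoid 𝔸] (l : List ι)
    {P : ι → ℂ → 𝔸} (hP : ∀ i, Differentiable ℂ (P i)) {Φ Ψ : ℂ → 𝔸}
    (h : IsFundamentalSolution (fun z => (l.map fun i => P i z).sum) Φ Ψ) (j : ℕ) {R b σ : ℝ}
    (hR : 0 < R) (hb : ∀ w : ℂ, ‖w‖ ≤ R / 2 → (l.map fun i => ‖P i w‖).sum ≤ b) (hσ1 : 1 ≤ σ)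
    (hσ : ((suzukiSchedule j).map fun q => |q.2|).sum ≤ σ) {z : ℂ} (hz : ‖z‖ ≤ R) :
    ‖composeSteps (suzukiSchedule j) (fun c z => strang l (fun i => P i c) z) 0 z
      - propagator Φ Ψ 0 z‖ ≤ 2 * Real.exp (σ * (R * b)) * (‖z‖ / R) ^ (2 * j + 3) := by
  have hW := isSymmetricStep_strang l hP
  have hV := h.isSymmetricStep
  obtain ⟨F, hF, hDF⟩ := vanishesToOrder_suzuki hW hV
    (hW.vanishesToOrder_three hV (fun c => hasDerivAt_strang l _) h.hasDerivAt_propagator)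
    (composeSteps_fivefold_propagator h.right_mul_left) j
  have hb0 : 0 ≤ b := le_trans (List.sum_nonneg fun x hx => by
    obtain ⟨i, _, rfl⟩ := List.mem_map.1 hx; positivity) (hb 0 (by simp; positivity))
  refine norm_le_of_eq_pow_smul (f := fun z =>
      composeSteps (suzukiSchedule j) (fun c z => strang l (fun i => P i c) z) 0 z
        - propagator Φ Ψ 0 z) (g := F 0)
    (((hW.composeSteps_suzukiSchedule j).comp (differentiable_const 0) differentiable_id).sub
      (hV.comp (differentiable_const 0) differentiable_id))
    (hF.comp (by fun_prop : Continuous fun z : ℂ => ((0 : ℂ), z))) (hDF 0) hR (fun w hw => ?_) hz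
  have hS : ‖composeSteps (suzukiSchedule j) (fun c z => strang l (fun i => P i c) z) 0 w‖
      ≤ Real.exp (σ * (R * b)) := by
    refine (norm_list_prod_le _ (g := fun q : ℝ × ℝ => |q.2| * (R * b)) fun q hq => ?_).trans ?_
    · refine (norm_strang_le l _ _).trans (Real.exp_le_exp.2 ?_)
      have hq1 : |q.1| ≤ 1 / 2 := by
        have := suzukiSchedule_mem j q hq
        have := abs_nonneg q.2
        linarith
      have := hb (0 + q.1 * w) (by
        rw [zero_add, norm_mul, hw, Complex.norm_real, Real.norm_eq_abs]; nlinarith)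
      rw [norm_mul, hw, Complex.norm_real, Real.norm_eq_abs, mul_assoc]
      gcongr
    · rw [List.sum_map_mul_right]
      gcongr
  have hU : ‖propagator Φ Ψ 0 w‖ ≤ Real.exp (σ * (R * b)) := by
    have hA : ∀ z : ℂ, ‖z‖ ≤ R / 2 → ‖(l.map fun i => P i z).sum‖ ≤ b := fun z hz => by
      refine le_trans ?_ (hb z hz)
      have := List.le_sum_of_subadditive (norm : 𝔸 → ℝ) norm_zero.le norm_add_le
        (l.map fun i => P i z)
      simpa [List.map_map, Function.comp_def] using this
    have hw2 : ‖w / 2‖ = R / 2 := by simp [hw]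
    have n1 := h.norm_left_le hA (z := 0 + w / 2) (by rw [zero_add, hw2])
    have n2 := h.norm_right_le hA (z := 0 - w / 2) (by rw [zero_sub, norm_neg, hw2])
    rw [zero_add, hw2] at n1
    rw [zero_sub, norm_neg, hw2] at n2
    calc ‖propagator Φ Ψ 0 w‖ ≤ Real.exp (b * (R / 2)) * Real.exp (b * (R / 2)) := by
          rw [propagator, zero_add, zero_sub]
          exact (norm_mul_le _ _).trans (mul_le_mul n1 n2 (norm_nonneg _) (Real.exp_nonneg _))
      _ = Real.exp (1 * (R * b)) := by rw [← Real.exp_add]; congr 1; ring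
      _ ≤ _ := by gcongr
  calc _ ≤ _ := norm_sub_le _ _
    _ ≤ Real.exp (σ * (R * b)) + Real.exp (σ * (R * b)) := add_le_add hS hU
    _ = _ := by ring

end Entire

/-! ### Taylor polynomials -/

section Taylor

/-- A Taylor estimate for a function whose derivatives are given as a sequence `f`; the highest
derivative need not be continuous. -/
theorem norm_sub_taylor_le {E : Type*} [NormedAddCommGroup E] [NormedSpace ℝ E] {S : Set ℝ}
    (hS : Convex ℝ S) {c : ℝ} (hc : c ∈ S) {B : ℝ} (N : ℕ) :
    ∀ (f : ℕ → ℝ → E), (∀ p < N, ∀ t ∈ S, HasDerivWithinAt (f p) (f (p + 1) t) S t) →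
    (∀ t ∈ S, ‖f N t‖ ≤ B) → ∀ t ∈ S,
    ‖f 0 t - ∑ p ∈ Finset.range N, ((t - c) ^ p / (p.factorial : ℝ)) • f p c‖
      ≤ B * |t - c| ^ N := by
  induction N with
  | zero => intro f _ h t ht; simpa using h t ht
  | succ N ih =>
    intro f hf hB t ht
    have hB0 : 0 ≤ B := (norm_nonneg _).trans (hB t ht)
    have ih' := ih (fun p => f (p + 1)) (fun p hp => hf (p + 1) (by omega)) hB
    let g : ℝ → E := fun s =>
      f 0 s - ∑ p ∈ Finset.range (N + 1), ((s - c) ^ p / (p.factorial : ℝ)) • f p c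
    have hgc : g c = 0 := by
      simp only [g, Finset.sum_range_succ', sub_self]
      simp
    have hmono : ∀ s ∈ Set.uIcc c t, s ∈ S := fun s hs =>
      hS.ordConnected.uIcc_subset hc ht hs
    have hg : ∀ s ∈ Set.uIcc c t, HasDerivWithinAt g (f 1 s -
        ∑ p ∈ Finset.range N, ((s - c) ^ p / (p.factorial : ℝ)) • f (p + 1) c) (Set.uIcc c t) s := by
      intro s hs
      refine ((hf 0 (by omega) s (hmono s hs)).mono fun _ h => hmono _ h).fun_sub ?_
      refine HasDerivAt.hasDerivWithinAt ?_
      simp only [Finset.sum_range_succ' _ N, pow_zero]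
      have : HasDerivAt (fun s : ℝ => ∑ p ∈ Finset.range N,
          ((s - c) ^ (p + 1) / ((p + 1).factorial : ℝ)) • f (p + 1) c)
          (∑ p ∈ Finset.range N, ((s - c) ^ p / (p.factorial : ℝ)) • f (p + 1) c) s := by
        refine HasDerivAt.fun_sum fun p _ => ?_
        have h1 : HasDerivAt (fun s : ℝ => (s - c) ^ (p + 1) / ((p + 1).factorial : ℝ))
            ((s - c) ^ p / (p.factorial : ℝ)) s := by
          have := (((hasDerivAt_id s).sub_const c).fun_pow (p + 1)).div_const
            ((p + 1).factorial : ℝ)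
          convert! this using 1
          rw [Nat.factorial_succ]; push_cast; simp only [id]; field_simp
        exact h1.smul_const _
      simpa using this.add_const ((1 / ((Nat.factorial 0 : ℕ) : ℝ)) • f 0 c)
    have := (convex_uIcc c t).norm_image_sub_le_of_norm_hasDerivWithin_le hg
      (C := B * |t - c| ^ N) (fun s hs => ?_) Set.left_mem_uIcc Set.right_mem_uIcc
    · rw [hgc, sub_zero, Real.norm_eq_abs, mul_assoc, ← pow_succ] at this
      exact this
    · refine (ih' s (hmono s hs)).trans ?_
      have : |s - c| ≤ |t - c| := Set.abs_sub_left_of_mem_uIcc hs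
      gcongr

theorem list_sum_finset_sum {ι κ M : Type*} [AddCommMonoid M] (l : List ι) (s : Finset κ)
    (f : ι → κ → M) :
    (l.map fun i => ∑ p ∈ s, f i p).sum = ∑ p ∈ s, (l.map fun i => f i p).sum := by
  induction l with
  | nil => simp
  | cons i l ih => simp [ih, Finset.sum_add_distrib]

variable {𝔸 : Type*} [NormedAddCommGroup 𝔸] [NormedSpace ℂ 𝔸] {ι : Type*}

/-- The Taylor polynomial with coefficients `a p / p!`, `p < N`. -/
def taylorPolynomial (N : ℕ) (a : ℕ → 𝔸) (w : ℂ) : 𝔸 :=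
  ∑ p ∈ Finset.range N, (w ^ p / (p.factorial : ℂ)) • a p

theorem differentiable_taylorPolynomial (N : ℕ) (a : ℕ → 𝔸) :
    Differentiable ℂ (taylorPolynomial N a) := by
  unfold taylorPolynomial; fun_prop

/-- The Taylor estimate for a family of functions whose derivatives are bounded in the sum over the
family. Norming functionals of the errors reduce it to the scalar case. -/
theorem sum_norm_sub_taylorPolynomial_le (l : List ι) {A : ι → ℕ → ℝ → 𝔸} {S : Set ℝ}
    (hS : Convex ℝ S) {c : ℝ} (hc : c ∈ S) {N : ℕ} {B : ℝ}
    (hA : ∀ i, ∀ p < N, ∀ t ∈ S, HasDerivWithinAt (A i p) (A i (p + 1) t) S t)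
    (hB : ∀ t ∈ S, (l.map fun i => ‖A i N t‖).sum ≤ B) {t : ℝ} (ht : t ∈ S) :
    (l.map fun i => ‖A i 0 t - taylorPolynomial N (fun p => A i p c) ((t - c : ℝ) : ℂ)‖).sum
      ≤ B * |t - c| ^ N := by
  choose φ hφ1 hφ using fun i => exists_dual_vector'' ℂ
    (A i 0 t - taylorPolynomial N (fun p => A i p c) ((t - c : ℝ) : ℂ))
  have key := norm_sub_taylor_le hS hc (B := B) N (fun p t => (l.map fun i => φ i (A i p t)).sum)
    (fun p hp s hs => ?_) (fun s hs => ?_) t ht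
  · refine le_trans (le_of_eq ?_) key
    have e : (l.map fun i => φ i (A i 0 t)).sum - ∑ p ∈ Finset.range N,
        ((t - c) ^ p / (p.factorial : ℝ)) • (l.map fun i => φ i (A i p c)).sum
        = (((l.map fun i =>
          ‖A i 0 t - taylorPolynomial N (fun p => A i p c) ((t - c : ℝ) : ℂ)‖).sum : ℝ) : ℂ) := by
      have h1 : ∀ i, ((‖A i 0 t - taylorPolynomial N (fun p => A i p c) ((t - c : ℝ) : ℂ)‖ : ℝ) : ℂ)
          = φ i (A i 0 t) - ∑ p ∈ Finset.range N,
            ((t - c) ^ p / (p.factorial : ℝ)) • φ i (A i p c) := fun i => by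
        have := (hφ i).symm
        rw [map_sub, taylorPolynomial, map_sum] at this
        convert! this using 3 with p
        rw [map_smul, Complex.real_smul, smul_eq_mul]
        push_cast; rfl
      clear key hB
      induction l with
      | nil => simp
      | cons i l ih =>
        simp only [List.map_cons, List.sum_cons, Complex.ofReal_add, h1, smul_add,
          Finset.sum_add_distrib] at ih ⊢
        rw [← ih]; ring
    rw [e, Complex.norm_real, Real.norm_of_nonneg]
    exact List.sum_nonneg fun x hx => by
      obtain ⟨i, _, rfl⟩ := List.mem_map.1 hx; positivity
  · have h1 : ∀ i, HasDerivWithinAt (fun s => φ i (A i p s)) (φ i (A i (p + 1) s)) S s := fun i =>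
      ((φ i).restrictScalars ℝ).hasFDerivAt.comp_hasDerivWithinAt s (hA i p hp s hs)
    clear hB
    induction l with
    | nil => simpa using hasDerivWithinAt_const s S (0 : ℂ)
    | cons i l ih => simpa using (h1 i).fun_add ih
  · refine le_trans ?_ (hB s hs)
    have := List.le_sum_of_subadditive (norm : ℂ → ℝ) norm_zero.le norm_add_le
      (l.map fun i => φ i (A i N s))
    rw [List.map_map] at this
    refine this.trans (List.sum_le_sum fun i _ => ?_)
    exact ((φ i).le_opNorm _).trans (mul_le_of_le_one_left (norm_nonneg _) (hφ1 i))

theorem sum_norm_taylorPolynomial_le (l : List ι) {a : ι → ℕ → 𝔸} {N : ℕ} {L : ℝ} (hL : 0 ≤ L)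
    (ha : ∀ p < N, (l.map fun i => ‖a i p‖).sum ≤ L ^ (p + 1)) (w : ℂ) :
    (l.map fun i => ‖taylorPolynomial N (a i) w‖).sum ≤ L * Real.exp (L * ‖w‖) := by
  calc _ ≤ (l.map fun i => ∑ p ∈ Finset.range N, ‖w‖ ^ p / (p.factorial : ℝ) * ‖a i p‖).sum := by
        refine List.sum_le_sum fun i _ => (norm_sum_le _ _).trans (le_of_eq ?_)
        refine Finset.sum_congr rfl fun p _ => ?_
        rw [norm_smul, norm_div, norm_pow, Complex.norm_natCast]
    _ = ∑ p ∈ Finset.range N, ‖w‖ ^ p / (p.factorial : ℝ) * (l.map fun i => ‖a i p‖).sum := by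
        rw [list_sum_finset_sum]
        exact Finset.sum_congr rfl fun p _ => List.sum_map_mul_left ..
    _ ≤ ∑ p ∈ Finset.range N, L * ((L * ‖w‖) ^ p / (p.factorial : ℝ)) := by
        refine Finset.sum_le_sum fun p hp => ?_
        calc _ ≤ ‖w‖ ^ p / (p.factorial : ℝ) * L ^ (p + 1) := by
              gcongr; exact ha p (Finset.mem_range.1 hp)
          _ = _ := by ring
    _ ≤ L * Real.exp (L * ‖w‖) := by
        rw [← Finset.mul_sum]
        gcongr
        exact Real.sum_le_exp_of_nonneg (by positivity) N

end Taylor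

/-! ### Product formulas for generators of finite smoothness -/

section ProductFormula

set_option linter.unusedSectionVars false

variable {𝔸 : Type*} [NormedRing 𝔸] [NormedAlgebra ℂ 𝔸] [CompleteSpace 𝔸] [StarRing 𝔸]
  [CStarRing 𝔸] [StarModule ℂ 𝔸] [Nontrivial 𝔸] {ι : Type*}

/-- One step of Suzuki's formula of order `2 j + 2`, of duration `τ` and centre `c`, for the
generators `X`. -/
def suzukiStep (l : List ι) (X : ℝ → ι → 𝔸) (j : ℕ) (τ c : ℝ) : 𝔸 :=
  ((suzukiSchedule j).map fun q => strang l (X (c + q.1 * τ)) ((q.2 * τ : ℝ) : ℂ)).prod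

/-- `r` consecutive steps of duration `τ` that start at `t₀`. -/
def suzukiFormula (l : List ι) (X : ℝ → ι → 𝔸) (j : ℕ) (τ t₀ : ℝ) : ℕ → 𝔸
  | 0 => 1
  | r + 1 => suzukiStep l X j τ (t₀ + (r + 1 / 2) * τ) * suzukiFormula l X j τ t₀ r

theorem norm_le_one_of_mem_unitary {u : 𝔸} (h : u ∈ unitary 𝔸) : ‖u‖ ≤ 1 :=
  (CStarRing.norm_of_mem_unitary h).le

/-- Steps of a Suzuki schedule stay inside the time step. -/
theorem suzukiSchedule_mem_Icc {j : ℕ} {q : ℝ × ℝ} (hq : q ∈ suzukiSchedule j) {τ : ℝ} (hτ : 0 ≤ τ)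
    (c : ℝ) : c + q.1 * τ ∈ Set.Icc (c - τ / 2) (c + τ / 2) := by
  have := suzukiSchedule_mem j q hq
  have h2 := abs_nonneg q.2
  have h1 : |q.1| ≤ 1 / 2 := by linarith
  rw [abs_le] at h1
  constructor <;> nlinarith [h1.1, h1.2]

theorem suzukiStep_mem_unitary (l : List ι) {X : ℝ → ι → 𝔸} {j : ℕ} {τ c : ℝ} (hτ : 0 ≤ τ)
    (hX : ∀ t ∈ Set.Icc (c - τ / 2) (c + τ / 2), ∀ i, star (X t i) = -X t i) :
    suzukiStep l X j τ c ∈ unitary 𝔸 := by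
  refine Submonoid.list_prod_mem _ fun a ha => ?_
  obtain ⟨q, hq, rfl⟩ := List.mem_map.1 ha
  exact strang_mem_unitary l (hX _ (suzukiSchedule_mem_Icc hq hτ c)) _

theorem norm_suzukiStep_sub_le (l : List ι) {X Y : ℝ → ι → 𝔸} {j : ℕ} {τ c σ δ : ℝ} (hτ : 0 ≤ τ)
    (hX : ∀ t ∈ Set.Icc (c - τ / 2) (c + τ / 2), ∀ i, star (X t i) = -X t i)
    (hY : ∀ t ∈ Set.Icc (c - τ / 2) (c + τ / 2), ∀ i, star (Y t i) = -Y t i)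
    (hσ : ((suzukiSchedule j).map fun q => |q.2|).sum ≤ σ) (hδ : 0 ≤ δ)
    (hXY : ∀ t ∈ Set.Icc (c - τ / 2) (c + τ / 2), (l.map fun i => ‖X t i - Y t i‖).sum ≤ δ) :
    ‖suzukiStep l X j τ c - suzukiStep l Y j τ c‖ ≤ σ * τ * δ := by
  refine (norm_list_prod_sub_le _
    (fun q hq => norm_le_one_of_mem_unitary
      (strang_mem_unitary l (hX _ (suzukiSchedule_mem_Icc hq hτ c)) _))
    fun q hq => norm_le_one_of_mem_unitary
      (strang_mem_unitary l (hY _ (suzukiSchedule_mem_Icc hq hτ c)) _)).trans ?_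
  calc _ ≤ ((suzukiSchedule j).map fun q : ℝ × ℝ => |q.2| * (τ * δ)).sum := by
        refine List.sum_le_sum fun q hq => ?_
        have hm := suzukiSchedule_mem_Icc hq hτ c
        refine (norm_strang_sub_strang_le l (hX _ hm) (hY _ hm) _).trans ?_
        rw [abs_mul, abs_of_nonneg hτ, mul_assoc]
        have := hXY _ hm
        gcongr
    _ = ((suzukiSchedule j).map fun q => |q.2|).sum * (τ * δ) := List.sum_map_mul_right ..
    _ ≤ σ * (τ * δ) := by gcongr
    _ = _ := by ring

theorem star_taylorPolynomial {N : ℕ} {a : ℕ → 𝔸} (ha : ∀ p < N, star (a p) = -a p) (t : ℝ) :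
    star (taylorPolynomial N a (t : ℂ)) = -taylorPolynomial N a (t : ℂ) := by
  rw [taylorPolynomial, star_sum, ← Finset.sum_neg_distrib]
  refine Finset.sum_congr rfl fun p hp => ?_
  have := star_real_smul (ha p (Finset.mem_range.1 hp)) (t ^ p / (p.factorial : ℝ))
  simpa using this

/-- The local error of Suzuki's formula. The generators are replaced by their Taylor polynomials
at the centre of the step, in the exact evolution and in the formula; for polynomial generators the
error is an entire function of the duration. -/
theorem norm_evolution_sub_suzukiStep_le [IsDedekindFiniteMonoid 𝔸] (l : List ι)
    {A : ι → ℕ → ℝ → 𝔸} {U : ℝ → 𝔸} {c τ L σ : ℝ} (j : ℕ) (hτ : 0 < τ) (hL : 0 < L)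
    (hσ1 : 1 ≤ σ) (hσ : ((suzukiSchedule j).map fun q => |q.2|).sum ≤ σ)
    (hA : ∀ i, ∀ p < 2 * j + 2, ∀ t ∈ Set.Icc (c - τ / 2) (c + τ / 2),
      HasDerivWithinAt (A i p) (A i (p + 1) t) (Set.Icc (c - τ / 2) (c + τ / 2)) t)
    (hskew : ∀ i, ∀ p < 2 * j + 2, ∀ t ∈ Set.Icc (c - τ / 2) (c + τ / 2),
      star (A i p t) = -A i p t)
    (hsum : ∀ p ≤ 2 * j + 2, ∀ t ∈ Set.Icc (c - τ / 2) (c + τ / 2),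
      (l.map fun i => ‖A i p t‖).sum ≤ L ^ (p + 1))
    (hU : ∀ t ∈ Set.Icc (c - τ / 2) (c + τ / 2),
      HasDerivWithinAt U ((l.map fun i => A i 0 t).sum * U t) (Set.Icc (c - τ / 2) (c + τ / 2)) t)
    (hU1 : ∀ t ∈ Set.Icc (c - τ / 2) (c + τ / 2), ‖U t‖ ≤ 1) (hx : σ * (L * τ) ≤ 1) :
    ‖U (c + τ / 2) - suzukiStep l (fun t i => A i 0 t) j τ c * U (c - τ / 2)‖
      ≤ 17 * (σ * (L * τ)) ^ (2 * j + 3) := by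
  set S := Set.Icc (c - τ / 2) (c + τ / 2) with hS
  set x := L * τ with hxdef
  have hx0 : 0 < x := by positivity
  have hcS : c ∈ S := ⟨by linarith, by linarith⟩
  have hbS : c + τ / 2 ∈ S := ⟨by linarith, le_rfl⟩
  have haS : c - τ / 2 ∈ S := ⟨le_rfl, by linarith⟩
  let P : ι → ℂ → 𝔸 := fun i => taylorPolynomial (2 * j + 2) fun p => A i p c
  have hP : ∀ i, Differentiable ℂ (P i) := fun i => differentiable_taylorPolynomial _ _
  -- the error of the Taylor polynomials, summed over the generators
  set δ := L ^ (2 * j + 3) * (τ / 2) ^ (2 * j + 2) with hδ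
  have hδ0 : 0 ≤ δ := by positivity
  have hAP : ∀ t ∈ S, (l.map fun i => ‖A i 0 t - P i ((t - c : ℝ) : ℂ)‖).sum ≤ δ := fun t ht => by
    refine (sum_norm_sub_taylorPolynomial_le l (convex_Icc _ _) hcS hA
      (fun s hs => hsum (2 * j + 2) le_rfl s hs) ht).trans ?_
    have : |t - c| ≤ τ / 2 := abs_le.2 ⟨by linarith [ht.1], by linarith [ht.2]⟩
    rw [hδ]
    exact mul_le_mul_of_nonneg_left (pow_le_pow_left₀ (abs_nonneg _) this _) (by positivity)
  obtain ⟨Φ, Ψ, hΦ⟩ := exists_fundamentalSolution (A := fun z => (l.map fun i => P i z).sum) (by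
    clear hsum hU hAP
    induction l with
    | nil => simp
    | cons i l ih => simpa using (hP i).fun_add ih)
  -- the generators are bounded by `2 L` on the disc of radius `R / 2` with `σ L R = 1`
  set R := 1 / (σ * L) with hR
  have hRpos : 0 < R := by positivity
  have hLR : L * R ≤ 1 := by
    rw [hR, mul_one_div, div_le_one (by positivity)]; nlinarith
  have hτR : τ ≤ R := by
    rw [hR, le_div_iff₀ (by positivity)]; rw [hxdef] at hx; linarith
  have hb : ∀ w : ℂ, ‖w‖ ≤ R / 2 → (l.map fun i => ‖P i w‖).sum ≤ 2 * L := fun w hw => by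
    refine (sum_norm_taylorPolynomial_le l hL.le (fun p hp => hsum p hp.le c hcS) w).trans ?_
    have h1 : Real.exp (L * ‖w‖) ≤ 2 := by
      have h2 : L * ‖w‖ ≤ 1 / 2 := by nlinarith
      have h3 : Real.exp (1 / 2) ^ 2 ≤ 2 ^ 2 := by
        rw [← Real.exp_nat_mul]; norm_num
        linarith [Real.exp_one_lt_d9]
      exact (Real.exp_le_exp.2 h2).trans (le_of_pow_le_pow_left₀ two_ne_zero (by norm_num) h3)
    nlinarith
  have hexp2 : Real.exp 2 ≤ 7.39 := by
    have : Real.exp 2 = Real.exp 1 ^ 2 := by rw [← Real.exp_nat_mul]; norm_num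
    rw [this]
    have := Real.exp_one_lt_d9
    have := Real.exp_pos 1
    nlinarith
  have hx_le : x ≤ σ * x := by nlinarith
  -- the formula and the exact evolution for the polynomial generators
  have key1 : ‖suzukiStep l (fun t i => P i ((t - c : ℝ) : ℂ)) j τ c - propagator Φ Ψ 0 τ‖
      ≤ 2 * 7.39 * (σ * x) ^ (2 * j + 3) := by
    have h1 := norm_suzuki_sub_propagator_le l hP hΦ j hRpos hb hσ1 hσ (z := (τ : ℂ))
      (by rw [Complex.norm_real, Real.norm_of_nonneg hτ.le]; exact hτR)
    have e1 : composeSteps (suzukiSchedule j) (fun c z => strang l (fun i => P i c) z) 0 (τ : ℂ)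
        = suzukiStep l (fun t i => P i ((t - c : ℝ) : ℂ)) j τ c := by
      simp only [composeSteps, suzukiStep]
      congr 1
      refine List.map_congr_left fun q _ => ?_
      push_cast; congr; ext i; congr 1; ring
    have e2 : σ * (R * (2 * L)) = 2 := by rw [hR]; field_simp
    have e3 : τ / R = σ * x := by rw [hR, hxdef]; field_simp
    rw [e1, e2, Complex.norm_real, Real.norm_of_nonneg hτ.le, e3] at h1
    refine h1.trans ?_
    gcongr
  -- replacing the generators in the formula
  have key2 : ‖suzukiStep l (fun t i => A i 0 t) j τ c
      - suzukiStep l (fun t i => P i ((t - c : ℝ) : ℂ)) j τ c‖ ≤ σ * τ * δ :=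
    norm_suzukiStep_sub_le l hτ.le (fun t ht i => hskew i 0 (by omega) t ht)
      (fun t _ i => star_taylorPolynomial (fun p hp => hskew i p hp c hcS) _) hσ hδ0 hAP
  -- replacing the generators in the exact evolution
  have key3 : ‖U (c + τ / 2) - propagator Φ Ψ 0 τ * U (c - τ / 2)‖ ≤ 7.39 * δ * τ := by
    have hsub : ∀ z : ℂ, ‖z‖ ≤ R / 2 → ‖(l.map fun i => P i z).sum‖ ≤ 2 * L := fun z hz => by
      refine le_trans ?_ (hb z hz)
      have := List.le_sum_of_subadditive (norm : 𝔸 → ℝ) norm_zero.le norm_add_le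
        (l.map fun i => P i z)
      simpa [List.map_map, Function.comp_def] using this
    -- `Y t` evolves up to `t` exactly and from `t` on with the polynomial generators, so that only
    -- the difference of the generators enters its derivative
    let Y : ℝ → 𝔸 := fun t => Φ ((τ / 2 : ℝ) : ℂ) * (Ψ ((t - c : ℝ) : ℂ) * U t)
    have hY : ∀ t ∈ S, HasDerivWithinAt Y (Φ ((τ / 2 : ℝ) : ℂ) * (Ψ ((t - c : ℝ) : ℂ) *
        (((l.map fun i => A i 0 t).sum - (l.map fun i => P i ((t - c : ℝ) : ℂ)).sum) * U t))) S t := by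
      intro t ht
      have hs : HasDerivAt (fun t : ℝ => ((t - c : ℝ) : ℂ)) 1 t := by
        simpa using ((hasDerivAt_id t).sub_const c).ofReal_comp
      have h1 : HasDerivAt (fun t : ℝ => Ψ ((t - c : ℝ) : ℂ))
          (-(Ψ ((t - c : ℝ) : ℂ) * (l.map fun i => P i ((t - c : ℝ) : ℂ)).sum)) t := by
        have := (hΦ.right_deriv ((t - c : ℝ) : ℂ)).scomp t hs
        simpa only [one_smul, Function.comp_def] using this
      have h2 := (h1.hasDerivWithinAt.fun_mul (hU t ht)).const_mul (Φ ((τ / 2 : ℝ) : ℂ))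
      convert! h2 using 1
      noncomm_ring
    have hnorm : ∀ t ∈ S, ‖Φ ((τ / 2 : ℝ) : ℂ) * (Ψ ((t - c : ℝ) : ℂ) *
        (((l.map fun i => A i 0 t).sum - (l.map fun i => P i ((t - c : ℝ) : ℂ)).sum) * U t))‖
        ≤ 7.39 * δ := by
      intro t ht
      have ht' : |t - c| ≤ τ / 2 := abs_le.2 ⟨by linarith [ht.1], by linarith [ht.2]⟩
      have n1 := hΦ.norm_left_le hsub (z := ((τ / 2 : ℝ) : ℂ))
        (by rw [Complex.norm_real, Real.norm_of_nonneg (by positivity)]; linarith)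
      have n2 := hΦ.norm_right_le hsub (z := ((t - c : ℝ) : ℂ))
        (by rw [Complex.norm_real, Real.norm_eq_abs]; linarith)
      rw [Complex.norm_real, Real.norm_of_nonneg (by positivity)] at n1
      rw [Complex.norm_real, Real.norm_eq_abs] at n2
      have n3 : ‖(l.map fun i => A i 0 t).sum - (l.map fun i => P i ((t - c : ℝ) : ℂ)).sum‖ ≤ δ := by
        refine le_trans ?_ (hAP t ht)
        have e : (l.map fun i => A i 0 t).sum - (l.map fun i => P i ((t - c : ℝ) : ℂ)).sum
            = (l.map fun i => A i 0 t - P i ((t - c : ℝ) : ℂ)).sum := by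
          clear hsum hU hAP hΦ hb hsub hY key1 key2
          induction l with
          | nil => simp
          | cons i l ih => simp only [List.map_cons, List.sum_cons, ← ih]; abel
        rw [e]
        have := List.le_sum_of_subadditive (norm : 𝔸 → ℝ) norm_zero.le norm_add_le
          (l.map fun i => A i 0 t - P i ((t - c : ℝ) : ℂ))
        simpa [List.map_map, Function.comp_def] using this
      have n12 : Real.exp (2 * L * (τ / 2)) * Real.exp (2 * L * |t - c|) ≤ 7.39 := by
        rw [← Real.exp_add]
        refine (Real.exp_le_exp.2 ?_).trans hexp2
        have : L * |t - c| ≤ L * (τ / 2) := by gcongr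
        have : L * τ ≤ 1 := le_trans hx_le hx
        linarith
      calc _ ≤ ‖Φ ((τ / 2 : ℝ) : ℂ)‖ * (‖Ψ ((t - c : ℝ) : ℂ)‖ * (‖(l.map fun i => A i 0 t).sum
            - (l.map fun i => P i ((t - c : ℝ) : ℂ)).sum‖ * ‖U t‖)) := by
            refine (norm_mul_le _ _).trans ?_
            gcongr
            refine (norm_mul_le _ _).trans ?_
            gcongr
            exact norm_mul_le _ _
        _ ≤ Real.exp (2 * L * (τ / 2)) * (Real.exp (2 * L * |t - c|) * (δ * 1)) := by
            have := hU1 t ht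
            gcongr
        _ = (Real.exp (2 * L * (τ / 2)) * Real.exp (2 * L * |t - c|)) * δ := by ring
        _ ≤ 7.39 * δ := by gcongr
    have := (convex_Icc (c - τ / 2) (c + τ / 2)).norm_image_sub_le_of_norm_hasDerivWithin_le hY
      hnorm haS hbS
    have eb : Y (c + τ / 2) = U (c + τ / 2) := by
      have : c + τ / 2 - c = τ / 2 := by ring
      simp only [Y, this]
      rw [← mul_assoc, hΦ.left_mul_right, one_mul]
    have ea : Y (c - τ / 2) = propagator Φ Ψ 0 τ * U (c - τ / 2) := by
      have : c - τ / 2 - c = -(τ / 2) := by ring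
      simp only [Y, this, propagator, zero_add, zero_sub, mul_assoc]
      push_cast; rfl
    rw [eb, ea] at this
    have hlen : ‖c + τ / 2 - (c - τ / 2)‖ = τ := by
      rw [Real.norm_of_nonneg] <;> linarith
    rwa [hlen] at this
  have hδτ : δ * τ ≤ (1 / 4) * x ^ (2 * j + 3) := by
    have e : δ * τ = (1 / 4) ^ (j + 1) * x ^ (2 * j + 3) := by
      have : (1 / 4 : ℝ) ^ (j + 1) = (1 / 2) ^ (2 * j + 2) := by
        rw [show 2 * j + 2 = 2 * (j + 1) by ring, pow_mul]; norm_num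
      rw [hδ, hxdef, this, mul_pow, div_pow, one_div, inv_pow, pow_succ τ (2 * j + 2)]
      field_simp
    rw [e]
    gcongr
    calc (1 / 4 : ℝ) ^ (j + 1) ≤ (1 / 4) ^ 1 :=
          pow_le_pow_of_le_one (by norm_num) (by norm_num) (by omega)
      _ = 1 / 4 := pow_one _
  have hx1 : x ^ (2 * j + 3) ≤ (σ * x) ^ (2 * j + 3) := pow_le_pow_left₀ hx0.le hx_le _
  have hx2 : σ * x ^ (2 * j + 3) ≤ (σ * x) ^ (2 * j + 3) := by
    rw [mul_pow σ x]
    exact mul_le_mul_of_nonneg_right (le_self_pow₀ hσ1 (by omega)) (by positivity)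
  set V := suzukiStep l (fun t i => A i 0 t) j τ c
  set V' := suzukiStep l (fun t i => P i ((t - c : ℝ) : ℂ)) j τ c
  have split : U (c + τ / 2) - V * U (c - τ / 2)
      = (U (c + τ / 2) - propagator Φ Ψ 0 τ * U (c - τ / 2))
        - (V' - propagator Φ Ψ 0 τ) * U (c - τ / 2) - (V - V') * U (c - τ / 2) := by
    noncomm_ring
  have hUa := hU1 _ haS
  rw [split]
  calc _ ≤ ‖U (c + τ / 2) - propagator Φ Ψ 0 τ * U (c - τ / 2)‖
        + ‖V' - propagator Φ Ψ 0 τ‖ * ‖U (c - τ / 2)‖ + ‖V - V'‖ * ‖U (c - τ / 2)‖ :=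
        (norm_sub_le _ _).trans (add_le_add ((norm_sub_le _ _).trans
          (add_le_add le_rfl (norm_mul_le _ _))) (norm_mul_le _ _))
    _ ≤ 7.39 * δ * τ + 2 * 7.39 * (σ * x) ^ (2 * j + 3) * 1 + σ * τ * δ * 1 := by gcongr
    _ ≤ 17 * (σ * x) ^ (2 * j + 3) := by nlinarith

/-- The solution of `U' = A U` for a skew-adjoint generator is isometric. -/
theorem norm_evolution_le_one {S : Set ℝ} (hS : Convex ℝ S) {A U : ℝ → 𝔸} {t₀ : ℝ} (h₀ : t₀ ∈ S)
    (hU0 : U t₀ = 1) (hU : ∀ t ∈ S, HasDerivWithinAt U (A t * U t) S t)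
    (hA : ∀ t ∈ S, star (A t) = -A t) {t : ℝ} (ht : t ∈ S) : ‖U t‖ ≤ 1 := by
  have hd : ∀ t ∈ S, HasDerivWithinAt (fun t => star (U t) * U t) 0 S t := fun t ht => by
    convert! (hU t ht).star.fun_mul (hU t ht) using 1
    rw [star_mul, hA t ht]; noncomm_ring
  have := hS.norm_image_sub_le_of_norm_hasDerivWithin_le hd (C := 0) (by simp) h₀ ht
  rw [zero_mul, norm_le_zero_iff, sub_eq_zero, hU0, star_one, one_mul] at this
  have h1 : ‖U t‖ * ‖U t‖ = 1 := by
    rw [← CStarRing.norm_star_mul_self, this, CStarRing.norm_one]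
  nlinarith [norm_nonneg (U t)]

theorem timeStep_subset {Δt τ t₀ : ℝ} {r s : ℕ} (hτ : 0 < τ) (hr : r * τ = Δt) (hs : s < r) :
    Set.Icc (t₀ + (s + 1 / 2) * τ - τ / 2) (t₀ + (s + 1 / 2) * τ + τ / 2)
      ⊆ Set.Icc t₀ (t₀ + Δt) := by
  intro t ht
  have h0 : (0 : ℝ) ≤ s := Nat.cast_nonneg s
  have h1 : (s : ℝ) + 1 ≤ r := by exact_mod_cast hs
  have h2 : ((s : ℝ) + 1) * τ ≤ r * τ := by gcongr
  have h3 : 0 ≤ s * τ := by positivity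
  exact ⟨by linarith [ht.1], by linarith [ht.2]⟩

/-- The global error of `r` steps of Suzuki's formula. -/
theorem norm_evolution_sub_suzukiFormula_le [IsDedekindFiniteMonoid 𝔸] (l : List ι)
    {A : ι → ℕ → ℝ → 𝔸} {U : ℝ → 𝔸} {t₀ Δt τ L σ : ℝ} (j r : ℕ) (hτ : 0 < τ) (hr : r * τ = Δt)
    (hL : 0 < L) (hσ1 : 1 ≤ σ) (hσ : ((suzukiSchedule j).map fun q => |q.2|).sum ≤ σ)
    (hA : ∀ i, ∀ p < 2 * j + 2, ∀ t ∈ Set.Icc t₀ (t₀ + Δt),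
      HasDerivWithinAt (A i p) (A i (p + 1) t) (Set.Icc t₀ (t₀ + Δt)) t)
    (hskew : ∀ i, ∀ p < 2 * j + 2, ∀ t ∈ Set.Icc t₀ (t₀ + Δt), star (A i p t) = -A i p t)
    (hsum : ∀ p ≤ 2 * j + 2, ∀ t ∈ Set.Icc t₀ (t₀ + Δt),
      (l.map fun i => ‖A i p t‖).sum ≤ L ^ (p + 1))
    (hU0 : U t₀ = 1)
    (hU : ∀ t ∈ Set.Icc t₀ (t₀ + Δt),
      HasDerivWithinAt U ((l.map fun i => A i 0 t).sum * U t) (Set.Icc t₀ (t₀ + Δt)) t)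
    (hx : σ * (L * τ) ≤ 1) :
    ‖U (t₀ + Δt) - suzukiFormula l (fun t i => A i 0 t) j τ t₀ r‖
      ≤ r * (17 * (σ * (L * τ)) ^ (2 * j + 3)) := by
  have hΔ : 0 ≤ Δt := by rw [← hr]; positivity
  have hskew_sum : ∀ t ∈ Set.Icc t₀ (t₀ + Δt),
      star (l.map fun i => A i 0 t).sum = -(l.map fun i => A i 0 t).sum := fun t ht => by
    clear hsum hU
    induction l with
    | nil => simp
    | cons i l ih =>
      simp only [List.map_cons, List.sum_cons, star_add, ih, hskew i 0 (by omega) t ht]; abel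
  have hU1 : ∀ t ∈ Set.Icc t₀ (t₀ + Δt), ‖U t‖ ≤ 1 := fun t ht =>
    norm_evolution_le_one (convex_Icc _ _) (Set.left_mem_Icc.2 (by linarith)) hU0 hU hskew_sum ht
  have main : ∀ s ≤ r, ‖U (t₀ + s * τ) - suzukiFormula l (fun t i => A i 0 t) j τ t₀ s‖
      ≤ s * (17 * (σ * (L * τ)) ^ (2 * j + 3)) := by
    intro s
    induction s with
    | zero => simp [suzukiFormula, hU0]
    | succ s ih =>
      intro hs
      have hsubset := timeStep_subset (t₀ := t₀) hτ hr (show s < r by omega)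
      have step := norm_evolution_sub_suzukiStep_le (U := U) (c := t₀ + (s + 1 / 2) * τ) l j hτ hL
        hσ1 hσ (fun i p hp t ht => (hA i p hp t (hsubset ht)).mono hsubset)
        (fun i p hp t ht => hskew i p hp t (hsubset ht))
        (fun p hp t ht => hsum p hp t (hsubset ht)) (fun t ht => (hU t (hsubset ht)).mono hsubset)
        (fun t ht => hU1 t (hsubset ht)) hx
      have e1 : t₀ + (s + 1 / 2) * τ + τ / 2 = t₀ + ((s + 1 : ℕ) : ℝ) * τ := by push_cast; ring
      have e2 : t₀ + (s + 1 / 2) * τ - τ / 2 = t₀ + s * τ := by ring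
      have hV : ‖suzukiStep l (fun t i => A i 0 t) j τ (t₀ + (s + 1 / 2) * τ)‖ ≤ 1 :=
        norm_le_one_of_mem_unitary
          (suzukiStep_mem_unitary l hτ.le fun t ht i => hskew i 0 (by omega) t (hsubset ht))
      rw [e1, e2] at step
      rw [suzukiFormula]
      set V := suzukiStep l (fun t i => A i 0 t) j τ (t₀ + (s + 1 / 2) * τ)
      set W := suzukiFormula l (fun t i => A i 0 t) j τ t₀ s
      have split : U (t₀ + ((s + 1 : ℕ) : ℝ) * τ) - V * W
          = (U (t₀ + ((s + 1 : ℕ) : ℝ) * τ) - V * U (t₀ + s * τ)) + V * (U (t₀ + s * τ) - W) := by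
        noncomm_ring
      rw [split]
      calc _ ≤ 17 * (σ * (L * τ)) ^ (2 * j + 3) + 1 * (s * (17 * (σ * (L * τ)) ^ (2 * j + 3))) :=
            (norm_add_le _ _).trans (add_le_add step ((norm_mul_le _ _).trans
              (mul_le_mul hV (ih (by omega)) (norm_nonneg _) zero_le_one)))
        _ = _ := by push_cast; ring
  simpa [hr] using main r le_rfl

/-- Perturbing the generators of Suzuki's formula. -/
theorem norm_suzukiFormula_sub_le (l : List ι) {X Y : ℝ → ι → 𝔸} {t₀ Δt τ σ δ : ℝ} (j r : ℕ)
    (hτ : 0 < τ) (hr : r * τ = Δt)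
    (hσ : ((suzukiSchedule j).map fun q => |q.2|).sum ≤ σ) (hδ : 0 ≤ δ)
    (hX : ∀ t ∈ Set.Icc t₀ (t₀ + Δt), ∀ i, star (X t i) = -X t i)
    (hY : ∀ t ∈ Set.Icc t₀ (t₀ + Δt), ∀ i, star (Y t i) = -Y t i)
    (hXY : ∀ t ∈ Set.Icc t₀ (t₀ + Δt), (l.map fun i => ‖X t i - Y t i‖).sum ≤ δ) :
    ‖suzukiFormula l X j τ t₀ r - suzukiFormula l Y j τ t₀ r‖ ≤ σ * Δt * δ := by
  have main : ∀ s ≤ r, ‖suzukiFormula l X j τ t₀ s‖ ≤ 1 ∧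
      ‖suzukiFormula l X j τ t₀ s - suzukiFormula l Y j τ t₀ s‖ ≤ s * (σ * τ * δ) := by
    intro s
    induction s with
    | zero => simp [suzukiFormula]
    | succ s ih =>
      intro hs
      obtain ⟨h1, h2⟩ := ih (by omega)
      have hsubset := timeStep_subset (t₀ := t₀) hτ hr (show s < r by omega)
      have hVX := norm_le_one_of_mem_unitary
        (suzukiStep_mem_unitary l (j := j) hτ.le fun t ht => hX t (hsubset ht))
      have hVY := norm_le_one_of_mem_unitary
        (suzukiStep_mem_unitary l (j := j) hτ.le fun t ht => hY t (hsubset ht))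
      have hstep := norm_suzukiStep_sub_le l hτ.le (fun t ht => hX t (hsubset ht))
        (fun t ht => hY t (hsubset ht)) hσ hδ fun t ht => hXY t (hsubset ht)
      simp only [suzukiFormula]
      refine ⟨(norm_mul_le _ _).trans (mul_le_one₀ hVX (norm_nonneg _) h1), ?_⟩
      set V := suzukiStep l X j τ (t₀ + (s + 1 / 2) * τ)
      set V' := suzukiStep l Y j τ (t₀ + (s + 1 / 2) * τ)
      set W := suzukiFormula l X j τ t₀ s
      set W' := suzukiFormula l Y j τ t₀ s
      have split : V * W - V' * W' = (V - V') * W + V' * (W - W') := by noncomm_ring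
      rw [split]
      calc _ ≤ σ * τ * δ * 1 + 1 * (s * (σ * τ * δ)) := by
            refine (norm_add_le _ _).trans (add_le_add ((norm_mul_le _ _).trans ?_)
              ((norm_mul_le _ _).trans ?_)) <;> gcongr
            exact (norm_nonneg _).trans hstep
        _ = _ := by push_cast; ring
  have := (main r le_rfl).2
  calc _ ≤ _ := this
    _ = _ := by rw [← hr]; ring

end ProductFormula

/-! ### Norms of one-sparse operators -/

section OneSparse

variable {n : ℕ}

theorem norm_entry_le (A : Op n) (x y : Basis n) : ‖A x y‖ ≤ ‖A‖ := by
  have h := A.l2_opNorm_mulVec (WithLp.toLp 2 (Pi.single y 1))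
  have h2 := PiLp.norm_apply_le
    (WithLp.toLp 2 (A.mulVec (WithLp.toLp 2 (Pi.single y (1 : ℂ))).ofLp)) x
  have h3 : ‖WithLp.toLp 2 (Pi.single y (1 : ℂ) : Basis n → ℂ)‖ = 1 := by
    simp [← EuclideanSpace.single.eq_1]
  rw [h3, mul_one] at h
  refine le_trans (le_of_eq ?_) (h2.trans h)
  simp

/-- There are no cross terms in the square of a sum with at most one nonzero term. -/
theorem norm_sum_sq_le_sum {α : Type*} [Fintype α] (f : α → ℂ)
    (h : ∀ a b, f a ≠ 0 → f b ≠ 0 → a = b) : ‖∑ a, f a‖ ^ 2 ≤ ∑ a, ‖f a‖ ^ 2 := by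
  by_cases h0 : ∃ a, f a ≠ 0
  · obtain ⟨a, ha⟩ := h0
    have hz : ∀ b, b ≠ a → f b = 0 := fun b hb => by
      by_contra hne; exact hb (h b a hne ha)
    rw [Fintype.sum_eq_single a hz]
    exact Finset.single_le_sum (f := fun a => ‖f a‖ ^ 2) (fun b _ => by positivity)
      (Finset.mem_univ a)
  · push Not at h0
    simp [h0]

/-- A matrix with at most one nonzero element in each row and column is bounded by its largest
element. -/
theorem norm_le_of_oneSparse {A : Op n} {m : ℝ} (hm : 0 ≤ m) (hA : ∀ x y, ‖A x y‖ ≤ m)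
    (hrow : ∀ x y y', A x y ≠ 0 → A x y' ≠ 0 → y = y')
    (hcol : ∀ x x' y, A x y ≠ 0 → A x' y ≠ 0 → x = x') : ‖A‖ ≤ m := by
  rw [Matrix.l2_opNorm_def]
  refine ContinuousLinearMap.opNorm_le_bound _ hm fun v => ?_
  refine le_of_pow_le_pow_left₀ two_ne_zero (by positivity) ?_
  rw [mul_pow, EuclideanSpace.norm_sq_eq, EuclideanSpace.norm_sq_eq, Finset.mul_sum]
  have hrow' : ∀ x, ‖∑ y, A x y * v y‖ ^ 2 ≤ ∑ y, ‖A x y‖ ^ 2 * ‖v y‖ ^ 2 := fun x => by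
    refine (norm_sum_sq_le_sum _ fun y y' h h' =>
      hrow x y y' (left_ne_zero_of_mul h) (left_ne_zero_of_mul h')).trans (le_of_eq ?_)
    exact Finset.sum_congr rfl fun y _ => by rw [norm_mul, mul_pow]
  have hcol' : ∀ y, ∑ x, ‖A x y‖ ^ 2 ≤ m ^ 2 := fun y => by
    by_cases h0 : ∃ x, A x y ≠ 0
    · obtain ⟨x, hx⟩ := h0
      rw [Fintype.sum_eq_single x fun x' hx' => ?_]
      · have := hA x y; gcongr
      · have : A x' y = 0 := by
          by_contra hne; exact hx' (hcol x' x y hne hx)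
        simp [this]
    · push Not at h0
      simp [h0]; positivity
  calc _ = ∑ x, ‖∑ y, A x y * v y‖ ^ 2 := Finset.sum_congr rfl fun x _ => by
        simp [Matrix.mulVec, dotProduct]
    _ ≤ ∑ x, ∑ y, ‖A x y‖ ^ 2 * ‖v y‖ ^ 2 := Finset.sum_le_sum fun x _ => hrow' x
    _ = ∑ y, (∑ x, ‖A x y‖ ^ 2) * ‖v y‖ ^ 2 := by
        rw [Finset.sum_comm]; exact Finset.sum_congr rfl fun y _ => (Finset.sum_mul ..).symm
    _ ≤ ∑ y, m ^ 2 * ‖v y‖ ^ 2 := Finset.sum_le_sum fun y _ => by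
        have := hcol' y; gcongr

end OneSparse

/-! ### Decomposition into one-sparse terms -/

section Decomposition

variable {n d : ℕ}

theorem Linked.symm {col : Fin d → Basis n → Basis n} {x y : Basis n} (h : Linked col x y) :
    Linked col y x := ⟨h.2, h.1⟩

variable (label : (Fin d → Basis n → Basis n) → Basis n → Basis n → ℕ)
  (col : Fin d → Basis n → Basis n)

open scoped Classical in
/-- The part of an operator at the linked positions with label `j`. -/
def sparsePart (j : ℕ) : Op n →ₗ[ℂ] Op n where
  toFun A := Matrix.of fun x y => if Linked col x y ∧ label col x y = j then A x y else 0
  map_add' A B := by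
    ext x y
    simp only [Matrix.add_apply, Matrix.of_apply]
    split_ifs <;> simp
  map_smul' c A := by
    ext x y
    simp only [Matrix.smul_apply, Matrix.of_apply, RingHom.id_apply]
    split_ifs <;> simp

open scoped Classical in
theorem sparsePart_apply (j : ℕ) (A : Op n) (x y : Basis n) :
    sparsePart label col j A x y = if Linked col x y ∧ label col x y = j then A x y else 0 := rfl

variable {label}

/-- An operator that vanishes outside the positions with a common label is one-sparse. -/
theorem norm_le_of_label (hl : IsOneSparseDecomposition label) {col : Fin d → Basis n → Basis n}
    {j : ℕ} {A : Op n} {m : ℝ}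
    (hm : 0 ≤ m) (hA : ∀ x y, ‖A x y‖ ≤ m)
    (hsupp : ∀ x y, A x y ≠ 0 → Linked col x y ∧ label col x y = j) : ‖A‖ ≤ m := by
  refine norm_le_of_oneSparse hm hA (fun x y y' h h' => ?_) fun x x' y h h' => ?_
  · obtain ⟨h1, h2⟩ := hsupp _ _ h
    obtain ⟨h1', h2'⟩ := hsupp _ _ h'
    exact (hl col x y' h1').2.2 y h1 (h2.trans h2'.symm)
  · obtain ⟨h1, h2⟩ := hsupp _ _ h
    obtain ⟨h1', h2'⟩ := hsupp _ _ h'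
    refine (hl col y x' h1'.symm).2.2 x h1.symm ?_
    rw [(hl col x y h1).2.1, (hl col x' y h1').2.1, h2, h2']

theorem norm_sparsePart_le (hl : IsOneSparseDecomposition label) (j : ℕ) (A : Op n) :
    ‖sparsePart label col j A‖ ≤ ‖A‖ := by
  refine norm_le_of_label hl (norm_nonneg A) (fun x y => ?_) (j := j) (col := col) fun x y h => ?_
  · rw [sparsePart_apply]
    split_ifs
    · exact norm_entry_le A x y
    · simp
  · rw [sparsePart_apply] at h
    by_contra hne
    rw [if_neg hne] at h
    exact h rfl

theorem isHermitian_sparsePart (hl : IsOneSparseDecomposition label) (j : ℕ) {A : Op n}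
    (hA : A.IsHermitian) : (sparsePart label col j A).IsHermitian := by
  ext x y
  rw [Matrix.conjTranspose_apply, sparsePart_apply, sparsePart_apply]
  by_cases h : Linked col x y
  · have hiff : (Linked col y x ∧ label col y x = j) ↔ (Linked col x y ∧ label col x y = j) := by
      rw [(hl col x y h).2.1]; exact ⟨fun h' => ⟨h, h'.2⟩, fun h' => ⟨h.symm, h'.2⟩⟩
    by_cases hj : Linked col x y ∧ label col x y = j
    · rw [if_pos hj, if_pos (hiff.2 hj)]
      exact hA.apply x y
    · rw [if_neg hj, if_neg fun h' => hj (hiff.1 h'), star_zero]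
  · have h' : ¬ Linked col y x := fun h' => h h'.symm
    simp [h, h']

theorem sum_sparsePart (hl : IsOneSparseDecomposition label) {A : Op n}
    (hA : ∀ x y, A x y ≠ 0 → Linked col x y) :
    ((List.finRange (6 * d ^ 2)).map fun j : Fin (6 * d ^ 2) =>
      sparsePart label col j A).sum = A := by
  rw [← List.ofFn_eq_map, List.sum_ofFn]
  ext x y
  rw [Matrix.sum_apply]
  simp only [sparsePart_apply]
  by_cases h : A x y = 0
  · simp [h]
  · have hlk := hA x y h
    rw [Fintype.sum_eq_single ⟨label col x y, (hl col x y hlk).1⟩]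
    · simp [hlk]
    · intro j hj
      rw [if_neg]
      rintro ⟨-, h'⟩
      exact hj (Fin.ext h'.symm)

end Decomposition

/-! ### The generators of the product formula -/

section Generators

variable {n M d nt nH : ℕ}

/-- The indices `(μ, j)` of the one-sparse terms, in the order of the product formula. -/
def termList (M d : ℕ) : List (Fin M × Fin (6 * d ^ 2)) :=
  (List.finRange M).flatMap fun μ => (List.finRange (6 * d ^ 2)).map fun j => (μ, j)

/-- The generator `-i T† A T`. -/
def rotated (T : Matrix.unitaryGroup (Basis n) ℂ) : Op n →ₗ[ℂ] Op n where
  toFun A := -Complex.I • ((T : Op n).conjTranspose * A * (T : Op n))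
  map_add' A B := by rw [mul_add, add_mul, smul_add]
  map_smul' c A := by
    rw [mul_smul_comm, smul_mul_assoc, smul_comm, RingHom.id_apply]

theorem rotated_apply (T : Matrix.unitaryGroup (Basis n) ℂ) (A : Op n) :
    rotated T A = -Complex.I • ((T : Op n).conjTranspose * A * (T : Op n)) := rfl

theorem norm_unitary_le_one (T : Matrix.unitaryGroup (Basis n) ℂ) : ‖(T : Op n)‖ ≤ 1 :=
  norm_le_one_of_mem_unitary T.2

theorem norm_rotated_le (T : Matrix.unitaryGroup (Basis n) ℂ) (A : Op n) :
    ‖rotated T A‖ ≤ ‖A‖ := by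
  rw [rotated_apply, norm_smul, norm_neg, Complex.norm_I, one_mul]
  have h1 := norm_unitary_le_one T
  have h2 : ‖(T : Op n).conjTranspose‖ ≤ 1 := by rwa [Matrix.l2_opNorm_conjTranspose]
  calc _ ≤ ‖(T : Op n).conjTranspose‖ * ‖A‖ * ‖(T : Op n)‖ :=
        (norm_mul_le _ _).trans (by gcongr; exact norm_mul_le _ _)
    _ ≤ 1 * ‖A‖ * 1 := by gcongr
    _ = ‖A‖ := by ring

theorem star_rotated (T : Matrix.unitaryGroup (Basis n) ℂ) {A : Op n} (hA : A.IsHermitian) :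
    star (rotated T A) = -rotated T A := by
  rw [rotated_apply, star_smul, Matrix.star_eq_conjTranspose, Matrix.conjTranspose_mul,
    Matrix.conjTranspose_mul, Matrix.conjTranspose_conjTranspose, hA.eq, ← mul_assoc]
  simp

theorem sum_termList_le {f : Fin M × Fin (6 * d ^ 2) → ℝ} {g : Fin M → ℝ}
    (h : ∀ i, f i ≤ g i.1) : ((termList M d).map f).sum ≤ 6 * (d : ℝ) ^ 2 * ∑ μ, g μ := by
  have h1 : ∀ l : List (Fin M), ((l.flatMap fun μ => (List.finRange (6 * d ^ 2)).map
      fun j => (μ, j)).map f).sum ≤ 6 * (d : ℝ) ^ 2 * (l.map g).sum := by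
    intro l
    induction l with
    | nil => simp
    | cons μ l ih =>
      rw [List.flatMap_cons, List.map_append, List.sum_append, List.map_cons, List.sum_cons,
        mul_add]
      refine add_le_add ?_ ih
      rw [List.map_map]
      refine (List.sum_le_sum (g := fun _ => g μ) fun j _ => h (μ, j)).trans (le_of_eq ?_)
      simp
  refine (h1 _).trans (le_of_eq ?_)
  rw [← List.ofFn_eq_map, List.sum_ofFn]

theorem sum_map_termList {𝔸 : Type*} [AddCommMonoid 𝔸] (f : Fin M × Fin (6 * d ^ 2) → 𝔸) :
    ((termList M d).map f).sum =
      ∑ μ, ((List.finRange (6 * d ^ 2)).map fun j => f (μ, j)).sum := by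
  rw [termList, List.flatMap, List.map_flatten, List.sum_flatten, List.map_map, List.map_map,
    ← List.sum_ofFn, List.ofFn_eq_map]
  congr 1
  refine List.map_congr_left fun μ _ => ?_
  simp [Function.comp_def]

variable (label : (Fin d → Basis n → Basis n) → Basis n → Basis n → ℕ)
  (O : Oracles n M d nt nH)

/-- The generator `-i T† A T` with `A` the part of label `j` of the given operator. -/
def exactGenerator (i : Fin M × Fin (6 * d ^ 2)) : Op n →ₗ[ℂ] Op n :=
  rotated (O.T i.1) ∘ₗ sparsePart label (O.col i.1) i.2

/-- The generator of the term `i` at mesh time `q` as the oracles give it. -/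
def oracleGenerator (Υ : ℝ) (q : Fin (2 ^ nt)) (i : Fin M × Fin (6 * d ^ 2)) : Op n :=
  rotated (O.T i.1) (oneSparseTerm label O Υ i.1 i.2 q)

variable {label}

theorem exactGenerator_apply (i : Fin M × Fin (6 * d ^ 2)) (A : Op n) :
    exactGenerator label O i A = rotated (O.T i.1) (sparsePart label (O.col i.1) i.2 A) := rfl

theorem norm_exactGenerator_le (hl : IsOneSparseDecomposition label)
    (i : Fin M × Fin (6 * d ^ 2)) (A : Op n) : ‖exactGenerator label O i A‖ ≤ ‖A‖ := by
  rw [exactGenerator_apply]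
  exact (norm_rotated_le _ _).trans (norm_sparsePart_le _ hl _ _)

theorem star_exactGenerator (hl : IsOneSparseDecomposition label)
    (i : Fin M × Fin (6 * d ^ 2)) {A : Op n} (hA : A.IsHermitian) :
    star (exactGenerator label O i A) = -exactGenerator label O i A := by
  rw [exactGenerator_apply]
  exact star_rotated _ (isHermitian_sparsePart _ hl _ hA)

open scoped Classical in
theorem oneSparseTerm_apply (label : (Fin d → Basis n → Basis n) → Basis n → Basis n → ℕ) (Υ : ℝ)
    (μ : Fin M) (j : ℕ) (q : Fin (2 ^ nt)) (x y : Basis n) :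
    oneSparseTerm label O Υ μ j q x y =
      if Linked (O.col μ) x y ∧ label (O.col μ) x y = j then
        if x < y then decode Υ (fun p => O.val p x y μ q)
        else if y < x then (starRingEnd ℂ) (decode Υ (fun p => O.val p y x μ q))
        else ((decode Υ (fun p => O.val p x x μ q)).re : ℂ)
      else 0 := by
  unfold oneSparseTerm; rfl

theorem isHermitian_oneSparseTerm (hl : IsOneSparseDecomposition label) (Υ : ℝ) (μ : Fin M) (j : ℕ)
    (q : Fin (2 ^ nt)) : (oneSparseTerm label O Υ μ j q).IsHermitian := by
  ext x y
  rw [Matrix.conjTranspose_apply]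
  rw [oneSparseTerm_apply, oneSparseTerm_apply]
  by_cases h : Linked (O.col μ) x y
  · have hiff : (Linked (O.col μ) y x ∧ label (O.col μ) y x = j) ↔
        (Linked (O.col μ) x y ∧ label (O.col μ) x y = j) := by
      rw [(hl _ x y h).2.1]; exact ⟨fun h' => ⟨h, h'.2⟩, fun h' => ⟨h.symm, h'.2⟩⟩
    by_cases hj : Linked (O.col μ) x y ∧ label (O.col μ) x y = j
    · rw [if_pos hj, if_pos (hiff.2 hj)]
      rcases lt_trichotomy x y with hxy | rfl | hxy
      · simp [hxy, hxy.not_gt]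
      · simp
      · simp [hxy, hxy.not_gt]
    · rw [if_neg hj, if_neg fun h' => hj (hiff.1 h'), star_zero]
  · have h' : ¬ Linked (O.col μ) y x := fun h' => h h'.symm
    simp [h, h']

theorem star_oracleGenerator (hl : IsOneSparseDecomposition label) (Υ : ℝ) (q : Fin (2 ^ nt))
    (i : Fin M × Fin (6 * d ^ 2)) :
    star (oracleGenerator label O Υ q i) = -oracleGenerator label O Υ q i :=
  star_rotated _ (isHermitian_oneSparseTerm O hl _ _ _ _)

end Generators

/-! ### Finite precision -/

section Precision

variable {n M d nt nH : ℕ}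

theorem norm_exp_I_mul_sub_le (a b : ℝ) :
    ‖Complex.exp (Complex.I * (a : ℂ)) - Complex.exp (Complex.I * (b : ℂ))‖ ≤ |a - b| := by
  have e : Complex.exp (Complex.I * (a : ℂ)) - Complex.exp (Complex.I * (b : ℂ))
      = Complex.exp (Complex.I * (b : ℂ)) * (Complex.exp (Complex.I * ((a - b : ℝ) : ℂ)) - 1) := by
    rw [mul_sub, ← Complex.exp_add]; push_cast; ring_nf
  rw [e, norm_mul, mul_comm Complex.I (b : ℂ), Complex.norm_exp_ofReal_mul_I, one_mul]
  exact Real.norm_exp_I_mul_ofReal_sub_one_le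

/-- The encoding error of a matrix element. The constant `8` bounds `1 + 2 π`. -/
theorem norm_decode_sub_le {Υ ρ φ : ℝ} {v : Fin nH → Bool} (hρ : 0 ≤ ρ) (hΥ : ρ ≤ Υ)
    (h1 : |ρ - Υ * modulusCode v| ≤ Υ / 2 ^ (nH / 2))
    (h2 : |φ - 2 * Real.pi * phaseCode v| ≤ 2 * Real.pi / 2 ^ (nH / 2)) :
    ‖decode Υ v - (ρ : ℂ) * Complex.exp (Complex.I * (φ : ℂ))‖ ≤ 8 * Υ / 2 ^ (nH / 2) := by
  set m := modulusCode v
  set f := phaseCode v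
  have e : decode Υ v - (ρ : ℂ) * Complex.exp (Complex.I * (φ : ℂ))
      = ((Υ * m - ρ : ℝ) : ℂ) * Complex.exp (Complex.I * ((2 * Real.pi * f : ℝ) : ℂ))
        + (ρ : ℂ) * (Complex.exp (Complex.I * ((2 * Real.pi * f : ℝ) : ℂ))
          - Complex.exp (Complex.I * (φ : ℂ))) := by
    simp only [decode, m, f]; push_cast; ring
  rw [e]
  refine (norm_add_le _ _).trans ?_
  rw [norm_mul, norm_mul, mul_comm Complex.I, Complex.norm_exp_ofReal_mul_I, mul_one,
    Complex.norm_real, Complex.norm_real, Real.norm_eq_abs, Real.norm_of_nonneg hρ, abs_sub_comm,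
    mul_comm _ Complex.I]
  have h3 := norm_exp_I_mul_sub_le (2 * Real.pi * f) φ
  rw [abs_sub_comm] at h3
  have hΥ0 : 0 ≤ Υ := hρ.trans hΥ
  calc _ ≤ Υ / 2 ^ (nH / 2) + Υ * (2 * Real.pi / 2 ^ (nH / 2)) :=
        add_le_add h1 (mul_le_mul hΥ (h3.trans h2) (norm_nonneg _) hΥ0)
    _ = (1 + 2 * Real.pi) * Υ / 2 ^ (nH / 2) := by ring
    _ ≤ 8 * Υ / 2 ^ (nH / 2) := by
        have := Real.pi_lt_d2
        gcongr; linarith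

theorem meshTime_mem {t₀ Δt : ℝ} (hΔt : 0 ≤ Δt) (q : Fin (2 ^ nt)) :
    meshTime t₀ Δt q ∈ Set.Icc t₀ (t₀ + Δt) := by
  have h0 : (0 : ℝ) ≤ (q : ℕ) := Nat.cast_nonneg _
  have h1 : ((q : ℕ) : ℝ) + 1 ≤ 2 ^ nt := by exact_mod_cast q.2
  have h2 : ((q : ℕ) + 1 / 2) * Δt / 2 ^ nt ≤ Δt := by
    rw [div_le_iff₀ (by positivity)]; nlinarith
  have h3 : 0 ≤ ((q : ℕ) + 1 / 2) * Δt / 2 ^ nt := by positivity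
  exact ⟨by rw [meshTime]; linarith, by rw [meshTime]; linarith⟩

/-- Every time is within half a mesh width of a mesh time. -/
theorem exists_meshTime_near {t₀ Δt : ℝ} (hΔt : 0 < Δt) (nt : ℕ) {t : ℝ}
    (ht : t ∈ Set.Icc t₀ (t₀ + Δt)) :
    ∃ q : Fin (2 ^ nt), |meshTime t₀ Δt q - t| ≤ Δt / 2 ^ (nt + 1) := by
  set s := (t - t₀) * 2 ^ nt / Δt with hs
  have hs0 : 0 ≤ s := div_nonneg (mul_nonneg (by linarith [ht.1]) (by positivity)) hΔt.le
  have hs1 : s ≤ 2 ^ nt := by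
    rw [hs, div_le_iff₀ hΔt, mul_comm]
    gcongr; linarith [ht.2]
  have hts : t = t₀ + s * Δt / 2 ^ nt := by rw [hs]; field_simp; ring
  suffices h : ∃ q : Fin (2 ^ nt), |((q : ℕ) : ℝ) + 1 / 2 - s| ≤ 1 / 2 by
    obtain ⟨q, hq⟩ := h
    refine ⟨q, ?_⟩
    have e : meshTime t₀ Δt q - t = (((q : ℕ) : ℝ) + 1 / 2 - s) * (Δt / 2 ^ nt) := by
      rw [meshTime, hts]; ring
    rw [e, abs_mul, abs_of_nonneg (by positivity : (0 : ℝ) ≤ Δt / 2 ^ nt), pow_succ]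
    calc _ ≤ 1 / 2 * (Δt / 2 ^ nt) := by gcongr
      _ = _ := by field_simp
  by_cases h : ⌊s⌋₊ < 2 ^ nt
  · refine ⟨⟨⌊s⌋₊, h⟩, abs_le.2 ⟨?_, ?_⟩⟩
    · have := Nat.lt_floor_add_one s; simp only; linarith
    · have := Nat.floor_le hs0; simp only; linarith
  · -- the right end point belongs to the last subinterval
    have h1 : (2 : ℝ) ^ nt ≤ s := by
      have : ((2 ^ nt : ℕ) : ℝ) ≤ s := (Nat.le_floor_iff hs0).1 (by omega)
      simpa using this
    have h2 : 1 ≤ 2 ^ nt := Nat.one_le_two_pow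
    refine ⟨⟨2 ^ nt - 1, by omega⟩, ?_⟩
    simp only [Nat.cast_sub h2]
    push_cast
    rw [le_antisymm hs1 h1, abs_le]
    constructor <;> linarith

variable {label : (Fin d → Basis n → Basis n) → Basis n → Basis n → ℕ}

theorem norm_oneSparseTerm_sub_le (hl : IsOneSparseDecomposition label)
    {O : Oracles n M d nt nH} {H : Fin M → ℝ → Op n} {t₀ Δt Υ : ℝ} (hΔt : 0 ≤ Δt)
    (hH : ∀ μ, ∀ t ∈ Set.Icc t₀ (t₀ + Δt), (H μ t).IsHermitian) (hO : O.Describes H t₀ Δt Υ)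
    (μ : Fin M) (j : ℕ) (q : Fin (2 ^ nt)) :
    ‖oneSparseTerm label O Υ μ j q - sparsePart label (O.col μ) j (H μ (meshTime t₀ Δt q))‖
      ≤ 8 * Υ / 2 ^ (nH / 2) := by
  have hq := meshTime_mem hΔt q (t₀ := t₀)
  have hΥ : 0 ≤ Υ := (norm_nonneg _).trans
    (hO.bound μ _ hq ⟨0, Nat.two_pow_pos n⟩ ⟨0, Nat.two_pow_pos n⟩)
  have hdec : ∀ x y, ‖decode Υ (fun p => O.val p x y μ q) - H μ (meshTime t₀ Δt q) x y‖
      ≤ 8 * Υ / 2 ^ (nH / 2) := fun x y => by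
    obtain ⟨ρ, φ, hρ, he, h1, h2⟩ := hO.val_spec μ q x y
    have hb := hO.bound μ _ hq x y
    rw [he, norm_mul, mul_comm Complex.I, Complex.norm_exp_ofReal_mul_I, mul_one,
      Complex.norm_real, Real.norm_of_nonneg hρ] at hb
    rw [he]
    exact norm_decode_sub_le hρ hb h1 h2
  have hentry : ∀ x y, ‖(oneSparseTerm label O Υ μ j q -
      sparsePart label (O.col μ) j (H μ (meshTime t₀ Δt q))) x y‖ ≤ 8 * Υ / 2 ^ (nH / 2) := by
    intro x y
    have hherm := (hH μ _ hq).apply x y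
    rw [Matrix.sub_apply, oneSparseTerm_apply, sparsePart_apply]
    by_cases hj : Linked (O.col μ) x y ∧ label (O.col μ) x y = j
    · rw [if_pos hj, if_pos hj]
      rcases lt_trichotomy x y with hxy | rfl | hxy
      · rw [if_pos hxy]; exact hdec x y
      · rw [if_neg (lt_irrefl _), if_neg (lt_irrefl _)]
        set w := decode Υ fun p => O.val p x x μ q
        have hre : (((H μ (meshTime t₀ Δt q) x x).re : ℝ) : ℂ) = H μ (meshTime t₀ Δt q) x x :=
          Complex.conj_eq_iff_re.1 hherm
        rw [← hre, ← Complex.ofReal_sub, Complex.norm_real, ← Complex.sub_re]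
        exact (Complex.abs_re_le_norm _).trans (hdec x x)
      · rw [if_neg hxy.not_gt, if_pos hxy, ← hherm, ← starRingEnd_apply, ← map_sub,
          Complex.norm_conj]
        exact hdec y x
    · rw [if_neg hj, if_neg hj]; simp; positivity
  refine norm_le_of_label hl (by positivity) hentry (j := j) (col := O.col μ) fun x y h => ?_
  by_contra hne
  rw [Matrix.sub_apply, oneSparseTerm_apply, sparsePart_apply, if_neg hne, if_neg hne,
    sub_zero] at h
  exact h rfl

/-- The generators given by the oracles at a mesh time are close to the exact ones at nearby
times. -/
theorem norm_oracleGenerator_sub_le (hl : IsOneSparseDecomposition label)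
    {O : Oracles n M d nt nH} {H : Fin M → ℝ → Op n} {t₀ Δt Υ C : ℝ} (hΔt : 0 ≤ Δt)
    (hH : ∀ μ, ∀ t ∈ Set.Icc t₀ (t₀ + Δt), (H μ t).IsHermitian) (hO : O.Describes H t₀ Δt Υ)
    (hd : ∀ μ, DifferentiableOn ℝ (H μ) (Set.Icc t₀ (t₀ + Δt)))
    (hC : ∀ μ, ∀ t ∈ Set.Icc t₀ (t₀ + Δt), ‖derivWithin (H μ) (Set.Icc t₀ (t₀ + Δt)) t‖ ≤ C)
    {t : ℝ} (ht : t ∈ Set.Icc t₀ (t₀ + Δt)) {q : Fin (2 ^ nt)}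
    (hq : |meshTime t₀ Δt q - t| ≤ Δt / 2 ^ (nt + 1)) (i : Fin M × Fin (6 * d ^ 2)) :
    ‖oracleGenerator label O Υ q i - exactGenerator label O i (H i.1 t)‖
      ≤ 8 * Υ / 2 ^ (nH / 2) + C * (Δt / 2 ^ (nt + 1)) := by
  have hqm := meshTime_mem hΔt q (t₀ := t₀)
  have hC0 : 0 ≤ C := (norm_nonneg _).trans (hC i.1 t ht)
  rw [oracleGenerator, exactGenerator_apply, ← map_sub]
  refine (norm_rotated_le _ _).trans ?_
  have h1 := norm_oneSparseTerm_sub_le hl hΔt hH hO i.1 i.2 q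
  have h2 : ‖sparsePart label (O.col i.1) i.2 (H i.1 (meshTime t₀ Δt q))
      - sparsePart label (O.col i.1) i.2 (H i.1 t)‖ ≤ C * (Δt / 2 ^ (nt + 1)) := by
    rw [← map_sub]
    refine (norm_sparsePart_le _ hl _ _).trans ?_
    refine ((convex_Icc t₀ (t₀ + Δt)).norm_image_sub_le_of_norm_derivWithin_le (hd i.1) (hC i.1)
      ht hqm).trans ?_
    rw [Real.norm_eq_abs]
    gcongr
  calc _ = ‖(oneSparseTerm label O Υ i.1 i.2 q
        - sparsePart label (O.col i.1) i.2 (H i.1 (meshTime t₀ Δt q)))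
        + (sparsePart label (O.col i.1) i.2 (H i.1 (meshTime t₀ Δt q))
        - sparsePart label (O.col i.1) i.2 (H i.1 t))‖ := by rw [sub_add_sub_cancel]
    _ ≤ _ := (norm_add_le _ _).trans (add_le_add h1 h2)

end Precision

/-! ### The error of the simulation -/

section SimulationError

variable {n M d nt nH : ℕ} {label : (Fin d → Basis n → Basis n) → Basis n → Basis n → ℕ}

theorem isHermitian_iteratedDerivWithin {H : ℝ → Op n} {S : Set ℝ}
    (hH : ∀ t ∈ S, (H t).IsHermitian) (p : ℕ) :
    ∀ t ∈ S, (iteratedDerivWithin p H S t).IsHermitian := by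
  induction p with
  | zero => simpa [iteratedDerivWithin_zero] using hH
  | succ p ih =>
    intro t ht
    rw [iteratedDerivWithin_succ]
    have h1 := derivWithin.star (f := iteratedDerivWithin p H S) (x := t) (s := S)
    have h2 : derivWithin (fun y => star (iteratedDerivWithin p H S y)) S t
        = derivWithin (iteratedDerivWithin p H S) S t :=
      derivWithin_congr (fun y hy => (ih y hy)) (ih t ht)
    rw [h2] at h1
    exact h1.symm

theorem sum_exactGenerator (hl : IsOneSparseDecomposition label) {O : Oracles n M d nt nH}
    {H : Fin M → ℝ → Op n} {t₀ Δt Υ : ℝ}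
    (hH : ∀ μ, ∀ t ∈ Set.Icc t₀ (t₀ + Δt), (H μ t).IsHermitian) (hO : O.Describes H t₀ Δt Υ)
    {t : ℝ} (ht : t ∈ Set.Icc t₀ (t₀ + Δt)) :
    ((termList M d).map fun i => exactGenerator label O i (H i.1 t)).sum
      = -Complex.I • totalHamiltonian H O.T t := by
  rw [sum_map_termList, totalHamiltonian, Finset.smul_sum]
  refine Finset.sum_congr rfl fun μ _ => ?_
  have hlk : ∀ x y, H μ t x y ≠ 0 → Linked (O.col μ) x y := fun x y h => by
    refine ⟨hO.col_spec μ x y ⟨t, ht, h⟩, hO.col_spec μ y x ⟨t, ht, ?_⟩⟩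
    rw [← (hH μ t ht).apply x y] at h
    exact star_ne_zero.1 h
  have := congrArg (rotated (O.T μ)) (sum_sparsePart (O.col μ) hl hlk)
  rw [map_list_sum, List.map_map, rotated_apply] at this
  exact this

/-- The error of the product formula with the terms given by the oracles at the mesh times. -/
theorem norm_evolution_sub_oracleFormula_le (hl : IsOneSparseDecomposition label)
    {O : Oracles n M d nt nH} {H : Fin M → ℝ → Op n} {U : ℝ → Op n} {t₀ Δt Λ Υ C σ : ℝ} (j r : ℕ)
    (hd : 1 ≤ d) (hΔt : 0 < Δt) (hΛ : 0 < Λ) (hr : 0 < r) (hσ1 : 1 ≤ σ)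
    (hσ : ((suzukiSchedule j).map fun q => |q.2|).sum ≤ σ) (hC0 : 0 ≤ C) (hΥ : 0 ≤ Υ)
    (hH : ∀ μ, ∀ t ∈ Set.Icc t₀ (t₀ + Δt), (H μ t).IsHermitian)
    (hs : IsSmoothOn Λ (2 * (j + 1)) H (Set.Icc t₀ (t₀ + Δt))) (hO : O.Describes H t₀ Δt Υ)
    (hC : ∀ μ, ∀ t ∈ Set.Icc t₀ (t₀ + Δt), ‖derivWithin (H μ) (Set.Icc t₀ (t₀ + Δt)) t‖ ≤ C)
    {q : ℝ → Fin (2 ^ nt)}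
    (hq : ∀ t ∈ Set.Icc t₀ (t₀ + Δt), |meshTime t₀ Δt (q t) - t| ≤ Δt / 2 ^ (nt + 1))
    (hU : IsEvolution (totalHamiltonian H O.T) t₀ Δt U)
    (hx : σ * (6 * (d : ℝ) ^ 2 * Λ * (Δt / r)) ≤ 1) :
    ‖U (t₀ + Δt) - suzukiFormula (termList M d) (fun t => oracleGenerator label O Υ (q t)) j
        (Δt / r) t₀ r‖
      ≤ r * (17 * (σ * (6 * (d : ℝ) ^ 2 * Λ * (Δt / r))) ^ (2 * j + 3))
        + σ * Δt * (6 * (d : ℝ) ^ 2 * (M * (8 * Υ / 2 ^ (nH / 2) + C * (Δt / 2 ^ (nt + 1))))) := by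
  set I := Set.Icc t₀ (t₀ + Δt) with hI
  have hr' : (0 : ℝ) < r := by exact_mod_cast hr
  have hd' : (1 : ℝ) ≤ d := by exact_mod_cast hd
  have hrτ : (r : ℝ) * (Δt / r) = Δt := by field_simp
  let A : Fin M × Fin (6 * d ^ 2) → ℕ → ℝ → Op n := fun i p t =>
    exactGenerator label O i (iteratedDerivWithin p (H i.1) I t)
  have hA0 : ∀ i t, A i 0 t = exactGenerator label O i (H i.1 t) := fun i t => by
    simp only [A, iteratedDerivWithin_zero]
  have key1 := norm_evolution_sub_suzukiFormula_le (A := A) (U := U) (t₀ := t₀) (Δt := Δt)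
    (τ := Δt / r) (L := 6 * (d : ℝ) ^ 2 * Λ) (σ := σ) (termList M d) j r (by positivity) hrτ
    (by positivity) hσ1 hσ ?_ ?_ ?_ hU.1 ?_ hx
  · have key2 := norm_suzukiFormula_sub_le (X := fun t i => A i 0 t)
      (Y := fun t => oracleGenerator label O Υ (q t)) (t₀ := t₀) (Δt := Δt) (τ := Δt / r)
      (δ := 6 * (d : ℝ) ^ 2 * (M * (8 * Υ / 2 ^ (nH / 2) + C * (Δt / 2 ^ (nt + 1)))))
      (termList M d) j r (by positivity) hrτ hσ (by positivity)
      (fun t ht i => by rw [hA0]; exact star_exactGenerator O hl i (hH i.1 t ht))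
      (fun t _ i => star_oracleGenerator O hl Υ _ i) (fun t ht => ?_)
    · refine (norm_sub_le_norm_sub_add_norm_sub _ _ _).trans (add_le_add key1 key2)
    · refine (sum_termList_le (g := fun _ => 8 * Υ / 2 ^ (nH / 2) + C * (Δt / 2 ^ (nt + 1)))
        fun i => ?_).trans (le_of_eq ?_)
      · rw [hA0, norm_sub_rev]
        exact norm_oracleGenerator_sub_le hl hΔt.le hH hO
          (fun μ => by simpa [iteratedDerivWithin_zero] using hs.1 μ 0 (by omega)) hC ht (hq t ht) i
      · rw [Finset.sum_const, Finset.card_univ, Fintype.card_fin, nsmul_eq_mul]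
  · intro i p hp t ht
    have h1 : HasDerivWithinAt (iteratedDerivWithin p (H i.1) I)
        (iteratedDerivWithin (p + 1) (H i.1) I t) I t := by
      rw [iteratedDerivWithin_succ]
      exact (hs.1 i.1 p (by omega) t ht).hasDerivWithinAt
    exact ((LinearMap.toContinuousLinearMap (exactGenerator label O i)).restrictScalars
      ℝ).hasFDerivAt.comp_hasDerivWithinAt t h1
  · exact fun i p _ t ht => star_exactGenerator O hl i
      (isHermitian_iteratedDerivWithin (hH i.1) p t ht)
  · intro p hp t ht
    have h1 : ∑ μ, ‖iteratedDerivWithin p (H μ) I t‖ ≤ Λ ^ (p + 1) := by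
      have h2 := hs.2 p (by omega) t ht
      have h0 : 0 ≤ ∑ μ, ‖iteratedDerivWithin p (H μ) I t‖ :=
        Finset.sum_nonneg fun _ _ => norm_nonneg _
      have h3 := pow_le_pow_left₀ (Real.rpow_nonneg h0 _) h2 (p + 1)
      rwa [← Real.rpow_natCast, ← Real.rpow_mul h0, Nat.cast_add, Nat.cast_one,
        one_div_mul_cancel (by positivity), Real.rpow_one] at h3
    refine (sum_termList_le (g := fun μ => ‖iteratedDerivWithin p (H μ) I t‖) fun i =>
      norm_exactGenerator_le O hl i _).trans ?_
    calc _ ≤ 6 * (d : ℝ) ^ 2 * Λ ^ (p + 1) := by gcongr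
      _ ≤ (6 * (d : ℝ) ^ 2) ^ (p + 1) * Λ ^ (p + 1) := by
          gcongr
          exact le_self_pow₀ (by nlinarith) (by omega)
      _ = _ := (mul_pow ..).symm
  · intro t ht
    simp only [hA0]
    rw [sum_exactGenerator hl hH hO ht, smul_mul_assoc]
    exact hU.2 t ht

end SimulationError

/-! ### The number of steps -/

section StepCount

/-- With the number of steps of the theorem the error of the product formula is at most half of the
tolerance; `K` is the product of the smoothness parameter and the duration. -/
theorem stepCount_bound (j : ℕ) {K ε g r : ℝ} (hK : 0 < K) (hε : 0 < ε)
    (hg : g = (K / (min ε (3 * (5 / 3 : ℝ) ^ j * K) / 2)) ^ (1 / (2 * ((j + 1 : ℕ) : ℝ))))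
    (hr : 4 * ((j + 1 : ℕ) : ℝ) * K * (5 / 3) ^ (j + 1) * g ≤ r) :
    0 < r ∧ ((j + 1) * (5 / 3 : ℝ) ^ j) * (K / r) ≤ 1 ∧
      r * (17 * (((j + 1) * (5 / 3 : ℝ) ^ j) * (K / r)) ^ (2 * j + 3)) ≤ ε / 2 := by
  set σ : ℝ := (j + 1) * (5 / 3 : ℝ) ^ j with hσ
  have hσ0 : 0 < σ := by positivity
  set e : ℝ := min ε (3 * (5 / 3 : ℝ) ^ j * K) / 2 with he
  have he0 : 0 < e := half_pos (lt_min hε (by positivity))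
  have heε : e ≤ ε / 2 := by have := min_le_left ε (3 * (5 / 3 : ℝ) ^ j * K); linarith
  have heK : e ≤ 3 / 2 * (5 / 3 : ℝ) ^ j * K := by
    have := min_le_right ε (3 * (5 / 3 : ℝ) ^ j * K); linarith
  have hg0 : 0 < g := by rw [hg]; positivity
  have hgpow : g ^ (2 * j + 2) = K / e := by
    rw [hg, ← Real.rpow_natCast, ← Real.rpow_mul (by positivity)]
    push_cast
    rw [show 1 / (2 * ((j : ℝ) + 1)) * (2 * j + 2) = 1 by field_simp, Real.rpow_one]
  have hg35 : 3 / 5 ≤ g := by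
    refine le_of_pow_le_pow_left₀ (n := 2 * j + 2) (by omega) hg0.le ?_
    rw [hgpow, le_div_iff₀ he0]
    calc (3 / 5 : ℝ) ^ (2 * j + 2) * e ≤ (3 / 5 : ℝ) ^ (j + 1) * (5 / 3 * (5 / 3 : ℝ) ^ j * K) := by
          refine mul_le_mul (pow_le_pow_of_le_one (by norm_num) (by norm_num) (by omega))
            (heK.trans ?_) he0.le (by positivity)
          have : 0 < (5 / 3 : ℝ) ^ j * K := by positivity
          linarith
      _ = ((3 / 5 : ℝ) * (5 / 3)) ^ (j + 1) * K := by rw [mul_pow, pow_succ (5 / 3 : ℝ)]; ring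
      _ = K := by norm_num
  have hr1 : 20 / 3 * σ * K * g ≤ r := by
    refine le_trans (le_of_eq ?_) hr
    rw [hσ, pow_succ]; push_cast; ring
  have hr0 : 0 < r := lt_of_lt_of_le (by positivity) hr1
  have hratio : σ * (K / r) ≤ 3 / 20 / g := by
    rw [← mul_div_assoc, div_le_div_iff₀ hr0 hg0]; linarith
  refine ⟨hr0, ?_, ?_⟩
  · refine hratio.trans ?_
    rw [div_le_one hg0]; linarith
  · have h17 : 17 * σ ≤ (400 / 9) ^ (j + 1) := by
      have hj : ((j : ℝ) + 1) ≤ 2 ^ j := by exact_mod_cast Nat.lt_two_pow_self (n := j)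
      calc 17 * σ ≤ 17 * (2 ^ j * (5 / 3 : ℝ) ^ j) := by rw [hσ]; gcongr
        _ = 17 * (10 / 3 : ℝ) ^ j := by rw [← mul_pow]; norm_num
        _ ≤ 400 / 9 * (400 / 9 : ℝ) ^ j :=
          mul_le_mul (by norm_num) (pow_le_pow_left₀ (by norm_num) (by norm_num) j)
            (by positivity) (by norm_num)
        _ = _ := by rw [pow_succ]; ring
    calc r * (17 * (σ * (K / r)) ^ (2 * j + 3))
        = 17 * σ * K * (σ * (K / r)) ^ (2 * j + 2) := by
          rw [pow_succ (σ * (K / r)) (2 * j + 2)]; field_simp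
      _ ≤ 17 * σ * K * (3 / 20 / g) ^ (2 * j + 2) := by gcongr
      _ = 17 * σ * ((9 / 400) ^ (j + 1) * e) := by
          rw [div_pow, hgpow, show 2 * j + 2 = 2 * (j + 1) by ring, pow_mul]
          norm_num; field_simp
      _ ≤ (400 / 9) ^ (j + 1) * ((9 / 400) ^ (j + 1) * e) := by gcongr
      _ = e := by rw [← mul_assoc, ← mul_pow]; norm_num
      _ ≤ ε / 2 := heε

/-- The requirement on a number of bits, without logarithms. -/
theorem le_two_pow_of_logb_le {X : ℝ} {m : ℕ} (h : ⌈Real.logb 2 X⌉ ≤ (m : ℤ)) : X ≤ 2 ^ m := by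
  rcases le_or_gt X 0 with hX | hX
  · exact hX.trans (by positivity)
  · have h1 : Real.logb 2 X ≤ m := by
      have := (Int.le_ceil (Real.logb 2 X)).trans (Int.cast_le.2 h)
      simpa using this
    rw [Real.logb_le_iff_le_rpow (by norm_num) hX] at h1
    simpa using h1

end StepCount

/-! ### Composition of circuits -/

section Circuits

variable {n M d nt nH a : ℕ} {O : Oracles n M d nt nH}

theorem Circuit.run_append (c₁ c₂ : Circuit n M d nt nH a) :
    Circuit.run O (c₁ ++ c₂) = Circuit.run O c₂ * Circuit.run O c₁ := by
  induction c₁ with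
  | nil => simp [Circuit.run]
  | cons g c ih => rw [List.cons_append, Circuit.run, Circuit.run, ih, mul_assoc]

theorem Circuit.run_singleton (g : Gate n M d nt nH a) :
    Circuit.run O [g] = g.toMatrix O := by
  simp [Circuit.run]

theorem Circuit.implements_nil : Circuit.Implements ([] : Circuit n M d nt nH a) O 1 := by
  rintro ⟨r, r'⟩ x
  simp only [Circuit.run, Matrix.one_apply, Prod.mk.injEq]
  by_cases h : r' = blank n a <;> simp [h]

theorem Circuit.Implements.append {c₁ c₂ : Circuit n M d nt nH a} {V₁ V₂ : Op n}
    (h₁ : c₁.Implements O V₁) (h₂ : c₂.Implements O V₂) :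
    Circuit.Implements (c₁ ++ c₂) O (V₂ * V₁) := by
  intro r x
  rw [Circuit.run_append, Matrix.mul_apply, Fintype.sum_prod_type]
  simp only [h₁ _ x, mul_ite, mul_zero]
  simp only [Finset.sum_ite_eq', Finset.mem_univ, if_true, h₂ r]
  split_ifs
  · rw [Matrix.mul_apply]
  · simp

theorem implements_basisChange (μ : Fin M) :
    Circuit.Implements ([.basisChange μ] : Circuit n M d nt nH a) O (O.T μ : Op n) := by
  intro r x
  rw [Circuit.run_singleton]
  rfl

theorem implements_basisChangeInv (μ : Fin M) :
    Circuit.Implements ([.basisChangeInv μ] : Circuit n M d nt nH a) O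
      (O.T μ : Op n).conjTranspose := by
  intro r x
  rw [Circuit.run_singleton]
  rfl

theorem implements_flatMap {α : Type*} (l : List α) {circ : α → Circuit n M d nt nH a}
    {V : α → Op n} (h : ∀ i, (circ i).Implements O (V i)) :
    Circuit.Implements (l.flatMap circ) O (l.reverse.map V).prod := by
  induction l with
  | nil => exact Circuit.implements_nil
  | cons i l ih =>
    rw [List.flatMap_cons, List.reverse_cons, List.map_append, List.prod_append, List.map_singleton,
      List.prod_singleton]
    exact (h i).append ih

theorem implements_flatMap_reverse {α : Type*} (l : List α) {circ : α → Circuit n M d nt nH a}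
    {V : α → Op n} (h : ∀ i, (circ i).Implements O (V i)) :
    Circuit.Implements (l.reverse.flatMap circ) O (l.map V).prod := by
  simpa using implements_flatMap l.reverse h

theorem countP_flatMap_eq {α β : Type*} (l : List α) (f : α → List β) (P : β → Bool) {b : ℕ}
    (h : ∀ i, (f i).countP P = b) : (l.flatMap f).countP P = l.length * b := by
  induction l with
  | nil => simp
  | cons i l ih => rw [List.flatMap_cons, List.countP_append, ih, h, List.length_cons]; ring

theorem countP_flatMap_le {α β : Type*} (l : List α) (f : α → List β) (P : β → Bool) {b : ℕ}
    (h : ∀ i, (f i).countP P ≤ b) : (l.flatMap f).countP P ≤ l.length * b := by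
  induction l with
  | nil => simp
  | cons i l ih =>
    rw [List.flatMap_cons, List.countP_append, List.length_cons, add_mul, one_mul, add_comm]
    exact add_le_add ih (h i)

end Circuits

/-! ### The circuit of the product formula -/

section FormulaCircuit

variable {n M d nt nH a : ℕ}

/-- The simulation of the terms `(μ, j)`, `j` in `l`, between the basis change `T μ` and its
inverse. -/
def blockCircuit (S : Fin M → Fin (6 * d ^ 2) → Circuit n M d nt nH a) (l : List (Fin (6 * d ^ 2)))
    (μ : Fin M) : Circuit n M d nt nH a :=
  [.basisChange μ] ++ l.flatMap (S μ) ++ [.basisChangeInv μ]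

/-- One symmetric second order product: all blocks in ascending, then in descending order. -/
def strangCircuit (S : Fin M → Fin (6 * d ^ 2) → Circuit n M d nt nH a) : Circuit n M d nt nH a :=
  (List.finRange M).flatMap (blockCircuit S (List.finRange (6 * d ^ 2))) ++
    (List.finRange M).reverse.flatMap (blockCircuit S (List.finRange (6 * d ^ 2)).reverse)

/-- The circuit of one step of Suzuki's formula; `S t δ` simulates the terms at the mesh time
chosen for `t` for the duration `δ`. -/
def stepCircuit (S : ℝ → ℝ → Fin M → Fin (6 * d ^ 2) → Circuit n M d nt nH a) (j : ℕ) (τ c : ℝ) :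
    Circuit n M d nt nH a :=
  (suzukiSchedule j).reverse.flatMap fun q => strangCircuit (S (c + q.1 * τ) (q.2 * τ / 2))

/-- The circuit of `suzukiFormula`. -/
def formulaCircuit (S : ℝ → ℝ → Fin M → Fin (6 * d ^ 2) → Circuit n M d nt nH a) (j : ℕ)
    (τ t₀ : ℝ) : ℕ → Circuit n M d nt nH a
  | 0 => []
  | r + 1 => formulaCircuit S j τ t₀ r ++ stepCircuit S j τ (t₀ + (r + 1 / 2) * τ)

theorem conj_list_prod {α : Type*} (T : Matrix.unitaryGroup (Basis n) ℂ) (l : List α)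
    (V : α → Op n) :
    (T : Op n).conjTranspose * (l.map V).prod * (T : Op n) =
      (l.map fun i => (T : Op n).conjTranspose * V i * (T : Op n)).prod := by
  have hT : (T : Op n) * (T : Op n).conjTranspose = 1 := Unitary.mul_star_self_of_mem T.2
  have hT' : (T : Op n).conjTranspose * (T : Op n) = 1 := Unitary.star_mul_self_of_mem T.2
  induction l with
  | nil => simp [hT']
  | cons i l ih =>
    rw [List.map_cons, List.map_cons, List.prod_cons, List.prod_cons, ← ih]
    calc _ = (T : Op n).conjTranspose * V i * 1 * (l.map V).prod * (T : Op n) := by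
          simp only [mul_one, mul_assoc]
      _ = _ := by rw [← hT]; simp only [mul_assoc]

theorem exp_rotated (T : Matrix.unitaryGroup (Basis n) ℂ) (A : Op n) (δ : ℝ) :
    NormedSpace.exp ((δ : ℂ) • rotated T A) = (T : Op n).conjTranspose *
      NormedSpace.exp ((-Complex.I * (δ : ℂ)) • A) * (T : Op n) := by
  have h := Matrix.exp_units_conj' (Unitary.toUnits T) ((-Complex.I * (δ : ℂ)) • A)
  have e : (δ : ℂ) • rotated T A = (T : Op n).conjTranspose * ((-Complex.I * (δ : ℂ)) • A) * T := by
    rw [rotated_apply, mul_smul_comm, smul_mul_assoc, smul_smul, mul_comm]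
  rw [e]
  exact h

theorem implements_blockCircuit {O : Oracles n M d nt nH}
    {S : Fin M → Fin (6 * d ^ 2) → Circuit n M d nt nH a} {V : Fin M → Fin (6 * d ^ 2) → Op n}
    (h : ∀ μ j, (S μ j).Implements O (V μ j)) (l : List (Fin (6 * d ^ 2))) (μ : Fin M) :
    (blockCircuit S l μ).Implements O
      (l.reverse.map fun j => (O.T μ : Op n).conjTranspose * V μ j * (O.T μ : Op n)).prod := by
  rw [← conj_list_prod, mul_assoc]
  exact ((implements_basisChange μ).append (implements_flatMap l (h μ))).append
    (implements_basisChangeInv μ)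

theorem prod_map_termList {𝔸 : Type*} [Monoid 𝔸] (f : Fin M × Fin (6 * d ^ 2) → 𝔸) :
    ((termList M d).map f).prod =
      ((List.finRange M).map fun μ =>
        ((List.finRange (6 * d ^ 2)).map fun j => f (μ, j)).prod).prod := by
  rw [termList, List.flatMap, List.map_flatten, List.prod_flatten, List.map_map, List.map_map]
  simp [Function.comp_def]

theorem prod_map_termList_reverse {𝔸 : Type*} [Monoid 𝔸] (f : Fin M × Fin (6 * d ^ 2) → 𝔸) :
    ((termList M d).reverse.map f).prod =
      ((List.finRange M).reverse.map fun μ =>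
        ((List.finRange (6 * d ^ 2)).reverse.map fun j => f (μ, j)).prod).prod := by
  rw [termList, List.reverse_flatMap, List.flatMap, List.map_flatten, List.prod_flatten,
    List.map_map, List.map_map]
  congr 1
  refine List.map_congr_left fun μ _ => ?_
  simp [Function.comp_def, ← List.map_reverse]

theorem implements_strangCircuit {O : Oracles n M d nt nH}
    {label : (Fin d → Basis n → Basis n) → Basis n → Basis n → ℕ} {Υ δ : ℝ} {q : Fin (2 ^ nt)}
    {S : Fin M → Fin (6 * d ^ 2) → Circuit n M d nt nH a}
    (h : ∀ μ j, (S μ j).Implements O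
      (NormedSpace.exp ((-Complex.I * ((δ / 2 : ℝ) : ℂ)) • oneSparseTerm label O Υ μ j q))) :
    (strangCircuit S).Implements O
      (strang (termList M d) (oracleGenerator label O Υ q) (δ : ℂ)) := by
  have e : ∀ i : Fin M × Fin (6 * d ^ 2),
      NormedSpace.exp (((δ : ℂ) / 2) • oracleGenerator label O Υ q i) =
      (O.T i.1 : Op n).conjTranspose * NormedSpace.exp
        ((-Complex.I * ((δ / 2 : ℝ) : ℂ)) • oneSparseTerm label O Υ i.1 i.2 q) * O.T i.1 :=
    fun i => by
      rw [← exp_rotated, oracleGenerator]; push_cast; rfl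
  rw [strang, prod_map_termList, prod_map_termList_reverse]
  simp only [e]
  refine (implements_flatMap _ fun μ => implements_blockCircuit h _ μ).append ?_
  have := implements_flatMap_reverse (List.finRange M) fun μ =>
    implements_blockCircuit h (List.finRange (6 * d ^ 2)).reverse μ
  simpa only [List.reverse_reverse] using this

theorem implements_formulaCircuit {O : Oracles n M d nt nH}
    {label : (Fin d → Basis n → Basis n) → Basis n → Basis n → ℕ} {Υ : ℝ} {q : ℝ → Fin (2 ^ nt)}
    {S : ℝ → ℝ → Fin M → Fin (6 * d ^ 2) → Circuit n M d nt nH a}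
    (h : ∀ t δ μ j, (S t δ μ j).Implements O
      (NormedSpace.exp ((-Complex.I * (δ : ℂ)) • oneSparseTerm label O Υ μ j (q t))))
    (j : ℕ) (τ t₀ : ℝ) (r : ℕ) :
    (formulaCircuit S j τ t₀ r).Implements O
      (suzukiFormula (termList M d) (fun t => oracleGenerator label O Υ (q t)) j τ t₀ r) := by
  induction r with
  | zero => exact Circuit.implements_nil
  | succ r ih =>
    exact ih.append (implements_flatMap_reverse _ fun p => implements_strangCircuit fun μ i =>
      h _ _ μ i)

theorem numBasisCalls_formulaCircuit
    {S : ℝ → ℝ → Fin M → Fin (6 * d ^ 2) → Circuit n M d nt nH a}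
    (h : ∀ t δ μ j, (S t δ μ j).numBasisCalls = 0) (j : ℕ) (τ t₀ : ℝ) (r : ℕ) :
    (formulaCircuit S j τ t₀ r).numBasisCalls = 4 * M * 5 ^ j * r := by
  have h1 : ∀ t δ l μ, (blockCircuit (S t δ) l μ).countP Gate.isBasisCall = 2 := fun t δ l μ => by
    rw [blockCircuit, List.countP_append, List.countP_append,
      countP_flatMap_eq (b := 0) _ _ _ fun i => h t δ μ i]
    simp [Gate.isBasisCall]
  have h2 : ∀ t δ, (strangCircuit (S t δ)).countP Gate.isBasisCall = 4 * M := fun t δ => by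
    rw [strangCircuit, List.countP_append, countP_flatMap_eq _ _ _ (h1 t δ _),
      countP_flatMap_eq _ _ _ (h1 t δ _), List.length_reverse, List.length_finRange]
    ring
  induction r with
  | zero => simp [formulaCircuit, Circuit.numBasisCalls]
  | succ r ih =>
    rw [Circuit.numBasisCalls] at ih ⊢
    rw [formulaCircuit, List.countP_append, ih, stepCircuit,
      countP_flatMap_eq _ _ _ fun p => h2 _ _, List.length_reverse, length_suzukiSchedule]
    ring

theorem numQueries_formulaCircuit_le {C : ℕ}
    {S : ℝ → ℝ → Fin M → Fin (6 * d ^ 2) → Circuit n M d nt nH a}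
    (h : ∀ t δ μ j, (S t δ μ j).numQueries ≤ C) (j : ℕ) (τ t₀ : ℝ) (r : ℕ) :
    (formulaCircuit S j τ t₀ r).numQueries ≤ 12 * C * M * d ^ 2 * 5 ^ j * r := by
  have h1 : ∀ t δ l μ, (blockCircuit (S t δ) l μ).countP Gate.isQuery ≤ l.length * C :=
    fun t δ l μ => by
      rw [blockCircuit, List.countP_append, List.countP_append]
      simpa [Gate.isQuery] using countP_flatMap_le l (S t δ μ) Gate.isQuery fun i => h t δ μ i
  have h2 : ∀ t δ, (strangCircuit (S t δ)).countP Gate.isQuery ≤ 12 * C * M * d ^ 2 :=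
    fun t δ => by
      rw [strangCircuit, List.countP_append]
      refine (add_le_add (countP_flatMap_le _ _ _ (h1 t δ _))
        (countP_flatMap_le _ _ _ (h1 t δ _))).trans (le_of_eq ?_)
      simp only [List.length_reverse, List.length_finRange]
      ring
  induction r with
  | zero => simp [formulaCircuit, Circuit.numQueries]
  | succ r ih =>
    rw [Circuit.numQueries] at ih ⊢
    rw [formulaCircuit, List.countP_append, stepCircuit]
    refine (add_le_add ih (countP_flatMap_le _ _ _ fun p => h2 _ _)).trans (le_of_eq ?_)
    rw [List.length_reverse, length_suzukiSchedule]
    ring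

end FormulaCircuit

/-! ### Edge colouring -/

section Coloring

variable {n d : ℕ}

/-- Greedy edge colouring: in the graph of linked pairs an edge meets at most `2 d` others, which is
less than the number `6 d ^ 2` of colours. -/
theorem exists_edgeColoring (col : Fin d → Basis n → Basis n) (F : Finset (Sym2 (Basis n)))
    (hF : ∀ x y, s(x, y) ∈ F → Linked col x y) :
    ∃ l : Sym2 (Basis n) → ℕ, (∀ e ∈ F, l e < 6 * d ^ 2) ∧
      ∀ x y y', s(x, y) ∈ F → s(x, y') ∈ F → l s(x, y) = l s(x, y') → y = y' := by
  induction F using Finset.induction with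
  | empty => exact ⟨fun _ => 0, by simp, by simp⟩
  | insert e F he ih =>
    obtain ⟨l, hl, hinj⟩ := ih fun x y h => hF x y (Finset.mem_insert_of_mem h)
    induction e using Sym2.inductionOn with | _ x₀ y₀ =>
    -- the colours of the edges that meet the new one
    let B : Finset ℕ := Finset.univ.image (fun i => l s(x₀, col i x₀)) ∪
      Finset.univ.image (fun i => l s(y₀, col i y₀))
    have hB : B.card ≤ d + d := (Finset.card_union_le _ _).trans
      (add_le_add (Finset.card_image_le.trans (by simp)) (Finset.card_image_le.trans (by simp)))
    have hd : 1 ≤ d := by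
      obtain ⟨⟨i, -⟩, -⟩ := hF x₀ y₀ (Finset.mem_insert_self _ _)
      exact Nat.one_le_iff_ne_zero.2 fun h => by subst h; exact i.elim0
    obtain ⟨c, hc, hcB⟩ : ∃ c ∈ Finset.range (6 * d ^ 2), c ∉ B :=
      Finset.exists_mem_notMem_of_card_lt_card (by rw [Finset.card_range]; nlinarith)
    have key : ∀ x y y', s(x, y) = s(x₀, y₀) → s(x, y') ∈ F → l s(x, y') ≠ c := by
      intro x y y' h h' hlc
      obtain ⟨⟨i, hi⟩, -⟩ := hF x y' (Finset.mem_insert_of_mem h')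
      subst hi
      apply hcB
      rw [← hlc]
      rcases Sym2.eq_iff.1 h with ⟨rfl, -⟩ | ⟨rfl, -⟩
      · exact Finset.mem_union_left _ (Finset.mem_image_of_mem _ (Finset.mem_univ i))
      · exact Finset.mem_union_right _ (Finset.mem_image_of_mem _ (Finset.mem_univ i))
    refine ⟨Function.update l s(x₀, y₀) c, fun e' he' => ?_, fun x y y' h h' heq => ?_⟩
    · by_cases h : e' = s(x₀, y₀)
      · rw [h, Function.update_self]; exact Finset.mem_range.1 hc
      · rw [Function.update_of_ne h]; exact hl _ ((Finset.mem_insert.1 he').resolve_left h)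
    · by_cases h1 : s(x, y) = s(x₀, y₀) <;> by_cases h2 : s(x, y') = s(x₀, y₀)
      · exact Sym2.congr_right.1 (h1.trans h2.symm)
      · rw [h1, Function.update_self, Function.update_of_ne h2] at heq
        exact absurd heq.symm (key x y y' h1 ((Finset.mem_insert.1 h').resolve_left h2))
      · rw [h2, Function.update_self, Function.update_of_ne h1] at heq
        exact absurd heq (key x y' y h2 ((Finset.mem_insert.1 h).resolve_left h1))
      · rw [Function.update_of_ne h1, Function.update_of_ne h2] at heq
        exact hinj x y y' ((Finset.mem_insert.1 h).resolve_left h1)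
          ((Finset.mem_insert.1 h').resolve_left h2) heq

open scoped Classical in
theorem exists_isOneSparseDecomposition (n d : ℕ) :
    ∃ label : (Fin d → Basis n → Basis n) → Basis n → Basis n → ℕ,
      IsOneSparseDecomposition label := by
  have h : ∀ col : Fin d → Basis n → Basis n, ∃ l : Sym2 (Basis n) → ℕ, ∀ x y, Linked col x y →
      l s(x, y) < 6 * d ^ 2 ∧ ∀ y', Linked col x y' → l s(x, y') = l s(x, y) → y' = y := by
    intro col
    let F : Finset (Sym2 (Basis n)) :=
      (Finset.univ.filter fun z : Basis n × Basis n => Linked col z.1 z.2).image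
        fun z => s(z.1, z.2)
    have hF : ∀ x y, s(x, y) ∈ F ↔ Linked col x y := by
      intro x y
      simp only [F, Finset.mem_image, Finset.mem_filter, Finset.mem_univ, true_and]
      refine ⟨?_, fun h => ⟨(x, y), h, rfl⟩⟩
      rintro ⟨z, hz, he⟩
      rcases Sym2.eq_iff.1 he with ⟨rfl, rfl⟩ | ⟨rfl, rfl⟩
      · exact hz
      · exact hz.symm
    obtain ⟨l, hl, hinj⟩ := exists_edgeColoring col F fun x y => (hF x y).1
    exact ⟨l, fun x y hxy => ⟨hl _ ((hF x y).2 hxy), fun y' hy' he =>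
      hinj x y' y ((hF x y').2 hy') ((hF x y).2 hxy) he⟩⟩
  choose l hl using h
  refine ⟨fun col x y => l col s(x, y), fun col x y hxy => ⟨(hl col x y hxy).1, ?_,
    (hl col x y hxy).2⟩⟩
  exact congrArg _ Sym2.eq_swap

end Coloring

/-! ### Reading the oracles -/

section Reading

variable {n M d nt nH a : ℕ}

/-- The questions that determine the answers of the two oracles on all inputs: a bit of a column
number of a given row, or a bit of a given matrix element. -/
abbrev Question (n M d nt nH : ℕ) : Type :=
  (Fin n × Fin d × Fin M × Basis n) ⊕ (Fin nH × Fin M × Fin (2 ^ nt) × Basis n × Basis n)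

/-- The query gate for a question. -/
def Question.gate : Question n M d nt nH → Gate n M d nt nH a
  | .inl (p, i, μ, _) => .colNum p i μ
  | .inr (p, μ, q, _, _) => .matrixVal p μ q

/-- The contents of the input registers for a question. -/
def Question.input : Question n M d nt nH → Basis n × Basis n
  | .inl (_, _, _, x) => (x, x)
  | .inr (_, _, _, x, y) => (x, y)

/-- The oracles' answer to a question. -/
def Oracles.answer (O : Oracles n M d nt nH) : Question n M d nt nH → Bool
  | .inl (p, i, μ, x) => (O.col μ i x : ℕ).testBit p
  | .inr (p, μ, q, x, y) => O.val p x y μ q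

theorem toMatrix_unitary (O : Oracles n M d nt nH) (V : Matrix.unitaryGroup (Reg n a) ℂ) :
    (.unitary V : Gate n M d nt nH a).toMatrix O = V := rfl

theorem isQuery_unitary (V : Matrix.unitaryGroup (Reg n a) ℂ) :
    (.unitary V : Gate n M d nt nH a).isQuery = false := rfl

theorem isBasisCall_unitary (V : Matrix.unitaryGroup (Reg n a) ℂ) :
    (.unitary V : Gate n M d nt nH a).isBasisCall = false := rfl

theorem isQuery_gate (k : Question n M d nt nH) : (k.gate (a := a)).isQuery = true := by
  rcases k with ⟨p, i, μ, x⟩ | ⟨p, μ, q, x, y⟩ <;> rfl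

theorem isBasisCall_gate (k : Question n M d nt nH) : (k.gate (a := a)).isBasisCall = false := by
  rcases k with ⟨p, i, μ, x⟩ | ⟨p, μ, q, x, y⟩ <;> rfl

theorem toMatrix_gate (O : Oracles n M d nt nH) (k : Question n M d nt nH) :
    ∃ f : Basis n → Basis n → Bool,
      (k.gate (a := a)).toMatrix O = queryMatrix f ∧ f k.input.1 k.input.2 = O.answer k := by
  rcases k with ⟨p, i, μ, x⟩ | ⟨p, μ, q, x, y⟩
  · exact ⟨fun x _ => (O.col μ i x : ℕ).testBit p, rfl, rfl⟩
  · exact ⟨fun x y => O.val p x y μ q, rfl, rfl⟩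

/-- The answers determine the one-sparse terms. -/
theorem oneSparseTerm_congr {O O' : Oracles n M d nt nH} (h : O.answer = O'.answer)
    (label : (Fin d → Basis n → Basis n) → Basis n → Basis n → ℕ) (Υ : ℝ) (μ : Fin M) (j : ℕ)
    (q : Fin (2 ^ nt)) : oneSparseTerm label O Υ μ j q = oneSparseTerm label O' Υ μ j q := by
  have hcol : O.col = O'.col := by
    funext μ i x
    refine Fin.ext (Nat.eq_of_testBit_eq fun p => ?_)
    by_cases hp : p < n
    · exact congrFun h (.inl (⟨p, hp⟩, i, μ, x))
    · have hle : 2 ^ n ≤ 2 ^ p := Nat.pow_le_pow_right two_pos (not_lt.1 hp)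
      rw [Nat.testBit_lt_two_pow ((O.col μ i x).2.trans_le hle),
        Nat.testBit_lt_two_pow ((O'.col μ i x).2.trans_le hle)]
  have hval : O.val = O'.val := by
    funext p x y μ q
    exact congrFun h (.inr (p, μ, q, x, y))
  ext x y
  rw [oneSparseTerm_apply, oneSparseTerm_apply, hcol, hval]

/-- The unitary that permutes the basis states. -/
def permUnitary {ι : Type*} [Fintype ι] [DecidableEq ι] (σ : Equiv.Perm ι) :
    Matrix.unitaryGroup ι ℂ :=
  ⟨(1 : Matrix ι ι ℂ).submatrix id σ, by
    rw [Matrix.mem_unitaryGroup_iff, Matrix.star_eq_conjTranspose, Matrix.conjTranspose_submatrix,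
      Matrix.submatrix_mul_equiv, Matrix.conjTranspose_one, mul_one, Matrix.submatrix_id_id]⟩

/-- The permutation unitary maps the basis state `s` to `σ s`. -/
theorem permUnitary_apply {ι : Type*} [Fintype ι] [DecidableEq ι] (σ : Equiv.Perm ι) (r s : ι) :
    (permUnitary σ : Matrix ι ι ℂ) r s = (1 : Matrix ι ι ℂ) r (σ s) := rfl

/-- If column `s` of `B` is the unit vector `s'`, then column `s` of `A * B` is column `s'` of
`A`. -/
theorem mul_apply_of_col_eq {ι : Type*} [Fintype ι] [DecidableEq ι] {A B : Matrix ι ι ℂ} {s s' : ι}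
    (h : ∀ r, B r s = (1 : Matrix ι ι ℂ) r s') (r : ι) : (A * B) r s = A r s' := by
  rw [Matrix.mul_apply]
  simp [h, Matrix.one_apply]

theorem queryMatrix_apply (f : Basis n → Basis n → Bool) (r : Reg n a) (x y : Basis n) (b : Bool)
    (w : Fin a → Bool) :
    queryMatrix f r (x, y, b, w) = (1 : Matrix (Reg n a) (Reg n a) ℂ) r (x, y, xor b (f x y), w) :=
  rfl

/-- A pointed finite type embeds into the states of some number of qubits, with the point going to
the all-zero state. -/
theorem exists_encoding (α : Type*) [Fintype α] (z : α) :
    ∃ (a : ℕ) (enc : α → Fin a → Bool), Function.Injective enc ∧ enc z = fun _ => false := by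
  classical
  refine ⟨Fintype.card α, fun x i => xor (decide (Fintype.equivFin α x = i))
    (decide (Fintype.equivFin α z = i)), fun x y h => ?_, by simp⟩
  by_contra hne
  have := congrFun h (Fintype.equivFin α x)
  simp [Ne.symm hne] at this

/-- The register state with `x` in the system register, the table `g` encoded in the ancillas and
zeros elsewhere. -/
def tableState (enc : Basis n × (Question n M d nt nH → Bool) → Fin a → Bool)
    (z : Basis n × (Question n M d nt nH → Bool)) : Reg n a :=
  (z.1, ⟨0, Nat.two_pow_pos n⟩, false, enc (⟨0, Nat.two_pow_pos n⟩, z.2))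

/-- The register state for asking the question `k`: the inputs of `k` in the input registers, the
entry `k` of the table in the output qubit, and the system state and the rest of the table in the
ancillas. -/
def askState (enc : Basis n × (Question n M d nt nH → Bool) → Fin a → Bool)
    (k : Question n M d nt nH) (z : Basis n × (Question n M d nt nH → Bool)) : Reg n a :=
  (k.input.1, k.input.2, z.2 k, enc (z.1, Function.update z.2 k false))

theorem tableState_injective {enc : Basis n × (Question n M d nt nH → Bool) → Fin a → Bool}
    (he : Function.Injective enc) : Function.Injective (tableState enc) := by
  rintro ⟨x, g⟩ ⟨x', g'⟩ h
  simp only [tableState, Prod.mk.injEq, true_and] at h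
  exact Prod.ext h.1 (Prod.ext_iff.1 (he h.2)).2

theorem askState_injective {enc : Basis n × (Question n M d nt nH → Bool) → Fin a → Bool}
    (he : Function.Injective enc) (k : Question n M d nt nH) :
    Function.Injective (askState enc k) := by
  rintro ⟨x, g⟩ ⟨x', g'⟩ h
  simp only [askState, Prod.mk.injEq, true_and] at h
  obtain ⟨h1, h2⟩ := Prod.ext_iff.1 (he h.2)
  refine Prod.ext h1 ?_
  have h3 := congrArg (fun u => Function.update u k (g k)) h2
  simp only [Function.update_idem, Function.update_eq_self] at h3
  rw [h.1, Function.update_eq_self] at h3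
  exact h3

/-- Entry `k` of a table, toggled by the oracles' answer. -/
def toggle (O : Oracles n M d nt nH) (g : Question n M d nt nH → Bool)
    (k : Question n M d nt nH) : Question n M d nt nH → Bool :=
  Function.update g k (xor (g k) (O.answer k))

theorem askState_toggle (O : Oracles n M d nt nH)
    (enc : Basis n × (Question n M d nt nH → Bool) → Fin a → Bool)
    (k : Question n M d nt nH) (x : Basis n) (g : Question n M d nt nH → Bool) :
    askState enc k (x, toggle O g k) = (k.input.1, k.input.2, xor (g k) (O.answer k),
      enc (x, Function.update g k false)) := by
  simp [askState, toggle]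

/-- A circuit with one query that toggles entry `k` of the table by the answer to the question
`k`. -/
theorem exists_toggle_circuit {enc : Basis n × (Question n M d nt nH → Bool) → Fin a → Bool}
    (he : Function.Injective enc) (k : Question n M d nt nH) :
    ∃ c : Circuit n M d nt nH a, c.numQueries = 1 ∧ c.numBasisCalls = 0 ∧
      ∀ (O : Oracles n M d nt nH) x g r, Circuit.run O c r (tableState enc (x, g)) =
        (1 : Matrix (Reg n a) (Reg n a) ℂ) r (tableState enc (x, toggle O g k)) := by
  obtain ⟨σ, hσ⟩ := Equiv.Perm.exists_extending_pair (tableState enc) (askState enc k)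
    (tableState_injective he) (askState_injective he k)
  refine ⟨[.unitary (permUnitary σ), k.gate, .unitary (permUnitary σ⁻¹)], ?_, ?_,
    fun O x g r => ?_⟩
  · simp [Circuit.numQueries, isQuery_gate, isQuery_unitary]
  · simp [Circuit.numBasisCalls, isBasisCall_gate, isBasisCall_unitary]
  · obtain ⟨f, hf, hfk⟩ := toMatrix_gate (a := a) O k
    have h1 : ∀ r, (permUnitary σ : Matrix (Reg n a) (Reg n a) ℂ) r (tableState enc (x, g)) =
        (1 : Matrix (Reg n a) (Reg n a) ℂ) r (askState enc k (x, g)) := fun r => by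
      rw [permUnitary_apply, hσ]
    have h2 : ∀ r, (queryMatrix f * (permUnitary σ : Matrix (Reg n a) (Reg n a) ℂ) :
        Matrix (Reg n a) (Reg n a) ℂ) r (tableState enc (x, g)) =
        (1 : Matrix (Reg n a) (Reg n a) ℂ) r (askState enc k (x, toggle O g k)) := fun r => by
      rw [mul_apply_of_col_eq h1, askState_toggle, askState, queryMatrix_apply, hfk]
    simp only [Circuit.run, toMatrix_unitary, hf, one_mul]
    rw [mul_assoc, mul_apply_of_col_eq h2, permUnitary_apply, ← hσ]
    exact congrArg _ (σ.symm_apply_apply _)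

/-- A circuit that toggles all entries of the table by the answers. -/
theorem exists_reading_circuit {enc : Basis n × (Question n M d nt nH → Bool) → Fin a → Bool}
    (he : Function.Injective enc) :
    ∃ c : Circuit n M d nt nH a, c.numQueries = Fintype.card (Question n M d nt nH) ∧
      c.numBasisCalls = 0 ∧
      ∀ (O : Oracles n M d nt nH) x g r, Circuit.run O c r (tableState enc (x, g)) =
        (1 : Matrix (Reg n a) (Reg n a) ℂ) r
          (tableState enc (x, fun k => xor (g k) (O.answer k))) := by
  classical
  choose c hq hb hc using exists_toggle_circuit he
  have hrun : ∀ (O : Oracles n M d nt nH) x (l : List (Question n M d nt nH)) g r,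
      Circuit.run O (l.flatMap c) r (tableState enc (x, g)) =
        (1 : Matrix (Reg n a) (Reg n a) ℂ) r (tableState enc (x, l.foldl (toggle O) g)) := by
    intro O x l
    induction l with
    | nil => intro g r; rfl
    | cons k l ih =>
      intro g r
      rw [List.flatMap_cons, Circuit.run_append, mul_apply_of_col_eq (hc k O x g), ih,
        List.foldl_cons]
  have hfold : ∀ (O : Oracles n M d nt nH) (l : List (Question n M d nt nH)), l.Nodup → ∀ g k,
      l.foldl (toggle O) g k = if k ∈ l then xor (g k) (O.answer k) else g k := by
    intro O l
    induction l with
    | nil => simp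
    | cons k' l ih =>
      intro hl g k
      rw [List.foldl_cons, ih (List.nodup_cons.1 hl).2]
      by_cases hk : k = k'
      · subst hk
        simp [(List.nodup_cons.1 hl).1, toggle]
      · simp [hk, toggle]
  refine ⟨Finset.univ.toList.flatMap c, ?_, ?_, fun O x g r => ?_⟩
  · rw [Circuit.numQueries, countP_flatMap_eq _ _ _ hq, Finset.length_toList, mul_one,
      Finset.card_univ]
  · rw [Circuit.numBasisCalls, countP_flatMap_eq _ _ _ hb, mul_zero]
  · have h : Finset.univ.toList.foldl (toggle O) g = fun k => xor (g k) (O.answer k) := by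
      funext k
      rw [hfold O _ (Finset.nodup_toList _), if_pos (by simp)]
    rw [hrun, h]

/-- The unitary that applies `W w` to the system register if the other registers are in the basis
state `w`. -/
def controlled (W : Basis n × Bool × (Fin a → Bool) → Matrix.unitaryGroup (Basis n) ℂ) :
    Matrix.unitaryGroup (Reg n a) ℂ :=
  ⟨Matrix.blockDiagonal fun w => (W w : Op n), by
    rw [Matrix.mem_unitaryGroup_iff, Matrix.star_eq_conjTranspose,
      Matrix.blockDiagonal_conjTranspose, ← Matrix.blockDiagonal_mul]
    have : (fun w => (W w : Op n) * (W w : Op n).conjTranspose) = 1 :=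
      funext fun w => Unitary.mul_star_self_of_mem (W w).2
    rw [this, Matrix.blockDiagonal_one]⟩

/-- Reading the whole table of answers, applying a unitary controlled by the table, and reading
again to clear the table implements any unitary that is a function of the answers. -/
theorem exists_circuit_of_answers (n M d nt nH : ℕ) :
    ∃ a : ℕ, ∀ W : (Question n M d nt nH → Bool) → Matrix.unitaryGroup (Basis n) ℂ,
      ∃ c : Circuit n M d nt nH a, c.numQueries = 2 * Fintype.card (Question n M d nt nH) ∧
        c.numBasisCalls = 0 ∧ ∀ O, c.Implements O (W O.answer : Op n) := by
  obtain ⟨a, enc, he, henc⟩ := exists_encoding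
    (Basis n × (Question n M d nt nH → Bool)) (⟨0, Nat.two_pow_pos n⟩, fun _ => false)
  refine ⟨a, fun W => ?_⟩
  obtain ⟨c, hq, hb, hc⟩ := exists_reading_circuit he
  let e : (Question n M d nt nH → Bool) → Basis n × Bool × (Fin a → Bool) := fun g =>
    (⟨0, Nat.two_pow_pos n⟩, false, enc (⟨0, Nat.two_pow_pos n⟩, g))
  have hinj : Function.Injective e := by
    intro g g' h
    simp only [e, Prod.mk.injEq, true_and] at h
    exact (Prod.ext_iff.1 (he h)).2
  -- `e g` is the content of the other registers when the table is `g`; contents that do not encode a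
  -- table never occur
  refine ⟨c ++ [.unitary (controlled (Function.extend e W fun _ => 1))] ++ c, ?_, ?_,
    fun O r x => ?_⟩
  · rw [Circuit.numQueries] at hq ⊢
    rw [List.countP_append, List.countP_append, hq, List.countP_singleton]
    simp [Gate.isQuery]; ring
  · rw [Circuit.numBasisCalls] at hb ⊢
    rw [List.countP_append, List.countP_append, hb, List.countP_singleton]
    simp [Gate.isBasisCall]
  · have hblank : ∀ x, tableState enc (x, fun _ => false) = (x, blank n a) := fun x => by
      rw [tableState, henc]; rfl
    rw [Circuit.run_append, Circuit.run_append, ← mul_assoc, ← hblank,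
      mul_apply_of_col_eq (hc O x _), Circuit.run_singleton, Matrix.mul_apply]
    simp only [Bool.false_xor, Gate.toMatrix, controlled, tableState, Matrix.blockDiagonal_apply]
    rw [Fintype.sum_prod_type]
    simp only [mul_ite, mul_zero, Finset.sum_ite_eq', Finset.mem_univ, if_true]
    rw [hinj.extend_apply]
    have h0 : ∀ x', Circuit.run O c r (tableState enc (x', O.answer)) =
        (1 : Matrix (Reg n a) (Reg n a) ℂ) r (x', blank n a) := fun x' => by
      have hxor : (fun k => xor (O.answer k) (O.answer k)) = fun _ => false :=
        funext fun k => Bool.xor_self _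
      rw [hc O x' O.answer r, hxor, hblank]
    simp only [tableState] at h0
    simp only [h0, Matrix.one_apply]
    obtain ⟨r1, r2⟩ := r
    simp only [Prod.mk.injEq]
    by_cases h : r2 = blank n a <;> simp [h]

/-- Some number of queries suffices to simulate the one-sparse exponentials. -/
theorem exists_oneSparseSimulable (n M d nt nH : ℕ) (t₀ Δt Υ : ℝ) :
    ∃ c, OneSparseSimulable n M d nt nH t₀ Δt Υ c := by
  classical
  obtain ⟨label, hl⟩ := exists_isOneSparseDecomposition n d
  obtain ⟨a, ha⟩ := exists_circuit_of_answers n M d nt nH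
  refine ⟨2 * Fintype.card (Question n M d nt nH), label, hl, a, fun μ j _ q δ => ?_⟩
  have hu : ∀ O : Oracles n M d nt nH,
      NormedSpace.exp ((-Complex.I * (δ : ℂ)) • oneSparseTerm label O Υ μ j q) ∈
        Matrix.unitaryGroup (Basis n) ℂ := fun O => by
    refine exp_mem_unitary ?_
    rw [star_smul, Matrix.star_eq_conjTranspose, (isHermitian_oneSparseTerm O hl Υ μ j q).eq]
    simp
  obtain ⟨c, hq, hb, hc⟩ := ha fun g =>
    if h : ∃ O : Oracles n M d nt nH, O.answer = g then ⟨_, hu h.choose⟩ else 1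
  refine ⟨c, hq.le, hb, fun H O _ _ => ?_⟩
  have h := hc O
  have hex : ∃ O' : Oracles n M d nt nH, O'.answer = O.answer := ⟨O, rfl⟩
  rw [dif_pos hex] at h
  simpa only [oneSparseTerm_congr hex.choose_spec] using h

theorem oneSparseSimulable_oneSparseCost (n M d nt nH : ℕ) (t₀ Δt Υ : ℝ) :
    OneSparseSimulable n M d nt nH t₀ Δt Υ (oneSparseCost n M d nt nH t₀ Δt Υ) :=
  Nat.sInf_mem (s := {c | OneSparseSimulable n M d nt nH t₀ Δt Υ c})
    (exists_oneSparseSimulable n M d nt nH t₀ Δt Υ)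

end Reading

/-! ### Neutral queries -/

section Neutral

variable {n M d nt nH a : ℕ}

/-- The Hadamard matrix. -/
def hadamard : Matrix Bool Bool ℂ :=
  Matrix.of fun b c => ((√2)⁻¹ : ℝ) * if b && c then -1 else 1

theorem hadamard_mem_unitaryGroup : hadamard ∈ Matrix.unitaryGroup Bool ℂ := by
  have h2 : (((√2)⁻¹ : ℝ) : ℂ) * (((√2)⁻¹ : ℝ) : ℂ) = 1 / 2 := by
    rw [← Complex.ofReal_mul, ← mul_inv, Real.mul_self_sqrt zero_le_two]; norm_num
  rw [Matrix.mem_unitaryGroup_iff]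
  ext b c
  cases b <;> cases c <;>
    simp [Matrix.mul_apply, hadamard, Matrix.star_apply, -Complex.ofReal_inv, h2]
  norm_num

/-- The Hadamard matrix on the output qubit of the oracles. -/
def outputHadamard (n a : ℕ) : Matrix.unitaryGroup (Reg n a) ℂ :=
  ⟨(Matrix.blockDiagonal fun _ : Basis n × Basis n × (Fin a → Bool) => hadamard).submatrix
      (fun r => (r.2.2.1, r.1, r.2.1, r.2.2.2)) (fun r => (r.2.2.1, r.1, r.2.1, r.2.2.2)), by
    let e : Reg n a ≃ Bool × Basis n × Basis n × (Fin a → Bool) :=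
      ⟨fun r => (r.2.2.1, r.1, r.2.1, r.2.2.2), fun s => (s.2.1, s.2.2.1, s.1, s.2.2.2),
        fun _ => rfl, fun _ => rfl⟩
    change (Matrix.blockDiagonal _).submatrix e e ∈ _
    rw [Matrix.mem_unitaryGroup_iff, Matrix.star_eq_conjTranspose, Matrix.conjTranspose_submatrix,
      Matrix.submatrix_mul_equiv, Matrix.blockDiagonal_conjTranspose, ← Matrix.blockDiagonal_mul]
    have : (fun _ : Basis n × Basis n × (Fin a → Bool) => hadamard * hadamard.conjTranspose) = 1 :=
      funext fun _ => Unitary.mul_star_self_of_mem hadamard_mem_unitaryGroup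
    rw [this, Matrix.blockDiagonal_one, Matrix.submatrix_one_equiv]⟩

/-- A query with the output qubit in the state `|0⟩ + |1⟩` changes nothing. -/
theorem queryMatrix_mul_outputHadamard (f : Basis n → Basis n → Bool) (r : Reg n a) (x : Basis n) :
    (queryMatrix f * (outputHadamard n a : Matrix (Reg n a) (Reg n a) ℂ) :
      Matrix (Reg n a) (Reg n a) ℂ) r (x, blank n a) =
      (outputHadamard n a : Matrix (Reg n a) (Reg n a) ℂ) r (x, blank n a) := by
  obtain ⟨r1, r2, b, w⟩ := r
  rw [Matrix.mul_apply, Finset.sum_eq_single (r1, r2, xor b (f r1 r2), w)]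
  · simp [queryMatrix, outputHadamard, blank, hadamard, Matrix.blockDiagonal_apply]
  · rintro ⟨s1, s2, c, v⟩ - hs
    have h0 : queryMatrix f (r1, r2, b, w) (s1, s2, c, v) = 0 := by
      refine if_neg fun h => hs ?_
      simp only [Prod.mk.injEq] at h
      obtain ⟨rfl, rfl, rfl, rfl⟩ := h
      simp
    rw [h0, zero_mul]
  · simp

theorem exists_neutral_circuit (g : Gate n M d nt nH a) (hg : g.isQuery = true) :
    ∃ c : Circuit n M d nt nH a, c.numQueries = 1 ∧ c.numBasisCalls = 0 ∧
      ∀ O, c.Implements O 1 := by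
  refine ⟨[.unitary (outputHadamard n a), g, .unitary (outputHadamard n a)⁻¹], ?_, ?_,
    fun O r x => ?_⟩
  · simp [Circuit.numQueries, hg, isQuery_unitary]
  · cases g <;> simp_all [Circuit.numBasisCalls, Gate.isBasisCall, Gate.isQuery]
  · obtain ⟨f, hf⟩ : ∃ f, g.toMatrix O = queryMatrix f := by
      cases g <;> simp_all [Gate.isQuery, Gate.toMatrix]
    rw [Circuit.run, Circuit.run, Circuit.run, Circuit.run, one_mul, hf, mul_assoc,
      Matrix.mul_apply]
    simp only [Gate.toMatrix, queryMatrix_mul_outputHadamard]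
    rw [← Matrix.mul_apply, ← Submonoid.coe_mul, inv_mul_cancel]
    exact Circuit.implements_nil (O := O) r x

/-- Unless no circuit can make a query, neutral queries are available in any number. -/
theorem exists_padding_circuit {S : Circuit n M d nt nH a} (hS : S.numQueries ≠ 0) (m : ℕ) :
    ∃ c : Circuit n M d nt nH a, c.numQueries = m ∧ c.numBasisCalls = 0 ∧
      ∀ O, c.Implements O 1 := by
  obtain ⟨g, -, hg⟩ := List.countP_pos_iff.1 (Nat.pos_of_ne_zero hS)
  obtain ⟨c₁, hq, hb, hc⟩ := exists_neutral_circuit g hg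
  induction m with
  | zero => exact ⟨[], rfl, rfl, fun O => Circuit.implements_nil⟩
  | succ m ih =>
    obtain ⟨c, hq', hb', hc'⟩ := ih
    refine ⟨c ++ c₁, ?_, ?_, fun O => ?_⟩
    · rw [Circuit.numQueries] at *; rw [List.countP_append, hq, hq']
    · rw [Circuit.numBasisCalls] at *; rw [List.countP_append, hb, hb']
    · simpa using (hc' O).append (hc O)

end Neutral

/-! ### Degenerate cases -/

section Degenerate

variable {n M d nt nH a : ℕ} {t₀ Δt Υ : ℝ}

theorem IsEvolution.eq_one {G U : ℝ → Op n} (hΔt : 0 ≤ Δt) (hU : IsEvolution G t₀ Δt U)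
    (hG : ∀ t ∈ Set.Icc t₀ (t₀ + Δt), G t = 0) : U (t₀ + Δt) = 1 := by
  have h := (convex_Icc t₀ (t₀ + Δt)).norm_image_sub_le_of_norm_hasDerivWithin_le (C := 0) hU.2
    (fun t ht => by simp [hG t ht]) (Set.left_mem_Icc.2 (by linarith))
    (Set.right_mem_Icc.2 (by linarith))
  rw [zero_mul, norm_le_zero_iff, sub_eq_zero, hU.1] at h
  exact h

theorem totalHamiltonian_eq_zero {H : Fin M → ℝ → Op n}
    (T : Fin M → Matrix.unitaryGroup (Basis n) ℂ) {t : ℝ} (h : ∀ μ, H μ t = 0) :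
    totalHamiltonian H T t = 0 := by
  simp [totalHamiltonian, h]

theorem IsSmoothOn.eq_zero {H : Fin M → ℝ → Op n} {P : ℕ} {S : Set ℝ} (hs : IsSmoothOn 0 P H S)
    (μ : Fin M) {t : ℝ} (ht : t ∈ S) : H μ t = 0 := by
  have h := hs.2 0 (Nat.zero_le _) t ht
  simp only [iteratedDerivWithin_zero, Nat.cast_zero, zero_add, div_one, Real.rpow_one] at h
  exact norm_le_zero_iff.1
    ((Finset.single_le_sum (f := fun μ => ‖H μ t‖) (fun _ _ => norm_nonneg _)
      (Finset.mem_univ μ)).trans h)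

theorem suzukiFormula_eq_one {ι : Type*} (l : List ι) {X : ℝ → ι → Op n}
    (h : ∀ t i (δ : ℝ), NormedSpace.exp ((δ : ℂ) • X t i) = 1) (j : ℕ) (τ t₀ : ℝ) (r : ℕ) :
    suzukiFormula l X j τ t₀ r = 1 := by
  have hstrang : ∀ t (δ : ℝ), strang l (X t) (δ : ℂ) = 1 := fun t δ => by
    have h2 : ∀ i, NormedSpace.exp (((δ : ℂ) / 2) • X t i) = 1 := fun i => by
      simpa using h t i (δ / 2)
    simp [strang, h2]
  induction r with
  | zero => rfl
  | succ r ih =>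
    rw [suzukiFormula, ih, mul_one, suzukiStep]
    simp only [hstrang]
    simp

theorem Circuit.Implements.unique {c : Circuit n M d nt nH a} {O : Oracles n M d nt nH}
    {V V' : Op n} (h : c.Implements O V) (h' : c.Implements O V') : V = V' := by
  ext x y
  simpa using (h (x, blank n a) y).symm.trans (h' (x, blank n a) y)

/-- A circuit without queries and basis changes does not depend on the oracles. -/
theorem Circuit.run_congr {c : Circuit n M d nt nH a} (hq : c.numQueries = 0)
    (hb : c.numBasisCalls = 0) (O O' : Oracles n M d nt nH) :
    Circuit.run O c = Circuit.run O' c := by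
  rw [Circuit.numQueries, List.countP_eq_zero] at hq
  rw [Circuit.numBasisCalls, List.countP_eq_zero] at hb
  induction c with
  | nil => rfl
  | cons g c ih =>
    rw [Circuit.run, Circuit.run, ih (fun g hg => hq g (List.mem_cons_of_mem _ hg))
      fun g hg => hb g (List.mem_cons_of_mem _ hg)]
    have hq' := hq g List.mem_cons_self
    have hb' := hb g List.mem_cons_self
    cases g <;> first | rfl | exact absurd rfl hq' | exact absurd rfl hb'

/-- If no queries are needed to simulate one-sparse Hamiltonians, then the one-sparse exponentials
are trivial, since they agree with those of the zero Hamiltonian. -/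
theorem exp_oneSparseTerm_eq_one
    {label : (Fin d → Basis n → Basis n) → Basis n → Basis n → ℕ} (hΥ : 0 ≤ Υ) {μ : Fin M} {j : ℕ}
    {q : Fin (2 ^ nt)} {δ : ℝ} {S : Circuit n M d nt nH a} (hq : S.numQueries = 0)
    (hb : S.numBasisCalls = 0)
    (hS : ∀ (H : Fin M → ℝ → Op n) (O : Oracles n M d nt nH),
      (∀ ν, ∀ t ∈ Set.Icc t₀ (t₀ + Δt), (H ν t).IsHermitian) → O.Describes H t₀ Δt Υ →
      S.Implements O (NormedSpace.exp ((-Complex.I * (δ : ℂ)) • oneSparseTerm label O Υ μ j q)))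
    {H : Fin M → ℝ → Op n} {O : Oracles n M d nt nH}
    (hH : ∀ ν, ∀ t ∈ Set.Icc t₀ (t₀ + Δt), (H ν t).IsHermitian) (hO : O.Describes H t₀ Δt Υ) :
    NormedSpace.exp ((-Complex.I * (δ : ℂ)) • oneSparseTerm label O Υ μ j q) = 1 := by
  let O' : Oracles n M d nt nH := ⟨O.col, fun _ _ _ _ _ => false, O.T⟩
  have hm : modulusCode (nH := nH) (fun _ => false) = 0 := by simp [modulusCode]
  have hp : phaseCode (nH := nH) (fun _ => false) = 0 := by simp [phaseCode]
  have hO' : O'.Describes (fun _ _ => 0) t₀ Δt Υ := by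
    refine ⟨fun _ _ _ _ _ => by simpa using hΥ, fun μ x y ⟨t, _, h⟩ => absurd rfl h,
      fun μ q x y => ⟨0, 0, le_rfl, by simp, ?_, ?_⟩⟩
    · simp only [O', hm]; simp; positivity
    · simp only [O', hp]; simp; positivity
  have h0 : oneSparseTerm label O' Υ μ j q = 0 := by
    ext x y
    rw [oneSparseTerm_apply]
    simp [O', decode, hm]
  have h := hS _ O' (fun _ _ _ => Matrix.isHermitian_zero) hO'
  rw [h0, smul_zero, NormedSpace.exp_zero] at h
  refine (hS H O hH hO).unique fun r x => ?_
  rw [Circuit.run_congr hq hb O O']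
  exact h r x

end Degenerate

/-! ### The total error -/

section TotalError

variable {n M d nt nH : ℕ} {label : (Fin d → Basis n → Basis n) → Basis n → Basis n → ℕ}

/-- The error due to the finite number of bits and of mesh times; `σ` is the total length of a
Suzuki schedule. -/
theorem precision_error_le {m d' σ Δt Υ ε : ℝ} (hm : 0 < m) (hd : 0 < d') (hσ : 0 < σ)
    (hΔt : 0 < Δt) (hε : 0 < ε) (hΥ : 0 ≤ Υ)
    (hnH : 2 * ⌈Real.logb 2 (32 * σ * m * d' ^ 2 * Υ * Δt / ε)⌉ + 6 ≤ (nH : ℤ)) :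
    σ * Δt * (6 * d' ^ 2 * (m * (8 * Υ / 2 ^ (nH / 2) +
      2 ^ nt * ε / (32 * σ * m * d' ^ 2 * Δt ^ 2) * (Δt / 2 ^ (nt + 1))))) ≤ ε / 2 := by
  -- the `+ 6` in the number of bits, shared by modulus and phase, is a factor `8` here
  have hX : 8 * (32 * σ * m * d' ^ 2 * Υ * Δt / ε) ≤ (2 : ℝ) ^ (nH / 2) := by
    rcases hΥ.eq_or_lt with rfl | hΥ
    · simp
    · apply le_two_pow_of_logb_le
      rw [Real.logb_mul (by norm_num) (by positivity),
        show Real.logb 2 8 = 3 by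
          rw [show (8 : ℝ) = 2 ^ (3 : ℝ) by norm_num, Real.logb_rpow (by norm_num) (by norm_num)],
        add_comm, Int.ceil_add_ofNat]
      push_cast
      omega
  have h1 : σ * Δt * (6 * d' ^ 2 * (m * (8 * Υ / 2 ^ (nH / 2)))) ≤ 6 / 32 * ε := by
    rw [← mul_div_assoc, ← mul_div_assoc, ← mul_div_assoc, div_le_iff₀ (by positivity)]
    calc _ = 6 / 32 * ε * (8 * (32 * σ * m * d' ^ 2 * Υ * Δt / ε)) := by field_simp
      _ ≤ _ := by gcongr
  have h2 : σ * Δt * (6 * d' ^ 2 * (m * (2 ^ nt * ε / (32 * σ * m * d' ^ 2 * Δt ^ 2) *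
      (Δt / 2 ^ (nt + 1))))) = 3 / 32 * ε := by
    rw [pow_succ]; field_simp; ring
  calc _ = σ * Δt * (6 * d' ^ 2 * (m * (8 * Υ / 2 ^ (nH / 2)))) +
        σ * Δt * (6 * d' ^ 2 * (m * (2 ^ nt * ε / (32 * σ * m * d' ^ 2 * Δt ^ 2) *
          (Δt / 2 ^ (nt + 1))))) := by ring
    _ ≤ ε / 2 := by rw [h2]; linarith

/-- With the number of steps and the precision of the theorem, the product formula with the
one-sparse terms given by the oracles is within `ε` of the evolution. -/
theorem norm_evolution_sub_oracleFormula_le_tolerance (hl : IsOneSparseDecomposition label)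
    {O : Oracles n M d nt nH} {H : Fin M → ℝ → Op n} {U : ℝ → Op n} {t₀ Δt Λ Υ ε : ℝ} {j r : ℕ}
    (hM : 1 ≤ M) (hd : 1 ≤ d) (hΔt : 0 < Δt) (hΛ : 0 < Λ) (hε : 0 < ε)
    (hr : r = ⌈24 * ((j + 1 : ℕ) : ℝ) * (d : ℝ) ^ 2 * Λ * Δt * (5 / 3 : ℝ) ^ (j + 1) *
      (6 * (d : ℝ) ^ 2 * Λ * Δt / (reducedTolerance d (j + 1) Λ Δt ε / 2))
        ^ (1 / (2 * ((j + 1 : ℕ) : ℝ)))⌉₊)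
    (hnH : 2 * ⌈Real.logb 2 (32 * ((j + 1 : ℕ) : ℝ) * (M : ℝ) * (d : ℝ) ^ 2 *
      (5 / 3 : ℝ) ^ j * Υ * Δt / ε)⌉ + 6 ≤ (nH : ℤ))
    (hH : ∀ μ, ∀ t ∈ Set.Icc t₀ (t₀ + Δt), (H μ t).IsHermitian)
    (hs : IsSmoothOn Λ (2 * (j + 1)) H (Set.Icc t₀ (t₀ + Δt))) (hO : O.Describes H t₀ Δt Υ)
    (hnt : ∀ μ, ∀ t ∈ Set.Icc t₀ (t₀ + Δt),
      ⌈Real.logb 2 (‖derivWithin (H μ) (Set.Icc t₀ (t₀ + Δt)) t‖ *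
        (32 * ((j + 1 : ℕ) : ℝ) * (M : ℝ) * (d : ℝ) ^ 2) * (5 / 3 : ℝ) ^ j * Δt ^ 2 / ε)⌉
        ≤ (nt : ℤ))
    {q : ℝ → Fin (2 ^ nt)}
    (hq : ∀ t ∈ Set.Icc t₀ (t₀ + Δt), |meshTime t₀ Δt (q t) - t| ≤ Δt / 2 ^ (nt + 1))
    (hU : IsEvolution (totalHamiltonian H O.T) t₀ Δt U) :
    ‖U (t₀ + Δt) - suzukiFormula (termList M d) (fun t => oracleGenerator label O Υ (q t)) j
        (Δt / r) t₀ r‖ ≤ ε := by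
  have hM' : (0 : ℝ) < M := by exact_mod_cast hM
  have hd' : (0 : ℝ) < d := by exact_mod_cast hd
  have hΥ : 0 ≤ Υ := (norm_nonneg _).trans
    (hO.bound ⟨0, hM⟩ t₀ (Set.left_mem_Icc.2 (by linarith)) ⟨0, Nat.two_pow_pos n⟩
      ⟨0, Nat.two_pow_pos n⟩)
  set σ : ℝ := (j + 1) * (5 / 3 : ℝ) ^ j with hσ
  have hσ0 : 0 < σ := by positivity
  have hσ1 : 1 ≤ σ := one_le_mul_of_one_le_of_one_le (by linarith [(j.cast_nonneg : (0 : ℝ) ≤ j)])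
    (one_le_pow₀ (by norm_num))
  have htol : reducedTolerance d (j + 1) Λ Δt ε =
      min ε (3 * (5 / 3 : ℝ) ^ j * (6 * (d : ℝ) ^ 2 * Λ * Δt)) := by
    rw [reducedTolerance, Nat.add_sub_cancel]; congr 1; ring
  obtain ⟨hr0, hx, herr⟩ := stepCount_bound j (K := 6 * (d : ℝ) ^ 2 * Λ * Δt) (r := r)
    (by positivity) hε rfl (by
      refine le_trans (le_of_eq ?_) ((Nat.le_ceil _).trans (Nat.cast_le.2 hr.ge))
      rw [htol]; ring)
  rw [← hσ, mul_div_assoc] at hx herr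
  refine (norm_evolution_sub_oracleFormula_le hl j r hd hΔt hΛ (Nat.cast_pos.1 hr0) hσ1
    (sum_abs_suzukiSchedule_le j) (C := 2 ^ nt * ε / (32 * σ * M * (d : ℝ) ^ 2 * Δt ^ 2))
    (by positivity) hΥ hH hs hO (fun μ t ht => ?_) hq hU hx).trans ?_
  · rw [le_div_iff₀ (by positivity)]
    have h := le_two_pow_of_logb_le (hnt μ t ht)
    rw [div_le_iff₀ hε] at h
    refine le_trans (le_of_eq ?_) h
    rw [hσ]; push_cast; ring
  · have h := precision_error_le (nt := nt) (nH := nH) hM' hd' hσ0 hΔt hε hΥ (by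
      refine le_trans (le_of_eq ?_) hnH
      congr 5
      rw [hσ]; push_cast; ring)
    linarith

end TotalError

end HamSim

end

theorem mainTheorem4 (n M d k nt nH : ℕ) (t₀ Δt Λ Υ ε : ℝ)
    (hk : 1 ≤ k) (hΔt : 0 ≤ Δt) (hΛ : 0 ≤ Λ) (hε : 0 < ε) (hε1 : ε ≤ 1)
    (hnH : 2 * ⌈Real.logb 2
        (32 * (k : ℝ) * (M : ℝ) * (d : ℝ) ^ 2 * (5 / 3 : ℝ) ^ (k - 1) * Υ * Δt / ε)⌉ + 6
      ≤ (nH : ℤ)) :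
    ∃ (a : ℕ) (S : HamSim.Circuit n M d nt nH a),
      S.numQueries ≤
        12 * HamSim.oneSparseCost n M d nt nH t₀ Δt Υ * M * d ^ 2 * 5 ^ (k - 1) *
          ⌈24 * (k : ℝ) * (d : ℝ) ^ 2 * Λ * Δt * (5 / 3 : ℝ) ^ k *
            (6 * (d : ℝ) ^ 2 * Λ * Δt / (HamSim.reducedTolerance d k Λ Δt ε / 2))
              ^ (1 / (2 * (k : ℝ)))⌉₊ ∧
      (S.numBasisCalls : ℝ) ≤
        (S.numQueries : ℝ) /
          (3 * (HamSim.oneSparseCost n M d nt nH t₀ Δt Υ : ℝ) * (d : ℝ) ^ 2) ∧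
      ∀ (H : Fin M → ℝ → HamSim.Op n) (O : HamSim.Oracles n M d nt nH),
        (∀ μ, ∀ t ∈ Set.Icc t₀ (t₀ + Δt), (H μ t).IsHermitian) →
        HamSim.IsSparseOn d H (Set.Icc t₀ (t₀ + Δt)) →
        HamSim.IsSmoothOn Λ (2 * k) H (Set.Icc t₀ (t₀ + Δt)) →
        O.Describes H t₀ Δt Υ →
        (∀ μ, ∀ t ∈ Set.Icc t₀ (t₀ + Δt),
          ⌈Real.logb 2 (‖derivWithin (H μ) (Set.Icc t₀ (t₀ + Δt)) t‖ *
            (32 * (k : ℝ) * (M : ℝ) * (d : ℝ) ^ 2) * (5 / 3 : ℝ) ^ (k - 1) * Δt ^ 2 / ε)⌉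
            ≤ (nt : ℤ)) →
        ∀ U : ℝ → HamSim.Op n,
          HamSim.IsEvolution (HamSim.totalHamiltonian H O.T) t₀ Δt U →
          ∃ V : HamSim.Op n, S.Implements O V ∧ ‖U (t₀ + Δt) - V‖ ≤ ε := by
  obtain ⟨j, rfl⟩ : ∃ j, k = j + 1 := ⟨k - 1, by omega⟩
  rw [Nat.add_sub_cancel] at *
  set C := HamSim.oneSparseCost n M d nt nH t₀ Δt Υ with hC
  obtain ⟨r, hr⟩ : ∃ r : ℕ, r = ⌈24 * ((j + 1 : ℕ) : ℝ) * (d : ℝ) ^ 2 * Λ * Δt *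
      (5 / 3 : ℝ) ^ (j + 1) *
      (6 * (d : ℝ) ^ 2 * Λ * Δt / (HamSim.reducedTolerance d (j + 1) Λ Δt ε / 2))
        ^ (1 / (2 * ((j + 1 : ℕ) : ℝ)))⌉₊ := ⟨_, rfl⟩
  rw [← hr]
  -- The empty circuit implements `1`, without any calls.
  have hempty : ∀ O : HamSim.Oracles n M d nt nH,
      HamSim.Circuit.Implements ([] : HamSim.Circuit n M d nt nH 0) O 1 :=
    fun O => HamSim.Circuit.implements_nil
  by_cases hdeg : Δt = 0 ∨ Λ = 0 ∨ M = 0 ∨ d = 0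
  · refine ⟨0, [], by simp [HamSim.Circuit.numQueries],
      by simp [HamSim.Circuit.numQueries, HamSim.Circuit.numBasisCalls],
      fun H O hH _ hs hO _ U hU => ⟨1, hempty O, ?_⟩⟩
    have h1 : U (t₀ + Δt) = 1 := by
      rcases hdeg with rfl | rfl | rfl | rfl
      · rw [add_zero, hU.1]
      · exact hU.eq_one hΔt fun t ht =>
          HamSim.totalHamiltonian_eq_zero _ fun μ => hs.eq_zero μ ht
      · exact hU.eq_one hΔt fun t _ => HamSim.totalHamiltonian_eq_zero _ fun μ => μ.elim0
      · refine hU.eq_one hΔt fun t ht => HamSim.totalHamiltonian_eq_zero _ fun μ => ?_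
        ext x y
        by_contra h
        obtain ⟨i, -⟩ := hO.col_spec μ x y ⟨t, ht, h⟩
        exact i.elim0
    rw [h1, sub_self, norm_zero]
    exact hε.le
  push Not at hdeg
  obtain ⟨hΔt0, hΛ0, hM0, hd0⟩ := hdeg
  replace hΔt : 0 < Δt := lt_of_le_of_ne hΔt hΔt0.symm
  replace hΛ : 0 < Λ := lt_of_le_of_ne hΛ hΛ0.symm
  have hM : 1 ≤ M := Nat.one_le_iff_ne_zero.2 hM0
  have hd : 1 ≤ d := Nat.one_le_iff_ne_zero.2 hd0
  have : Nonempty (Fin (2 ^ nt)) := ⟨⟨0, Nat.two_pow_pos nt⟩⟩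
  -- `q t` is the mesh time used for `t`.
  choose! q hq using fun t (ht : t ∈ Set.Icc t₀ (t₀ + Δt)) =>
    HamSim.exists_meshTime_near hΔt nt ht
  obtain ⟨label, hl, a, ha⟩ := HamSim.oneSparseSimulable_oneSparseCost n M d nt nH t₀ Δt Υ
  rw [← hC] at ha
  choose S hSq hSb hS using fun μ (i : Fin (6 * d ^ 2)) => ha μ i i.2
  by_cases hC0 : C = 0
  · refine ⟨0, [], by simp [HamSim.Circuit.numQueries],
      by simp [HamSim.Circuit.numQueries, HamSim.Circuit.numBasisCalls],
      fun H O hH _ hs hO hnt U hU => ⟨1, hempty O, ?_⟩⟩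
    have hΥ : 0 ≤ Υ := (norm_nonneg _).trans
      (hO.bound ⟨0, hM⟩ t₀ (Set.left_mem_Icc.2 (by linarith)) ⟨0, Nat.two_pow_pos n⟩
        ⟨0, Nat.two_pow_pos n⟩)
    have h := HamSim.norm_evolution_sub_oracleFormula_le_tolerance hl hM hd hΔt hΛ hε hr hnH hH hs
      hO hnt hq hU
    rwa [HamSim.suzukiFormula_eq_one] at h
    intro t i δ
    rw [HamSim.oracleGenerator, HamSim.exp_rotated,
      HamSim.exp_oneSparseTerm_eq_one hΥ (Nat.le_zero.1 ((hSq _ _ _ _).trans hC0.le))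
        (hSb _ _ _ _) (hS i.1 i.2 (q t) δ) hH hO, mul_one]
    exact Unitary.star_mul_self_of_mem (O.T i.1).2
  -- Some simulation of a one-sparse Hamiltonian makes a query, hence neutral queries are available.
  have hquery : ∃ μ i q' δ, (S μ i q' δ).numQueries ≠ 0 := by
    by_contra! hno
    refine hC0 (Nat.le_zero.1 (Nat.sInf_le ⟨label, hl, a, fun μ i hi q' δ => ?_⟩))
    exact ⟨S μ ⟨i, hi⟩ q' δ, (hno _ _ _ _).le, hSb _ _ _ _, hS μ ⟨i, hi⟩ q' δ⟩
  obtain ⟨μ₀, i₀, q₀, δ₀, hquery⟩ := hquery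
  let F : HamSim.Circuit n M d nt nH a :=
    HamSim.formulaCircuit (fun t δ μ i => S μ i (q t) δ) j (Δt / r) t₀ r
  have hFq : F.numQueries ≤ 12 * C * M * d ^ 2 * 5 ^ j * r :=
    HamSim.numQueries_formulaCircuit_le (fun t δ μ i => hSq μ i (q t) δ) _ _ _ _
  have hFb : F.numBasisCalls = 4 * M * 5 ^ j * r :=
    HamSim.numBasisCalls_formulaCircuit (fun t δ μ i => hSb μ i (q t) δ) _ _ _ _
  -- is padded up to its bound.
  obtain ⟨P, hPq, hPb, hP⟩ := HamSim.exists_padding_circuit hquery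
    (12 * C * M * d ^ 2 * 5 ^ j * r - F.numQueries)
  have hN : HamSim.Circuit.numQueries (F ++ P) = 12 * C * M * d ^ 2 * 5 ^ j * r := by
    rw [HamSim.Circuit.numQueries] at hPq ⊢
    rw [List.countP_append, hPq]
    exact Nat.add_sub_of_le hFq
  have hN' : HamSim.Circuit.numBasisCalls (F ++ P) = 4 * M * 5 ^ j * r := by
    rw [HamSim.Circuit.numBasisCalls] at hFb hPb ⊢
    rw [List.countP_append, hFb, hPb, add_zero]
  refine ⟨a, F ++ P, hN.le, ?_, fun H O hH _ hs hO hnt U hU => ?_⟩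
  · have hC' : (C : ℝ) ≠ 0 := Nat.cast_ne_zero.2 hC0
    have hd' : (d : ℝ) ≠ 0 := Nat.cast_ne_zero.2 hd0
    rw [hN, hN', le_div_iff₀ (by positivity)]
    push_cast
    exact le_of_eq (by ring)
  · exact ⟨_, (HamSim.implements_formulaCircuit (fun t δ μ i => hS μ i (q t) δ H O hH hO)
      j (Δt / r) t₀ r).append (hP O), by
        rw [one_mul]
        exact HamSim.norm_evolution_sub_oracleFormula_le_tolerance hl hM hd hΔt hΛ hε hr hnH hH hs
          hO hnt hq hU⟩
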